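/- Let $N$ be the dimension and let $\mathbb T^N=\mathbb R^N/\mathbb Z^N$ be the flat torus. Let $f:\mathbb T^N\times[0,\infty)\to\mathbb R$ and $H:\mathbb R^N\to\mathbb R$ be of class $C^3$ (no growth, sign or convexity assumption is made), let $m_0,u_T\in C^2(\mathbb T^N)$ with $m_0>0$ and $\int_{\mathbb T^N}m_0\,dx=1$. For $T>0$ consider the mean field game system $$ \begin{cases} -u_t-\Delta u+H(\nabla u)=-f(x,m) & \text{in } \mathbb T^N\times(0,T),\\ m_t-\Delta m-\operatorname{div}(\nabla H(\nabla u)\,m)=0 & \text{in } \mathbb T^N\times(0,T),\\ m(\cdot,0)=m_0,\quad u(\cdot,T)=u_T & \text{on } \mathbb T^N. \end{cases} $$ A classical solution is a pair $(u,m)$ of functions in $C(\mathbb T^N\times[0,T])\cap C^{2,1}(\mathbb T^N\times(0,T))$ (that is, $u_t,m_t$ and the space derivatives of $u,m$ up to order two exist and are continuous on $\mathbb T^N\times(0,T)$) with $m\ge 0$ that satisfies the system pointwise. Then for every $a>0$ there is $T^*>0$ such that for every $T\in(0,T^*]$ the system has a classical solution $(u,m)$ with $$ |u(x,t)-u_T(x)|\le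 a,\qquad |\nabla u(x,t)-\nabla u_T(x)|\le a,\qquad |m(x,t)-m_0(x)|\le a\qquad\text{for all } (x,t)\in\mathbb T^N\times(0,T), $$ and $(u,m)$ is the only classical solution satisfying these bounds. -/

import Mathlib

open Set MeasureTheory

noncomputable section

/-- A function on `ℝ^N` that is `ℤ^N`-periodic, i.e. a function on the flat torus
`𝕋^N = ℝ^N / ℤ^N`. -/
def IsTorusFun {N : ℕ} {β : Type*} (φ : EuclideanSpace ℝ (Fin N) → β) : Prop :=
  ∀ i : Fin N, Function.Periodic φ (EuclideanSpace.single i (1 : ℝ))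

/-- The unit cube `[0,1)^N`, a fundamental domain of the flat torus; the integral of a function
over the torus is the integral of its periodic lift over this cube. -/
def unitCube (N : ℕ) : Set (EuclideanSpace ℝ (Fin N)) :=
  {x | ∀ i, x i ∈ Ico (0 : ℝ) 1}

/-- The divergence `∑ i, ∂_i V_i` of a vector field on `ℝ^N`. -/
def divergence {N : ℕ} (V : EuclideanSpace ℝ (Fin N) → EuclideanSpace ℝ (Fin N))
    (x : EuclideanSpace ℝ (Fin N)) : ℝ :=
  ∑ i, (fderiv ℝ V x (EuclideanSpace.single i (1 : ℝ))) i

/-- The parabolic class on the open cylinder `𝕋^N × (0,T)`: the function is `ℤ^N`-periodic in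
space and continuous on the closed cylinder `𝕋^N × [0,T]`, and on `𝕋^N × (0,T)` it is of class
`C^{2,1}`: its time derivative and its space derivatives of order at most two exist and are
jointly continuous in `(x,t)`. -/
structure IsClassicalFun {N : ℕ} (T : ℝ) (w : EuclideanSpace ℝ (Fin N) → ℝ → ℝ) : Prop where
  periodic : ∀ t ∈ Icc 0 T, IsTorusFun (fun x => w x t)
  continuous_closed :
    ContinuousOn (fun p : EuclideanSpace ℝ (Fin N) × ℝ => w p.1 p.2) (univ ×ˢ Icc 0 T)
  contDiff_space : ∀ t ∈ Ioo 0 T, ContDiff ℝ 2 (fun x => w x t)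
  differentiable_time : ∀ x, ∀ t ∈ Ioo 0 T, DifferentiableAt ℝ (w x) t
  continuous_deriv_time :
    ContinuousOn (fun p : EuclideanSpace ℝ (Fin N) × ℝ => deriv (w p.1) p.2) (univ ×ˢ Ioo 0 T)
  continuous_deriv_space :
    ContinuousOn (fun p : EuclideanSpace ℝ (Fin N) × ℝ => fderiv ℝ (fun y => w y p.2) p.1)
      (univ ×ˢ Ioo 0 T)
  continuous_deriv_space_two :
    ContinuousOn
      (fun p : EuclideanSpace ℝ (Fin N) × ℝ => iteratedFDeriv ℝ 2 (fun y => w y p.2) p.1)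
      (univ ×ˢ Ioo 0 T)

/-- `(u, m)` is a classical solution on `𝕋^N × (0,T)` of the mean field game system
`-u_t - Δu + H(∇u) = -f(x,m)`, `m_t - Δm - div(m ∇H(∇u)) = 0`, `m(0) = m₀`, `u(T) = u_T`.
Since `f(x, ·)` is only given on `[0, ∞)`, the density `m` takes nonnegative values. -/
structure IsClassicalMFGSolution {N : ℕ}
    (f : EuclideanSpace ℝ (Fin N) → ℝ → ℝ) (H : EuclideanSpace ℝ (Fin N) → ℝ)
    (m₀ uT : EuclideanSpace ℝ (Fin N) → ℝ) (T : ℝ)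
    (u m : EuclideanSpace ℝ (Fin N) → ℝ → ℝ) : Prop where
  classical_u : IsClassicalFun T u
  classical_m : IsClassicalFun T m
  nonneg_m : ∀ x, ∀ t ∈ Icc 0 T, 0 ≤ m x t
  hamiltonJacobi : ∀ x, ∀ t ∈ Ioo 0 T,
    -deriv (u x) t - Laplacian.laplacian (fun y => u y t) x
      + H (gradient (fun y => u y t) x) = -f x (m x t)
  fokkerPlanck : ∀ x, ∀ t ∈ Ioo 0 T,
    deriv (m x) t - Laplacian.laplacian (fun y => m y t) x
      - divergence (fun y => m y t • gradient H (gradient (fun z => u z t) y)) x = 0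
  initial : ∀ x, m x 0 = m₀ x
  terminal : ∀ x, u x T = uT x

/-- For every `t ∈ (0,T)`, `u(·,t)` is `a`-close to `u_T` in `C¹` and `m(·,t)` is `a`-close to
`m₀` in `C⁰`. -/
def IsCloseToData {N : ℕ} (m₀ uT : EuclideanSpace ℝ (Fin N) → ℝ) (T a : ℝ)
    (u m : EuclideanSpace ℝ (Fin N) → ℝ → ℝ) : Prop :=
  ∀ x, ∀ t ∈ Ioo 0 T,
    |u x t - uT x| ≤ a ∧ ‖gradient (fun y => u y t) x - gradient uT x‖ ≤ a ∧ |m x t - m₀ x| ≤ a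

end

/-!
Both parts of the theorem are small-time perturbation arguments; no structure of `f` and `H` beyond
their smoothness enters.

**Existence.** All nonlinearities are truncated: `H` for large gradients, and the coupling `f` and
the flux `m ∇H(∇u)` for densities that are large or below half of the minimum of `m₀`
(`exists_isNonlinearity`). They are then bounded and Lipschitz, and no a priori estimate is needed.
The unknowns are the density `m` and the gradient `p` of the value function in reversed time. They
are sought as a mild solution, that is, as a solution of the Duhamel formulas
`p(t) = e^{tΔ} ∇u_T + ∫₀ᵗ ∇e^{(t-s)Δ} F(s) ds` and `m(t) = e^{tΔ} m₀ + ∫₀ᵗ e^{(t-s)Δ} div B(s) ds`,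
where all derivatives fall on the heat kernel. Its singularity `(t - s)^(-1/2)` is integrable and the
right-hand sides are contractions in the supremum norm once `T` is small (`exists_isMildSolution`).
The convolutions are taken over all of space; periodicity is inherited from the data by uniqueness
of the fixed point.

Mild solutions are classical (`IsMildSolution.exists_isParabolic`): bounded sources give unknowns
that are Hölder continuous in space, a Hölder continuous source makes the unknowns differentiable
in space, the density then solves the heat equation with source `div B`, and that source is Hölder
continuous in space away from the terminal time. The heat equation with a Hölder continuous source
has classical solutions (`isParabolic_heatSolution`).

The Duhamel formulas move the data by at most a multiple of `√T`
(`exists_norm_duhamelHalf_sub_le`). For small `T` the solution therefore stays in the range where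
nothing was truncated, it is close to the data, and the density stays positive, without recourse to
a maximum principle (`exists_isClassicalMFGSolution`).

**Uniqueness.** For two solutions close to the data the values lie in a bounded set on which `f`, `H`
and `∇H` are Lipschitz. Let `y(t)` and `z(t)` be the squared `L²` norms of the differences of the
value functions and of the densities, and `Z(t)` that of the difference of the gradients. Energy
estimates give `y' ≥ Z - C (y + z)` and `z' ≤ C (z + Z)` (`IsParabolic.le_integral_of_backward`,
`IsParabolic.integral_le_of_forward`), with `y(T) = 0` and `z(0) = 0`. The term `Z` cancels in
`z' - C y'`, and integration from the two ends shows that `y` and `z` vanish if `T` is small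
(`eq_zero_of_forward_backward`). The integrations by parts rest on the translation invariance of
integrals over the torus (`integral_mul_basisTrace`).
-/

open Filter Topology

set_option linter.unusedSectionVars false

noncomputable section

/-! ### Averages against rapidly decaying kernels -/

section Kernels

variable {E : Type*} [NormedAddCommGroup E] [InnerProductSpace ℝ E] [FiniteDimensional ℝ E]
  [MeasurableSpace E] [BorelSpace E]
variable {V W : Type*} [NormedAddCommGroup V] [NormedSpace ℝ V]
  [NormedAddCommGroup W] [NormedSpace ℝ W]

/-- A continuous map that is dominated by a Gaussian. -/
def GaussianDecay (K : E → V) : Prop :=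
  Continuous K ∧ ∃ C, ∀ z, ‖K z‖ ≤ C * Real.exp (-‖z‖ ^ 2 / 8)

/-- A `C¹` kernel that is dominated by a Gaussian together with its derivative. -/
structure IsGoodKernel (K : E → V) : Prop where
  contDiff : ContDiff ℝ 1 K
  decay : GaussianDecay K
  decay_fderiv : GaussianDecay (fderiv ℝ K)

theorem integrable_exp_neg_norm_sq_div {b : ℝ} (hb : 0 < b) :
    Integrable (fun z : E => Real.exp (-‖z‖ ^ 2 / b)) := by
  have h := GaussianFourier.integrable_cexp_neg_mul_sq_norm_add (V := E) (b := ((1 / b : ℝ) : ℂ))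
    (by simpa using hb) 0 0
  refine (h.norm).congr (Eventually.of_forall fun z => ?_)
  simp only [Complex.norm_exp]
  congr 1
  simp only [inner_zero_left, Complex.ofReal_zero, mul_zero, add_zero]
  rw [← Complex.ofReal_pow, ← Complex.ofReal_neg, ← Complex.ofReal_mul, Complex.ofReal_re]
  ring

theorem GaussianDecay.exists_pos {K : E → V} (hK : GaussianDecay K) :
    ∃ C, 0 < C ∧ ∀ z, ‖K z‖ ≤ C * Real.exp (-‖z‖ ^ 2 / 8) := by
  obtain ⟨C, hC⟩ := hK.2
  refine ⟨|C| + 1, by positivity, fun z => (hC z).trans ?_⟩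
  gcongr
  linarith [le_abs_self C]

theorem GaussianDecay.integrable {K : E → V} (hK : GaussianDecay K) : Integrable K := by
  obtain ⟨C, hC⟩ := hK.2
  exact ((integrable_exp_neg_norm_sq_div (E := E) (b := 8) (by norm_num)).const_mul C).mono'
    hK.1.aestronglyMeasurable (Eventually.of_forall hC)

theorem one_add_le_exp_sq (r : ℝ) : 1 + r ≤ 20 * Real.exp (r ^ 2 / 16) := by
  have := Real.add_one_le_exp (r ^ 2 / 16)
  nlinarith [sq_nonneg (r - 1)]

theorem GaussianDecay.integrable_mul_sqrt {K : E → V} (hK : GaussianDecay K) :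
    Integrable (fun z => ‖K z‖ * √‖z‖) := by
  obtain ⟨C, hC0, hC⟩ := hK.exists_pos
  refine ((integrable_exp_neg_norm_sq_div (E := E) (b := 16) (by norm_num)).const_mul
    (C * 20)).mono' (hK.1.norm.mul (continuous_norm.sqrt)).aestronglyMeasurable
    (Eventually.of_forall fun z => ?_)
  have h1 : √‖z‖ ≤ 20 * Real.exp (‖z‖ ^ 2 / 16) := by
    refine le_trans ?_ (one_add_le_exp_sq ‖z‖)
    rw [Real.sqrt_le_left (by positivity)]
    nlinarith [norm_nonneg z]
  rw [Real.norm_of_nonneg (by positivity)]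
  calc ‖K z‖ * √‖z‖ ≤ (C * Real.exp (-‖z‖ ^ 2 / 8)) * (20 * Real.exp (‖z‖ ^ 2 / 16)) := by
        gcongr; exact hC z
    _ = C * 20 * (Real.exp (-‖z‖ ^ 2 / 8) * Real.exp (‖z‖ ^ 2 / 16)) := by ring
    _ = C * 20 * Real.exp (-‖z‖ ^ 2 / 16) := by
        rw [← Real.exp_add]; congr 2; ring

theorem exp_neg_sub_sq_le (z η : E) (hη : ‖η‖ ≤ 1) :
    Real.exp (-‖z - η‖ ^ 2 / 8) ≤ Real.exp (1 / 8) * Real.exp (-‖z‖ ^ 2 / 16) := by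
  rw [← Real.exp_add]
  apply Real.exp_le_exp.2
  have h := norm_sub_norm_le z η
  have h2 : ‖z‖ ≤ ‖z - η‖ + 1 := by linarith
  have h3 : ‖z‖ ^ 2 ≤ (‖z - η‖ + 1) ^ 2 := by gcongr
  nlinarith [sq_nonneg (‖z - η‖ - 1)]

/-- The average `∫ K(z) φ(x + l z) dz` of a function `φ` at scale `l` around the point `x`, against
an operator-valued kernel. The heat semigroup is the case of the Gaussian kernel and `l = √t`. -/
def kernelAvg (K : E → W →L[ℝ] V) (l : ℝ) (φ : E → W) (x : E) : V :=
  ∫ z, K z (φ (x + l • z))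

/-- The kernel of the derivative of `kernelAvg K l φ`, see `hasFDerivAt_kernelAvg`. -/
def derivKernel (K : E → W →L[ℝ] V) (z : E) : W →L[ℝ] (E →L[ℝ] V) :=
  -(fderiv ℝ K z).flip

theorem norm_derivKernel (K : E → W →L[ℝ] V) (z : E) : ‖derivKernel K z‖ = ‖fderiv ℝ K z‖ := by
  exact (norm_neg (fderiv ℝ K z).flip).trans (ContinuousLinearMap.opNorm_flip _)

theorem IsGoodKernel.decay_derivKernel {K : E → W →L[ℝ] V} (hK : IsGoodKernel K) :
    GaussianDecay (derivKernel K) := by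
  refine ⟨?_, ?_⟩
  · have := (ContinuousLinearMap.flipₗᵢ ℝ E W V).continuous.comp hK.decay_fderiv.1
    exact this.neg
  · obtain ⟨C, hC⟩ := hK.decay_fderiv.2
    exact ⟨C, fun z => by rw [norm_derivKernel]; exact hC z⟩

theorem integrable_kernelAvg {K : E → W →L[ℝ] V} (hK : GaussianDecay K) {φ : E → W}
    (hφ : Continuous φ) {M : ℝ} (hM : ∀ x, ‖φ x‖ ≤ M) (l : ℝ) (x : E) :
    Integrable (fun z => K z (φ (x + l • z))) := by
  refine (hK.integrable.norm.mul_const M).mono' ?_ (Eventually.of_forall fun z => ?_)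
  · exact (hK.1.clm_apply (hφ.comp (by fun_prop))).aestronglyMeasurable
  · exact (K z).le_opNorm_of_le (hM _)

theorem norm_kernelAvg_le {K : E → W →L[ℝ] V} (hK : GaussianDecay K) {φ : E → W}
    {M : ℝ} (hM : ∀ x, ‖φ x‖ ≤ M) (l : ℝ) (x : E) :
    ‖kernelAvg K l φ x‖ ≤ (∫ z, ‖K z‖) * M := by
  rw [← integral_mul_const]
  exact norm_integral_le_of_norm_le (hK.integrable.norm.mul_const M)
    (Eventually.of_forall fun z => (K z).le_opNorm_of_le (hM _))

theorem continuous_kernelAvg {X : Type*} [TopologicalSpace X] [FirstCountableTopology X]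
    {K : E → W →L[ℝ] V} (hK : GaussianDecay K) {F : X → E → W}
    (hF : Continuous (Function.uncurry F)) {M : ℝ} (hM : ∀ q x, ‖F q x‖ ≤ M)
    {l : X → ℝ} (hl : Continuous l) {x : X → E} (hx : Continuous x) :
    Continuous (fun q => kernelAvg K (l q) (F q) (x q)) := by
  refine continuous_of_dominated (bound := fun z => ‖K z‖ * M) (fun q => ?_) (fun q => ?_)
    (hK.integrable.norm.mul_const M) (Eventually.of_forall fun z => ?_)
  · have : Continuous (F q) := hF.comp (Continuous.prodMk_right q)
    exact (hK.1.clm_apply (this.comp (by fun_prop))).aestronglyMeasurable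
  · exact Eventually.of_forall fun z => (K z).le_opNorm_of_le (hM _ _)
  · exact (K z).continuous.comp (hF.comp (by fun_prop : Continuous fun q => (q, x q + l q • z)))

theorem kernelAvg_sub {K : E → W →L[ℝ] V} (hK : GaussianDecay K) {φ ψ : E → W}
    (hφ : Continuous φ) {M : ℝ} (hM : ∀ x, ‖φ x‖ ≤ M)
    (hψ : Continuous ψ) {M' : ℝ} (hM' : ∀ x, ‖ψ x‖ ≤ M') (l : ℝ) (x : E) :
    kernelAvg K l φ x - kernelAvg K l ψ x = kernelAvg K l (fun y => φ y - ψ y) x := by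
  simp only [kernelAvg, map_sub]
  rw [integral_sub (integrable_kernelAvg hK hφ hM l x) (integrable_kernelAvg hK hψ hM' l x)]

theorem kernelAvg_zero (K : E → W →L[ℝ] V) (φ : E → W) (x : E) :
    kernelAvg K 0 φ x = ∫ z, K z (φ x) := by
  simp [kernelAvg]

/-- Unit scale case of `hasFDerivAt_kernelAvg`: move the translation onto the kernel and
differentiate under the integral sign. -/
theorem hasFDerivAt_integral_kernel_translate {K : E → W →L[ℝ] V} (hK : IsGoodKernel K) {φ : E → W}
    (hφ : Continuous φ) {M : ℝ} (hM : ∀ x, ‖φ x‖ ≤ M) (ξ : E) :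
    HasFDerivAt (fun ξ => ∫ z, K z (φ (ξ + z))) (∫ z, derivKernel K z (φ (ξ + z))) ξ := by
  have hM0 : 0 ≤ M := (norm_nonneg _).trans (hM 0)
  have key : ∀ ξ, ∫ z, K z (φ (ξ + z)) = ∫ y, K (y - ξ) (φ y) := fun ξ => by
    rw [← integral_add_right_eq_self (fun y => K (y - ξ) (φ y)) ξ]
    simp [add_comm]
  have key2 : ∫ z, derivKernel K z (φ (ξ + z)) = ∫ y, derivKernel K (y - ξ) (φ y) := by
    rw [← integral_add_right_eq_self (fun y => derivKernel K (y - ξ) (φ y)) ξ]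
    simp [add_comm]
  simp only [key, key2]
  obtain ⟨C, hC0, hC⟩ := hK.decay_fderiv.exists_pos
  have hKd : Differentiable ℝ K := hK.contDiff.differentiable (by norm_num)
  have hint : ∀ ξ, Integrable (fun y => K (y - ξ) (φ y)) := fun ξ => by
    refine ((hK.decay.integrable.comp_sub_right ξ).norm.mul_const M).mono' ?_
      (Eventually.of_forall fun z => (K _).le_opNorm_of_le (hM _))
    exact ((hK.decay.1.comp (by fun_prop)).clm_apply hφ).aestronglyMeasurable
  refine hasFDerivAt_integral_of_dominated_of_fderiv_le
    (F := fun ξ y => K (y - ξ) (φ y))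
    (F' := fun ξ y => derivKernel K (y - ξ) (φ y))
    (bound := fun y => C * M * Real.exp (1 / 8) * Real.exp (-‖y - ξ‖ ^ 2 / 16))
    (Metric.ball_mem_nhds ξ one_pos) (Eventually.of_forall fun ξ => (hint ξ).1) (hint ξ) ?_ ?_ ?_ ?_
  · exact ((hK.decay_derivKernel.1.comp (by fun_prop)).clm_apply hφ).aestronglyMeasurable
  · refine Eventually.of_forall fun y ξ' hξ' => ?_
    have h1 : ‖derivKernel K (y - ξ') (φ y)‖ ≤ ‖fderiv ℝ K (y - ξ')‖ * M := by
      rw [← norm_derivKernel]; exact (derivKernel K _).le_opNorm_of_le (hM _)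
    have h2 := exp_neg_sub_sq_le (y - ξ) (ξ' - ξ) (by
      rw [Metric.mem_ball, dist_eq_norm] at hξ'; exact hξ'.le)
    rw [sub_sub_sub_cancel_right] at h2
    calc _ ≤ _ := h1
      _ ≤ (C * Real.exp (-‖y - ξ'‖ ^ 2 / 8)) * M := by gcongr; exact hC _
      _ ≤ (C * (Real.exp (1 / 8) * Real.exp (-‖y - ξ‖ ^ 2 / 16))) * M := by gcongr
      _ = _ := by ring
  · exact ((integrable_exp_neg_norm_sq_div (E := E) (b := 16) (by norm_num)).comp_sub_right
      ξ).const_mul _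
  · refine Eventually.of_forall fun y ξ' _ => ?_
    have h1 : HasFDerivAt (fun ξ : E => y - ξ) (-(ContinuousLinearMap.id ℝ E)) ξ' :=
      (hasFDerivAt_id ξ').const_sub y
    have h2 := ((hKd (y - ξ')).hasFDerivAt.comp ξ' h1).clm_apply (hasFDerivAt_const (φ y) ξ')
    exact h2.congr_fderiv (ContinuousLinearMap.ext fun v => by simp [derivKernel])

theorem hasFDerivAt_kernelAvg {K : E → W →L[ℝ] V} (hK : IsGoodKernel K) {φ : E → W}
    (hφ : Continuous φ) {M : ℝ} (hM : ∀ x, ‖φ x‖ ≤ M) {l : ℝ} (hl : l ≠ 0) (x : E) :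
    HasFDerivAt (kernelAvg K l φ) (l⁻¹ • kernelAvg (derivKernel K) l φ x) x := by
  have h1 := hasFDerivAt_integral_kernel_translate hK (φ := fun y => φ (l • y))
    (hφ.comp (by fun_prop)) (fun x => hM _) (l⁻¹ • x)
  have h2 : HasFDerivAt (fun x : E => l⁻¹ • x) (l⁻¹ • ContinuousLinearMap.id ℝ E) x :=
    (hasFDerivAt_id x).const_smul l⁻¹
  have h3 := h1.comp x h2
  simp only [smul_add, smul_inv_smul₀ hl] at h3
  convert h3 using 1
  · ext x
    simp [kernelAvg, smul_inv_smul₀ hl]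
  · ext v
    simp [kernelAvg]

/-- The derivative of a kernel has vanishing integral: it is what turns Hölder continuity of `φ`
into a gain in `kernelAvg (derivKernel K) l φ` at small scale `l`. -/
theorem integral_derivKernel_apply [CompleteSpace V] {K : E → W →L[ℝ] V} (hK : IsGoodKernel K)
    (w : W) : ∫ z, derivKernel K z w = 0 := by
  have h := hasFDerivAt_integral_kernel_translate hK (φ := fun _ => w) continuous_const
    (M := ‖w‖) (fun _ => le_rfl) 0
  exact h.unique (hasFDerivAt_const _ _)

/-- A Hölder continuous `φ` gains the factor `√l` over the trivial bound, which makes the singularity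
`t⁻¹` of the second derivatives of the heat semigroup integrable after the substitution `l = √t`. -/
theorem norm_kernelAvg_derivKernel_le [CompleteSpace V] {K : E → W →L[ℝ] V} (hK : IsGoodKernel K)
    {φ : E → W} (hφ : Continuous φ) {M : ℝ} (hM : ∀ x, ‖φ x‖ ≤ M) {H : ℝ}
    (hH : ∀ x y, ‖φ x - φ y‖ ≤ H * √‖x - y‖) {l : ℝ} (hl : 0 ≤ l) (x : E) :
    ‖kernelAvg (derivKernel K) l φ x‖ ≤ (∫ z, ‖derivKernel K z‖ * √‖z‖) * (H * √l) := by
  have h0 : kernelAvg (derivKernel K) l φ x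
      = ∫ z, derivKernel K z (φ (x + l • z) - φ x) := by
    simp only [map_sub]
    rw [integral_sub (integrable_kernelAvg hK.decay_derivKernel hφ hM l x),
      integral_derivKernel_apply hK, sub_zero, kernelAvg]
    simpa using integrable_kernelAvg hK.decay_derivKernel hφ hM 0 x
  rw [h0, ← integral_mul_const]
  refine norm_integral_le_of_norm_le (hK.decay_derivKernel.integrable_mul_sqrt.mul_const _)
    (Eventually.of_forall fun z => ?_)
  have h1 := hH (x + l • z) x
  rw [add_sub_cancel_left, norm_smul, Real.norm_of_nonneg hl, Real.sqrt_mul hl] at h1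
  calc _ ≤ ‖derivKernel K z‖ * (H * (√l * √‖z‖)) := (derivKernel K z).le_opNorm_of_le h1
    _ = _ := by ring

/-- Translation is Hölder continuous of exponent `1/2` in `L¹` on good kernels. Short translations are
controlled by the derivative of the kernel and long ones by the trivial bound. -/
theorem integral_norm_translate_sub_le {K : E → V} (hK : IsGoodKernel K) :
    ∃ C, 0 ≤ C ∧ ∀ η, ∫ z, ‖K (z - η) - K z‖ ≤ C * √‖η‖ := by
  obtain ⟨C, hC0, hC⟩ := hK.decay_fderiv.exists_pos
  have hKd : Differentiable ℝ K := hK.contDiff.differentiable (by norm_num)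
  have hi16 := integrable_exp_neg_norm_sq_div (E := E) (b := 16) (by norm_num)
  set A := ∫ z, ‖K z‖ with hA
  set B := C * Real.exp (1 / 8) * ∫ z : E, Real.exp (-‖z‖ ^ 2 / 16) with hB
  have hA0 : 0 ≤ A := by rw [hA]; positivity
  have hB0 : 0 ≤ B := mul_nonneg (by positivity) (integral_nonneg fun z => (Real.exp_pos _).le)
  refine ⟨2 * A + B, by positivity, fun η => ?_⟩
  rcases le_total ‖η‖ 1 with hη | hη
  · have h1 : ∫ z, ‖K (z - η) - K z‖ ≤ ∫ z : E, ‖η‖ * (C * Real.exp (1 / 8) *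
        Real.exp (-‖z‖ ^ 2 / 16)) := by
      refine integral_mono ((hK.decay.integrable.comp_sub_right η).sub hK.decay.integrable).norm
        ((hi16.const_mul _).const_mul _) fun z => ?_
      have hseg : ∀ y ∈ segment ℝ z (z - η), ‖fderiv ℝ K y‖ ≤
          C * Real.exp (1 / 8) * Real.exp (-‖z‖ ^ 2 / 16) := by
        rintro y hy
        rw [segment_eq_image'] at hy
        obtain ⟨θ, hθ, rfl⟩ := hy
        have h2 := exp_neg_sub_sq_le z (θ • η) (by
          rw [norm_smul, Real.norm_of_nonneg hθ.1]
          exact mul_le_one₀ hθ.2 (norm_nonneg _) hη)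
        have h3 : z + θ • (z - η - z) = z - θ • η := by
          rw [sub_sub_cancel_left, smul_neg, sub_eq_add_neg]
        simp only [h3]
        refine (hC _).trans ?_
        rw [mul_assoc]
        gcongr
      have := (convex_segment z (z - η)).norm_image_sub_le_of_norm_fderiv_le
        (fun y _ => hKd y) hseg (left_mem_segment ℝ _ _) (right_mem_segment ℝ _ _)
      rw [sub_sub_cancel_left, norm_neg] at this
      simpa [mul_comm] using this
    rw [integral_const_mul, integral_const_mul, ← hB] at h1
    have h2 : ‖η‖ ≤ √‖η‖ := by
      apply Real.le_sqrt_of_sq_le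
      nlinarith [norm_nonneg η]
    calc _ ≤ _ := h1
      _ ≤ √‖η‖ * B := by gcongr
      _ ≤ _ := by nlinarith [mul_nonneg hA0 (Real.sqrt_nonneg ‖η‖)]
  · have h1 : ∫ z, ‖K (z - η) - K z‖ ≤ ∫ z, (‖K (z - η)‖ + ‖K z‖) :=
      integral_mono ((hK.decay.integrable.comp_sub_right η).sub hK.decay.integrable).norm
        ((hK.decay.integrable.comp_sub_right η).norm.add hK.decay.integrable.norm)
        fun z => norm_sub_le _ _
    rw [integral_add (hK.decay.integrable.comp_sub_right η).norm hK.decay.integrable.norm,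
      integral_sub_right_eq_self (fun z => ‖K z‖) η, ← hA] at h1
    have h2 : 1 ≤ √‖η‖ := Real.one_le_sqrt.2 hη
    calc _ ≤ 2 * A := by linarith
      _ ≤ 2 * A * √‖η‖ := le_mul_of_one_le_right (by positivity) h2
      _ ≤ _ := by nlinarith [mul_nonneg hB0 (Real.sqrt_nonneg ‖η‖)]

/-- Averages of bounded functions are Hölder continuous of exponent `1/2`, with a constant that
degenerates as `l ^ (-1/2)` at small scale. -/
theorem norm_kernelAvg_sub_le {K : E → W →L[ℝ] V} (hK : IsGoodKernel K) :
    ∃ C, 0 ≤ C ∧ ∀ (φ : E → W) (M : ℝ), Continuous φ → (∀ x, ‖φ x‖ ≤ M) → ∀ l, 0 < l → ∀ x y,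
      ‖kernelAvg K l φ x - kernelAvg K l φ y‖ ≤ C * M * (√‖x - y‖ / √l) := by
  obtain ⟨C, hC0, hC⟩ := integral_norm_translate_sub_le hK
  refine ⟨C, hC0, fun φ M hφ hM l hl x y => ?_⟩
  have hM0 : 0 ≤ M := (norm_nonneg _).trans (hM 0)
  set η := l⁻¹ • (x - y) with hη
  have hηn : √‖η‖ = √‖x - y‖ / √l := by
    rw [hη, norm_smul, norm_inv, Real.norm_of_nonneg hl.le, ← Real.sqrt_div' _ hl.le]
    congr 1; field_simp
  have h1 : kernelAvg K l φ x = ∫ z, K (z - η) (φ (y + l • z)) := by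
    rw [← integral_add_right_eq_self (fun z => K (z - η) (φ (y + l • z))) η, kernelAvg]
    congr 1; ext z
    rw [add_sub_cancel_right, smul_add, hη, smul_inv_smul₀ hl.ne']
    congr 2; abel
  have hint1 : Integrable (fun z => K (z - η) (φ (y + l • z))) := by
    refine ((hK.decay.integrable.comp_sub_right η).norm.mul_const M).mono' ?_
      (Eventually.of_forall fun z => (K _).le_opNorm_of_le (hM _))
    exact ((hK.decay.1.comp (by fun_prop)).clm_apply (hφ.comp (by fun_prop))).aestronglyMeasurable
  rw [h1, kernelAvg, ← integral_sub hint1 (integrable_kernelAvg hK.decay hφ hM l y)]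
  calc _ ≤ ∫ z, ‖K (z - η) - K z‖ * M := by
        refine norm_integral_le_of_norm_le
          (((hK.decay.integrable.comp_sub_right η).sub hK.decay.integrable).norm.mul_const M)
          (Eventually.of_forall fun z => ?_)
        rw [← sub_apply]
        exact (K (z - η) - K z).le_opNorm_of_le (hM _)
    _ = (∫ z, ‖K (z - η) - K z‖) * M := integral_mul_const _ _
    _ ≤ C * √‖η‖ * M := by gcongr; exact hC η
    _ = _ := by rw [hηn]; ring

/-- For a differentiable `φ` the derivative of the average is the average of the derivative. -/
theorem hasFDerivAt_kernelAvg_of_hasFDerivAt {K : E → W →L[ℝ] V} (hK : GaussianDecay K) {φ : E → W}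
    {φ' : E → E →L[ℝ] W} (hφ : ∀ x, HasFDerivAt φ (φ' x) x) {M : ℝ} (hM : ∀ x, ‖φ x‖ ≤ M)
    (hφ' : Continuous φ') {M' : ℝ} (hM' : ∀ x, ‖φ' x‖ ≤ M') (l : ℝ) (x : E) :
    HasFDerivAt (kernelAvg K l φ) (∫ z, (K z).comp (φ' (x + l • z))) x := by
  have hφc : Continuous φ := continuous_iff_continuousAt.2 fun x => (hφ x).continuousAt
  refine hasFDerivAt_integral_of_dominated_of_fderiv_le
    (F := fun x z => K z (φ (x + l • z)))
    (F' := fun x z => (K z).comp (φ' (x + l • z)))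
    (bound := fun z => ‖K z‖ * M') univ_mem
    (Eventually.of_forall fun y => (integrable_kernelAvg hK hφc hM l y).1)
    (integrable_kernelAvg hK hφc hM l x) ?_ ?_ (hK.integrable.norm.mul_const M') ?_
  · exact (hK.1.clm_comp (hφ'.comp (by fun_prop))).aestronglyMeasurable
  · exact Eventually.of_forall fun z y _ => ((K z).opNorm_comp_le _).trans (by gcongr; exact hM' _)
  · refine Eventually.of_forall fun z y _ => ?_
    have h1 : HasFDerivAt (fun y : E => y + l • z) (ContinuousLinearMap.id ℝ E) y :=
      (hasFDerivAt_id y).add_const _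
    have h2 := (K z).hasFDerivAt.comp y ((hφ (y + l • z)).comp y h1)
    simpa [Function.comp_def] using h2

/-- Integration by parts: the derivative on the kernel can be moved onto `φ`. -/
theorem kernelAvg_derivKernel_apply {K : E → W →L[ℝ] V} (hK : IsGoodKernel K) {φ : E → W}
    {φ' : E → E →L[ℝ] W} (hφ : ∀ x, HasFDerivAt φ (φ' x) x) {M : ℝ} (hM : ∀ x, ‖φ x‖ ≤ M)
    (hφ' : Continuous φ') {M' : ℝ} (hM' : ∀ x, ‖φ' x‖ ≤ M') {l : ℝ} (hl : l ≠ 0) (x e : E) :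
    l⁻¹ • kernelAvg (derivKernel K) l φ x e = kernelAvg K l (fun y => φ' y e) x := by
  have hφc : Continuous φ := continuous_iff_continuousAt.2 fun x => (hφ x).continuousAt
  have h := (hasFDerivAt_kernelAvg hK hφc hM hl x).unique
    (hasFDerivAt_kernelAvg_of_hasFDerivAt hK.decay hφ hM hφ' hM' l x)
  have h2 := congrArg (fun A => A e) h
  simp only [smul_apply] at h2
  rw [h2, ContinuousLinearMap.integral_apply, kernelAvg]
  · rfl
  · refine (hK.decay.integrable.norm.mul_const M').mono'
      (hK.decay.1.clm_comp (hφ'.comp (by fun_prop))).aestronglyMeasurable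
      (Eventually.of_forall fun z => ((K z).opNorm_comp_le _).trans (by gcongr; exact hM' _))

end Kernels

/-! ### The heat kernel and its derivatives -/

section HeatKernel

variable {E : Type*} [NormedAddCommGroup E] [InnerProductSpace ℝ E] [FiniteDimensional ℝ E]
  [MeasurableSpace E] [BorelSpace E]
variable {V W : Type*} [NormedAddCommGroup V] [NormedSpace ℝ V]
  [NormedAddCommGroup W] [NormedSpace ℝ W]

open Module (finrank)

/-- The heat kernel at time one. -/
def gaussKer (z : E) : ℝ :=
  (4 * Real.pi) ^ (-(finrank ℝ E / 2 : ℝ)) * Real.exp (-‖z‖ ^ 2 / 4)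

theorem gaussKer_pos (z : E) : 0 < gaussKer z := by
  unfold gaussKer; positivity

theorem integral_gaussKer : ∫ z : E, gaussKer z = 1 := by
  have h := GaussianFourier.integral_rexp_neg_mul_sq_norm (V := E) (b := 1 / 4) (by norm_num)
  have h2 : ∀ z : E, Real.exp (-‖z‖ ^ 2 / 4) = Real.exp (-(1 / 4) * ‖z‖ ^ 2) := fun z => by
    congr 1; ring
  simp only [gaussKer, integral_const_mul, h2, h]
  rw [show Real.pi / (1 / 4) = 4 * Real.pi by ring, ← Real.rpow_add (by positivity)]
  simp

theorem hasFDerivAt_gaussKer (z : E) :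
    HasFDerivAt (gaussKer (E := E)) (-(1 / 2 * gaussKer z) • innerSL ℝ z) z := by
  have h1 : HasFDerivAt (fun z : E => -‖z‖ ^ 2 / 4) (-(1 / 2 : ℝ) • innerSL ℝ z) z := by
    have := ((hasStrictFDerivAt_norm_sq z).hasFDerivAt.neg).const_mul (1 / 4)
    refine (this.congr_of_eventuallyEq (Eventually.of_forall fun y => ?_)).congr_fderiv ?_
    · simp; ring
    · ext v; simp; ring
  refine (h1.exp.const_mul ((4 * Real.pi) ^ (-(finrank ℝ E / 2 : ℝ)))).congr_fderiv ?_
  ext v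
  simp [gaussKer]
  ring

theorem contDiff_gaussKer : ContDiff ℝ 1 (gaussKer (E := E)) :=
  contDiff_const.mul ((contDiff_norm_sq ℝ).neg.div_const 4).exp

theorem norm_sq_mul_gaussKer_le (z : E) :
    (1 + ‖z‖ ^ 2) * gaussKer z ≤
      8 * (4 * Real.pi) ^ (-(finrank ℝ E / 2 : ℝ)) * Real.exp (-‖z‖ ^ 2 / 8) := by
  have h : 1 + ‖z‖ ^ 2 ≤ 8 * Real.exp (‖z‖ ^ 2 / 8) := by
    have := Real.add_one_le_exp (‖z‖ ^ 2 / 8)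
    nlinarith
  have h2 : Real.exp (-‖z‖ ^ 2 / 8) = Real.exp (‖z‖ ^ 2 / 8) * Real.exp (-‖z‖ ^ 2 / 4) := by
    rw [← Real.exp_add]; congr 1; ring
  rw [gaussKer, h2]
  calc _ ≤ 8 * Real.exp (‖z‖ ^ 2 / 8) *
        ((4 * Real.pi) ^ (-(finrank ℝ E / 2 : ℝ)) * Real.exp (-‖z‖ ^ 2 / 4)) := by gcongr
    _ = _ := by ring

/-- A continuous map bounded by a multiple of `(1 + |z|²)` times the heat kernel has Gaussian decay:
half of the exponent absorbs the polynomial factor. -/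
theorem gaussianDecay_of_norm_le {K : E → V} (hK : Continuous K) {C : ℝ} (hC : 0 ≤ C)
    (h : ∀ z, ‖K z‖ ≤ C * ((1 + ‖z‖ ^ 2) * gaussKer z)) : GaussianDecay K := by
  refine ⟨hK, C * (8 * (4 * Real.pi) ^ (-(finrank ℝ E / 2 : ℝ))), fun z => (h z).trans ?_⟩
  rw [mul_assoc C]
  exact mul_le_mul_of_nonneg_left (norm_sq_mul_gaussKer_le z) hC

theorem IsGoodKernel.clm_comp {K : E → V} (hK : IsGoodKernel K) (A : V →L[ℝ] W) :
    IsGoodKernel (fun z => A (K z)) := by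
  have hf : fderiv ℝ (fun z => A (K z)) = fun z => A.comp (fderiv ℝ K z) := by
    ext1 z
    exact (A.hasFDerivAt.comp z
      ((hK.contDiff.differentiable (by norm_num)) z).hasFDerivAt).fderiv
  refine ⟨A.contDiff.comp hK.contDiff, ⟨A.continuous.comp hK.decay.1, ?_⟩, ?_, ?_⟩
  · obtain ⟨C, hC⟩ := hK.decay.2
    refine ⟨‖A‖ * C, fun z => ?_⟩
    rw [mul_assoc]
    exact A.le_opNorm_of_le (hC z)
  · rw [hf]
    exact continuous_const.clm_comp hK.decay_fderiv.1
  · obtain ⟨C, hC⟩ := hK.decay_fderiv.2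
    refine ⟨‖A‖ * C, fun z => ?_⟩
    rw [mul_assoc, hf]
    exact (A.opNorm_comp_le _).trans (by gcongr; exact hC z)

theorem continuous_gaussKer : Continuous (gaussKer (E := E)) := contDiff_gaussKer.continuous

theorem norm_fderiv_gaussKer_le (z : E) : ‖fderiv ℝ gaussKer z‖ ≤ ‖z‖ * gaussKer z := by
  rw [(hasFDerivAt_gaussKer z).fderiv]
  refine (norm_smul_le (-(1 / 2 * gaussKer z)) (innerSL ℝ z)).trans ?_
  rw [innerSL_apply_norm, norm_neg, Real.norm_of_nonneg (by have := gaussKer_pos z; positivity)]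
  nlinarith [mul_nonneg (norm_nonneg z) (gaussKer_pos z).le]

theorem isGoodKernel_gaussKer : IsGoodKernel (gaussKer (E := E)) := by
  refine ⟨contDiff_gaussKer, ?_, ?_⟩
  · refine gaussianDecay_of_norm_le continuous_gaussKer zero_le_one fun z => ?_
    have := gaussKer_pos z
    rw [Real.norm_of_nonneg this.le]
    nlinarith [mul_nonneg (sq_nonneg ‖z‖) this.le]
  · refine gaussianDecay_of_norm_le (contDiff_gaussKer.continuous_fderiv (by norm_num)) zero_le_one
      fun z => (norm_fderiv_gaussKer_le z).trans ?_
    rw [one_mul]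
    have := gaussKer_pos z
    gcongr
    nlinarith [sq_nonneg (‖z‖ - 1)]

theorem hasFDerivAt_gaussKer_smul (z : E) :
    HasFDerivAt (fun z : E => gaussKer z • z) (gaussKer z • ContinuousLinearMap.id ℝ E +
      ((-(1 / 2 * gaussKer z) • innerSL ℝ z) : E →L[ℝ] ℝ).smulRight z) z :=
  (hasFDerivAt_gaussKer z).smul (hasFDerivAt_id z)

theorem isGoodKernel_gaussKer_smul : IsGoodKernel (fun z : E => gaussKer z • z) := by
  have hd : ContDiff ℝ 1 (fun z : E => gaussKer z • z) := contDiff_gaussKer.smul contDiff_id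
  refine ⟨hd, ?_, ?_⟩
  · refine gaussianDecay_of_norm_le hd.continuous zero_le_one fun z => ?_
    have := gaussKer_pos z
    rw [norm_smul, Real.norm_of_nonneg this.le, mul_comm, one_mul]
    gcongr
    nlinarith [sq_nonneg (‖z‖ - 1)]
  · refine gaussianDecay_of_norm_le (hd.continuous_fderiv (by norm_num)) zero_le_one
      fun z => ?_
    have h0 := gaussKer_pos z
    rw [(hasFDerivAt_gaussKer_smul z).fderiv]
    refine (norm_add_le _ _).trans ?_
    rw [ContinuousLinearMap.norm_smulRight_apply]
    have h1 : ‖gaussKer z • ContinuousLinearMap.id ℝ E‖ ≤ gaussKer z * 1 := by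
      refine (norm_smul_le (gaussKer z) (ContinuousLinearMap.id ℝ E)).trans ?_
      rw [Real.norm_of_nonneg h0.le]
      gcongr
      exact ContinuousLinearMap.norm_id_le
    have h2 : ‖(-(1 / 2 * gaussKer z) • innerSL ℝ z : E →L[ℝ] ℝ)‖ ≤ ‖z‖ * gaussKer z := by
      rw [← (hasFDerivAt_gaussKer z).fderiv]
      exact norm_fderiv_gaussKer_le z
    calc _ ≤ gaussKer z * 1 + (‖z‖ * gaussKer z) * ‖z‖ := by gcongr
      _ = _ := by ring

/-- The kernel of the heat semigroup acting on `W`-valued functions. -/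
def heatKer (W : Type*) [NormedAddCommGroup W] [NormedSpace ℝ W] (z : E) : W →L[ℝ] W :=
  gaussKer z • ContinuousLinearMap.id ℝ W

/-- Minus the gradient of the Gaussian, paired with vectors: up to the factor `t^(-1/2)`,
the kernel of `e^{tΔ} div`. -/
def divKer (z : E) : E →L[ℝ] ℝ := (1 / 2 : ℝ) • innerSL ℝ (gaussKer z • z)

/-- The identification of vectors with linear maps defined on scalars. -/
def smulCLM (V : Type*) [NormedAddCommGroup V] [NormedSpace ℝ V] : V →L[ℝ] (ℝ →L[ℝ] V) :=
  (ContinuousLinearMap.lsmul ℝ ℝ).flip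

/-- Minus the gradient of the Gaussian, multiplied by scalars: up to the factor `t^(-1/2)`,
the kernel of `D e^{tΔ}`. -/
def gradKer (z : E) : ℝ →L[ℝ] (E →L[ℝ] ℝ) :=
  smulCLM (E →L[ℝ] ℝ) (divKer z)

/-- The Laplacian of the Gaussian: up to the factor `t⁻¹`, the kernel of `Δ e^{tΔ}`. -/
def lapKer (z : E) : ℝ →L[ℝ] ℝ :=
  ((‖z‖ ^ 2 / 4 - finrank ℝ E / 2) * gaussKer z) • ContinuousLinearMap.id ℝ ℝ

theorem isGoodKernel_heatKer : IsGoodKernel (heatKer (E := E) W) :=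
  isGoodKernel_gaussKer.clm_comp
    (ContinuousLinearMap.toSpanSingleton ℝ (ContinuousLinearMap.id ℝ W))

theorem isGoodKernel_divKer : IsGoodKernel (divKer (E := E)) :=
  isGoodKernel_gaussKer_smul.clm_comp ((1 / 2 : ℝ) • innerSL ℝ)

theorem isGoodKernel_gradKer : IsGoodKernel (gradKer (E := E)) :=
  isGoodKernel_divKer.clm_comp (smulCLM (E →L[ℝ] ℝ))

theorem heatKer_apply (z : E) (w : W) : heatKer W z w = gaussKer z • w := rfl

theorem divKer_apply (z w : E) : divKer z w = 1 / 2 * (gaussKer z * inner ℝ z w) := by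
  simp [divKer]

theorem gradKer_apply (z : E) (r : ℝ) : gradKer z r = r • divKer z := rfl

theorem lapKer_apply (z : E) (r : ℝ) :
    lapKer z r = ((‖z‖ ^ 2 / 4 - finrank ℝ E / 2) * gaussKer z) * r := rfl

theorem derivKernel_heatKer (z : E) : derivKernel (heatKer ℝ) z = gradKer z := by
  have h : HasFDerivAt (heatKer (E := E) ℝ)
      (((-(1 / 2 * gaussKer z) • innerSL ℝ z) : E →L[ℝ] ℝ).smulRight
        (ContinuousLinearMap.id ℝ ℝ)) z :=
    (hasFDerivAt_gaussKer z).smul_const (ContinuousLinearMap.id ℝ ℝ)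
  rw [derivKernel, h.fderiv]
  ext v
  simp [gradKer_apply, divKer_apply]
  ring

/-- The trace of the second derivative kernel is the kernel of the Laplacian. -/
theorem sum_derivKernel_gradKer {ι : Type*} [Fintype ι] (b : OrthonormalBasis ι ℝ E) (z : E)
    (r : ℝ) : ∑ i, derivKernel gradKer z r (b i) (b i) = lapKer z r := by
  have h : HasFDerivAt (gradKer (E := E))
      ((smulCLM (E →L[ℝ] ℝ)).comp (((1 / 2 : ℝ) • innerSL ℝ).comp
        (gaussKer z • ContinuousLinearMap.id ℝ E +
      ((-(1 / 2 * gaussKer z) • innerSL ℝ z) : E →L[ℝ] ℝ).smulRight z))) z :=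
    (smulCLM (E →L[ℝ] ℝ)).hasFDerivAt.comp z
      ((ContinuousLinearMap.hasFDerivAt ((1 / 2 : ℝ) • innerSL ℝ)).comp z
        (hasFDerivAt_gaussKer_smul z))
  have h2 : ∀ v, derivKernel gradKer z r v v =
      r * gaussKer z * (1 / 4 * inner ℝ z v ^ 2 - 1 / 2 * ‖v‖ ^ 2) := fun v => by
    rw [derivKernel, h.fderiv]
    simp [smulCLM]
    ring
  have hs : ∑ i, inner ℝ z (b i) ^ 2 = ‖z‖ ^ 2 := by
    simpa using b.sum_sq_norm_inner_left z
  simp only [h2, b.norm_eq_one, lapKer_apply]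
  rw [← Finset.mul_sum, Finset.sum_sub_distrib, ← Finset.mul_sum, hs]
  simp [Module.finrank_eq_card_basis b.toBasis]
  ring

theorem gaussianDecay_lapKer : GaussianDecay (lapKer (E := E)) := by
  refine gaussianDecay_of_norm_le (C := 1 + (finrank ℝ E : ℝ)) ?_ (by positivity) fun z => ?_
  · have := continuous_gaussKer (E := E)
    unfold lapKer
    fun_prop
  · have h0 := gaussKer_pos z
    refine (norm_smul_le ((‖z‖ ^ 2 / 4 - finrank ℝ E / 2) * gaussKer z)
      (ContinuousLinearMap.id ℝ ℝ)).trans ?_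
    rw [norm_mul, Real.norm_of_nonneg h0.le, ContinuousLinearMap.norm_id, mul_one, ← mul_assoc]
    gcongr
    rw [Real.norm_eq_abs, abs_le]
    constructor <;> nlinarith [sq_nonneg ‖z‖, (Nat.cast_nonneg (finrank ℝ E) : (0 : ℝ) ≤ _),
      mul_nonneg (Nat.cast_nonneg (finrank ℝ E) : (0 : ℝ) ≤ _) (sq_nonneg ‖z‖)]

theorem integral_heatKer_apply [CompleteSpace W] (w : W) : ∫ z : E, heatKer W z w = w := by
  simp only [heatKer_apply]
  rw [integral_smul_const, integral_gaussKer, one_smul]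

/-- The time derivative of the heat semigroup without its normalizing factor. It is taken in the
unscaled variable `y`, where `φ` need not be differentiable. -/
theorem hasDerivAt_integral_exp_mul {φ : E → ℝ} (hφ : Continuous φ) {M : ℝ}
    (hM : ∀ x, ‖φ x‖ ≤ M) {t : ℝ} (ht : 0 < t) :
    HasDerivAt (fun t => ∫ y, Real.exp (-‖y‖ ^ 2 / (4 * t)) * φ y)
      (∫ y, ‖y‖ ^ 2 / (4 * t ^ 2) * Real.exp (-‖y‖ ^ 2 / (4 * t)) * φ y) t := by
  have hM0 : 0 ≤ M := (norm_nonneg _).trans (hM 0)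
  have hmeas : ∀ t : ℝ, AEStronglyMeasurable
      (fun y : E => Real.exp (-‖y‖ ^ 2 / (4 * t)) * φ y) := fun t =>
    Continuous.aestronglyMeasurable (by fun_prop)
  refine (hasDerivAt_integral_of_dominated_loc_of_deriv_le
    (F := fun t y => Real.exp (-‖y‖ ^ 2 / (4 * t)) * φ y)
    (F' := fun t y => ‖y‖ ^ 2 / (4 * t ^ 2) * Real.exp (-‖y‖ ^ 2 / (4 * t)) * φ y)
    (bound := fun y => 16 / t * M * Real.exp (-‖y‖ ^ 2 / (16 * t)))
    (Ioo_mem_nhds (show t / 2 < t by linarith) (show t < 2 * t by linarith))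
    (Eventually.of_forall hmeas) ?_ ?_ ?_ ?_ ?_).2
  · refine ((integrable_exp_neg_norm_sq_div (E := E) (b := 4 * t) (by positivity)).mul_const
      M).mono' (hmeas t) (Eventually.of_forall fun y => ?_)
    rw [norm_mul, Real.norm_of_nonneg (Real.exp_pos _).le]
    gcongr
    exact hM y
  · exact Continuous.aestronglyMeasurable (by fun_prop)
  · refine Eventually.of_forall fun y s hs => ?_
    have hs0 : 0 < s := by linarith [hs.1]
    rw [norm_mul, Real.norm_of_nonneg (by positivity)]
    have h1 : ‖y‖ ^ 2 / (4 * s ^ 2) ≤ ‖y‖ ^ 2 / t ^ 2 := by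
      gcongr
      nlinarith [hs.1]
    have h2 : ‖y‖ ^ 2 / t ^ 2 ≤ 16 / t * Real.exp (‖y‖ ^ 2 / (16 * t)) := by
      have := Real.add_one_le_exp (‖y‖ ^ 2 / (16 * t))
      have h3 : ‖y‖ ^ 2 / t ^ 2 = 16 / t * (‖y‖ ^ 2 / (16 * t)) := by field_simp
      rw [h3]
      gcongr
      linarith
    have h4 : Real.exp (-‖y‖ ^ 2 / (4 * s)) ≤ Real.exp (-‖y‖ ^ 2 / (8 * t)) := by
      apply Real.exp_le_exp.2
      rw [neg_div, neg_div, neg_le_neg_iff]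
      apply div_le_div_of_nonneg_left (by positivity) (by positivity)
      linarith [hs.2]
    calc _ ≤ 16 / t * Real.exp (‖y‖ ^ 2 / (16 * t)) * Real.exp (-‖y‖ ^ 2 / (8 * t)) * M := by
          gcongr
          · exact h1.trans h2
          · exact hM y
      _ = 16 / t * M * (Real.exp (‖y‖ ^ 2 / (16 * t)) * Real.exp (-‖y‖ ^ 2 / (8 * t))) := by ring
      _ = _ := by
          rw [← Real.exp_add]
          congr 2
          field_simp
          ring
  · exact (integrable_exp_neg_norm_sq_div (by positivity)).const_mul _
  · refine Eventually.of_forall fun y s hs => ?_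
    have hs0 : 0 < s := by linarith [hs.1]
    have h1 : HasDerivAt (fun s : ℝ => -‖y‖ ^ 2 / (4 * s)) (‖y‖ ^ 2 / (4 * s ^ 2)) s := by
      have h2 : HasDerivAt (fun s : ℝ => 4 * s) 4 s := by
        simpa using (hasDerivAt_id s).const_mul (4 : ℝ)
      have := (h2.inv (by positivity)).const_mul (-‖y‖ ^ 2)
      refine this.congr_deriv ?_
      field_simp
    have := h1.exp.mul_const (φ y)
    refine this.congr_deriv ?_
    ring

/-- The heat semigroup solves the heat equation. -/
theorem hasDerivAt_kernelAvg_heatKer {φ : E → ℝ} (hφ : Continuous φ) {M : ℝ}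
    (hM : ∀ x, ‖φ x‖ ≤ M) (x : E) {t : ℝ} (ht : 0 < t) :
    HasDerivAt (fun t => kernelAvg (heatKer ℝ) (√t) φ x)
      (t⁻¹ * kernelAvg lapKer (√t) φ x) t := by
  set n : ℝ := (finrank ℝ E : ℝ) with hn
  set c : ℝ := (4 * Real.pi) ^ (-(n / 2)) with hc
  have hsq : ∀ t : ℝ, 0 < t → |(√t ^ (finrank ℝ E))⁻¹| = t ^ (-(n / 2)) := fun t ht => by
    rw [abs_of_nonneg (by positivity), Real.sqrt_eq_rpow, ← Real.rpow_natCast,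
      ← Real.rpow_mul ht.le, ← Real.rpow_neg ht.le]
    congr 1; rw [hn]; ring
  -- rescaling the integration variable
  have hscale : ∀ (q : E → ℝ) (t : ℝ), 0 < t →
      ∫ z, q (√t • z) * φ (x + √t • z) = t ^ (-(n / 2)) * ∫ y, q y * φ (x + y) :=
    fun q t ht => by
      rw [Measure.integral_comp_smul volume (fun y => q y * φ (x + y)) (√t), hsq t ht, smul_eq_mul]
  have hnorm : ∀ (z : E) (t : ℝ), 0 < t → ‖z‖ ^ 2 = ‖√t • z‖ ^ 2 / t := fun z t ht => by
    rw [norm_smul, mul_pow, Real.norm_of_nonneg (Real.sqrt_nonneg t), Real.sq_sqrt ht.le]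
    field_simp
  have h1 : ∀ t, 0 < t → kernelAvg (heatKer ℝ) (√t) φ x =
      t ^ (-(n / 2)) * (c * ∫ y, Real.exp (-‖y‖ ^ 2 / (4 * t)) * φ (x + y)) := fun t ht => by
    rw [← integral_const_mul]
    simp only [← mul_assoc c]
    rw [← hscale (fun y => c * Real.exp (-‖y‖ ^ 2 / (4 * t))) t ht]
    simp only [kernelAvg, heatKer_apply, gaussKer, smul_eq_mul, ← hn, ← hc]
    congr 1; ext z
    rw [hnorm z t ht]
    congr 3
    field_simp
  have h2 : kernelAvg lapKer (√t) φ x = t ^ (-(n / 2)) *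
      (c * (t * (∫ y, ‖y‖ ^ 2 / (4 * t ^ 2) * Real.exp (-‖y‖ ^ 2 / (4 * t)) * φ (x + y))
      - n / 2 * ∫ y, Real.exp (-‖y‖ ^ 2 / (4 * t)) * φ (x + y))) := by
    have hi : ∀ A : ℝ, Integrable (fun y : E =>
        A * (Real.exp (-‖y‖ ^ 2 / (4 * t)) * φ (x + y))) := fun A => by
      refine (((integrable_exp_neg_norm_sq_div (E := E) (b := 4 * t) (by positivity)).mul_const
        M).mono' (Continuous.aestronglyMeasurable (by fun_prop))
        (Eventually.of_forall fun y => ?_)).const_mul A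
      rw [norm_mul, Real.norm_of_nonneg (Real.exp_pos _).le]
      gcongr
      exact hM _
    have hi2 : Integrable (fun y : E =>
        t * (‖y‖ ^ 2 / (4 * t ^ 2) * Real.exp (-‖y‖ ^ 2 / (4 * t)) * φ (x + y))) := by
      refine (((integrable_exp_neg_norm_sq_div (E := E) (b := 8 * t) (by positivity)).const_mul
        (2 / t * M)).mono' (Continuous.aestronglyMeasurable (by fun_prop))
        (Eventually.of_forall fun y => ?_)).const_mul t
      have h5 : ‖y‖ ^ 2 / (4 * t ^ 2) ≤ 2 / t * Real.exp (‖y‖ ^ 2 / (8 * t)) := by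
        have := Real.add_one_le_exp (‖y‖ ^ 2 / (8 * t))
        have h3 : ‖y‖ ^ 2 / (4 * t ^ 2) = 2 / t * (‖y‖ ^ 2 / (8 * t)) := by field_simp; ring
        rw [h3]
        gcongr
        linarith
      rw [norm_mul, Real.norm_of_nonneg (by positivity)]
      calc _ ≤ 2 / t * Real.exp (‖y‖ ^ 2 / (8 * t)) * Real.exp (-‖y‖ ^ 2 / (4 * t)) * M := by
            gcongr; exact hM _
        _ = 2 / t * M * (Real.exp (‖y‖ ^ 2 / (8 * t)) * Real.exp (-‖y‖ ^ 2 / (4 * t))) := by ring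
        _ = _ := by rw [← Real.exp_add]; congr 2; field_simp; ring
    rw [← integral_const_mul, ← integral_const_mul, ← integral_sub hi2 (hi _),
      ← integral_const_mul]
    have h6 := hscale (fun y => c * ((‖y‖ ^ 2 / (4 * t) - n / 2) *
      Real.exp (-‖y‖ ^ 2 / (4 * t)))) t ht
    rw [show (fun y : E => c * (t * (‖y‖ ^ 2 / (4 * t ^ 2) * Real.exp (-‖y‖ ^ 2 / (4 * t)) *
        φ (x + y)) - n / 2 * (Real.exp (-‖y‖ ^ 2 / (4 * t)) * φ (x + y)))) =
        fun y : E => c * ((‖y‖ ^ 2 / (4 * t) - n / 2) * Real.exp (-‖y‖ ^ 2 / (4 * t))) *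
          φ (x + y) by ext y; field_simp, ← h6]
    simp only [kernelAvg, lapKer_apply, gaussKer, ← hn, ← hc]
    congr 1; ext z
    rw [hnorm z t ht]
    have e1 : -(‖√t • z‖ ^ 2 / t) / 4 = -‖√t • z‖ ^ 2 / (4 * t) := by field_simp
    have e2 : ‖√t • z‖ ^ 2 / t / 4 = ‖√t • z‖ ^ 2 / (4 * t) := by field_simp
    rw [e1, e2]
    ring
  have h3 := (hasDerivAt_integral_exp_mul (φ := fun y => φ (x + y)) (hφ.comp (by fun_prop))
    (fun y => hM _) ht).const_mul c
  have h4 : HasDerivAt (fun t : ℝ => t ^ (-(n / 2))) (-(n / 2) * t ^ (-(n / 2) - 1)) t :=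
    Real.hasDerivAt_rpow_const (Or.inl ht.ne')
  refine ((h4.mul h3).congr_of_eventuallyEq ?_).congr_deriv ?_
  · filter_upwards [Ioi_mem_nhds ht] with s hs using h1 s hs
  · rw [h2, Real.rpow_sub_one ht.ne']
    field_simp
    ring

end HeatKernel

/-! ### Duhamel integrals -/

section Duhamel

variable {E : Type*} [NormedAddCommGroup E] [InnerProductSpace ℝ E] [FiniteDimensional ℝ E]
  [MeasurableSpace E] [BorelSpace E]
variable {V W : Type*} [NormedAddCommGroup V] [NormedSpace ℝ V]
  [NormedAddCommGroup W] [NormedSpace ℝ W]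

/-- A jointly continuous function of space and time, bounded by `M`. -/
def IsSource (F : E → ℝ → W) (M : ℝ) : Prop :=
  Continuous (Function.uncurry F) ∧ ∀ x s, ‖F x s‖ ≤ M

theorem IsSource.slice {F : E → ℝ → W} {M : ℝ} (hF : IsSource F M) (s : ℝ) :
    Continuous (fun y => F y s) := hF.1.comp (by fun_prop : Continuous fun y : E => (y, s))

theorem IsSource.nonneg {F : E → ℝ → W} {M : ℝ} (hF : IsSource F M) : 0 ≤ M :=
  (norm_nonneg _).trans (hF.2 0 0)

/-- The Duhamel integral of `F` with kernel `K` and singularity exponent `a`, in self-similar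
variables. The substitution `s = t (1 - θ)` turns `t ^ (1 - a) • duhamel a K F x t` into
`∫ s in 0..t, (t - s) ^ (-a) • kernelAvg K √(t - s) (F · s) x`; in the variable `θ` the domain of
integration is fixed, so that dominated convergence applies in `(x, t)`. -/
def duhamel (a : ℝ) (K : E → W →L[ℝ] V) (F : E → ℝ → W) (x : E) (t : ℝ) : V :=
  ∫ θ in (0 : ℝ)..1, θ ^ (-a) • kernelAvg K (√(t * θ)) (fun y => F y (t * (1 - θ))) x

/-- The integrand of `duhamel a K F` has a singularity at `θ = 0` of order at most `3/4`. -/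
def DuhamelBound (a : ℝ) (K : E → W →L[ℝ] V) (F : E → ℝ → W) (C : ℝ) : Prop :=
  ∀ x t, ∀ θ ∈ Ioc (0 : ℝ) 1,
    ‖θ ^ (-a) • kernelAvg K (√(t * θ)) (fun y => F y (t * (1 - θ))) x‖ ≤
      C * (1 + |t|) * θ ^ (-(3 / 4) : ℝ)

theorem duhamelBound_of_le {a : ℝ} (ha : a ≤ 3 / 4) {K : E → W →L[ℝ] V} (hK : GaussianDecay K)
    {F : E → ℝ → W} {M : ℝ} (hF : IsSource F M) : DuhamelBound a K F ((∫ z, ‖K z‖) * M) := by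
  intro x t θ hθ
  have h1 := norm_kernelAvg_le hK (fun y => hF.2 y (t * (1 - θ))) (√(t * θ)) x
  have h2 : 0 ≤ (∫ z, ‖K z‖) * M := (norm_nonneg _).trans h1
  rw [norm_smul, Real.norm_of_nonneg (Real.rpow_nonneg hθ.1.le _), mul_comm]
  have h3 : θ ^ (-a) ≤ θ ^ (-(3 / 4) : ℝ) :=
    Real.rpow_le_rpow_of_exponent_ge hθ.1 hθ.2 (by linarith)
  have h4 := h1.trans (le_mul_of_one_le_right h2
    (by linarith [abs_nonneg t] : (1 : ℝ) ≤ 1 + |t|))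
  exact mul_le_mul h4 h3 (Real.rpow_nonneg hθ.1.le _) ((norm_nonneg _).trans h4)

/-- With the full singularity `θ⁻¹` the factor `√l = (tθ)^(1/4)` is what makes the integrand integrable. -/
theorem duhamelBound_one_of_le {K : E → W →L[ℝ] V} {F : E → ℝ → W} {C : ℝ} (hC : 0 ≤ C)
    (h : ∀ x s l, 0 ≤ l → ‖kernelAvg K l (fun y => F y s) x‖ ≤ C * √l) :
    DuhamelBound 1 K F C := by
  intro x t θ hθ
  have h1 := h x (t * (1 - θ)) _ (Real.sqrt_nonneg (t * θ))
  have h2 : √(√(t * θ)) ≤ (1 + |t|) * θ ^ (1 / 4 : ℝ) := by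
    have e : θ ^ (1 / 4 : ℝ) = √(√θ) := by
      rw [Real.sqrt_eq_rpow, Real.sqrt_eq_rpow, ← Real.rpow_mul hθ.1.le]; norm_num
    rw [e, Real.sqrt_mul' _ hθ.1.le, Real.sqrt_mul' _ (Real.sqrt_nonneg _)]
    gcongr
    rw [Real.sqrt_le_left (by positivity), Real.sqrt_le_left (by positivity)]
    have h3 : (1 : ℝ) ≤ (1 + |t|) ^ 2 := by nlinarith [abs_nonneg t]
    nlinarith [le_abs_self t, abs_nonneg t, mul_self_nonneg (1 + |t|)]
  have h4 : θ ^ (-1 : ℝ) * θ ^ (1 / 4 : ℝ) = θ ^ (-(3 / 4) : ℝ) := by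
    rw [← Real.rpow_add hθ.1]; norm_num
  rw [norm_smul, Real.norm_of_nonneg (Real.rpow_nonneg hθ.1.le _), ← h4]
  have h5 : 0 ≤ θ ^ (-1 : ℝ) := Real.rpow_nonneg hθ.1.le _
  calc _ ≤ θ ^ (-1 : ℝ) * (C * ((1 + |t|) * θ ^ (1 / 4 : ℝ))) := by
        gcongr; exact h1.trans (by gcongr)
    _ = _ := by ring

/-- Hölder continuity in space, of exponent `1/2` and uniformly in time. -/
def IsHolder (F : E → ℝ → W) (H : ℝ) : Prop :=
  0 ≤ H ∧ ∀ x y s, ‖F x s - F y s‖ ≤ H * √‖x - y‖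

theorem duhamelBound_of_holder [CompleteSpace V] {K : E → W →L[ℝ] V} (hK : IsGoodKernel K)
    {F : E → ℝ → W} {M : ℝ} (hF : IsSource F M) {H : ℝ} (hH : IsHolder F H) :
    DuhamelBound 1 (derivKernel K) F ((∫ z, ‖derivKernel K z‖ * √‖z‖) * H) := by
  refine duhamelBound_one_of_le (mul_nonneg (by positivity) hH.1) fun x s l hl => ?_
  rw [mul_assoc]
  exact norm_kernelAvg_derivKernel_le hK (hF.slice s) (fun y => hF.2 y s)
    (fun x y => hH.2 x y s) hl x

theorem kernelAvg_lapKer {φ : E → ℝ} (hφ : Continuous φ) {M : ℝ} (hM : ∀ x, ‖φ x‖ ≤ M)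
    {ι : Type*} [Fintype ι] (b : OrthonormalBasis ι ℝ E) (l : ℝ) (x : E) :
    kernelAvg lapKer l φ x = ∑ i, kernelAvg (derivKernel gradKer) l φ x (b i) (b i) := by
  have hint := integrable_kernelAvg isGoodKernel_gradKer.decay_derivKernel hφ hM l x
  simp only [kernelAvg, ← sum_derivKernel_gradKer b]
  rw [integral_finsetSum]
  · refine Finset.sum_congr rfl fun i _ => ?_
    rw [ContinuousLinearMap.integral_apply hint,
      ContinuousLinearMap.integral_apply (hint.apply_continuousLinearMap _)]
  · exact fun i _ => (hint.apply_continuousLinearMap _).apply_continuousLinearMap _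

theorem intervalIntegrable_rpow_three_quarters (a b : ℝ) :
    IntervalIntegrable (fun θ : ℝ => θ ^ (-(3 / 4) : ℝ)) volume a b :=
  intervalIntegral.intervalIntegrable_rpow' (by norm_num)

theorem aestronglyMeasurable_duhamel_integrand (a : ℝ) {K : E → W →L[ℝ] V} (hK : GaussianDecay K)
    {F : E → ℝ → W} {M : ℝ} (hF : IsSource F M) (x : E) (t : ℝ) (μ : Measure ℝ) :
    AEStronglyMeasurable (fun θ : ℝ =>
      θ ^ (-a) • kernelAvg K (√(t * θ)) (fun y => F y (t * (1 - θ))) x) μ := by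
  have h1 : Continuous fun θ : ℝ => kernelAvg K (√(t * θ)) (fun y => F y (t * (1 - θ))) x :=
    continuous_kernelAvg hK (F := fun θ y => F y (t * (1 - θ)))
      (hF.1.comp (by fun_prop : Continuous fun p : ℝ × E => (p.2, t * (1 - p.1))))
      (fun _ _ => hF.2 _ _) (by fun_prop) continuous_const
  exact (measurable_id.pow_const (-a)).aestronglyMeasurable.smul h1.aestronglyMeasurable

theorem intervalIntegrable_duhamel {a : ℝ} {K : E → W →L[ℝ] V} (hK : GaussianDecay K)
    {F : E → ℝ → W} {M : ℝ} (hF : IsSource F M) {C : ℝ} (hC : DuhamelBound a K F C) (x : E)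
    (t : ℝ) : IntervalIntegrable (fun θ : ℝ =>
      θ ^ (-a) • kernelAvg K (√(t * θ)) (fun y => F y (t * (1 - θ))) x) volume 0 1 := by
  refine ((intervalIntegrable_rpow_three_quarters 0 1).const_mul (C * (1 + |t|))).mono_fun'
    (aestronglyMeasurable_duhamel_integrand a hK hF x t _) ?_
  rw [uIoc_of_le zero_le_one]
  exact (ae_restrict_iff' measurableSet_Ioc).2 (Eventually.of_forall fun θ hθ => hC x t θ hθ)

theorem integral_rpow_three_quarters : ∫ θ in (0 : ℝ)..1, θ ^ (-(3 / 4) : ℝ) = 4 := by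
  rw [integral_rpow (Or.inl (by norm_num))]
  norm_num

theorem norm_duhamel_le {a : ℝ} {K : E → W →L[ℝ] V}
    {F : E → ℝ → W} {C : ℝ} (hC : DuhamelBound a K F C) (x : E)
    (t : ℝ) : ‖duhamel a K F x t‖ ≤ 4 * C * (1 + |t|) := by
  have h := intervalIntegral.norm_integral_le_of_norm_le (μ := volume) (zero_le_one' ℝ)
    (Eventually.of_forall fun θ hθ => hC x t θ hθ)
    ((intervalIntegrable_rpow_three_quarters 0 1).const_mul (C * (1 + |t|)))
  rw [intervalIntegral.integral_const_mul, integral_rpow_three_quarters] at h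
  refine h.trans_eq (by ring)

theorem continuous_duhamel {a : ℝ} {K : E → W →L[ℝ] V} (hK : GaussianDecay K)
    {F : E → ℝ → W} {M : ℝ} (hF : IsSource F M) {C : ℝ} (hC : DuhamelBound a K F C) :
    Continuous (Function.uncurry (duhamel a K F)) := by
  refine continuous_iff_continuousAt.2 fun q => ?_
  have hC0 : 0 ≤ C := by
    have := (norm_nonneg _).trans (hC 0 0 1 ⟨one_pos, le_rfl⟩)
    simpa using this
  refine intervalIntegral.continuousAt_of_dominated_interval
    (F := fun (q : E × ℝ) θ => θ ^ (-a) • kernelAvg K (√(q.2 * θ))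
      (fun y => F y (q.2 * (1 - θ))) q.1)
    (bound := fun θ => C * (1 + (|q.2| + 1)) * θ ^ (-(3 / 4) : ℝ))
    (Eventually.of_forall fun q => aestronglyMeasurable_duhamel_integrand a hK hF _ _ _) ?_
    ((intervalIntegrable_rpow_three_quarters 0 1).const_mul _)
    (Eventually.of_forall fun θ hθ => ?_)
  · have h1 : ∀ᶠ p : E × ℝ in 𝓝 q, |p.2| < |q.2| + 1 :=
      (continuous_snd.abs.tendsto q).eventually_lt_const (by linarith)
    filter_upwards [h1] with p hp
    refine Eventually.of_forall fun θ hθ => ?_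
    rw [uIoc_of_le zero_le_one] at hθ
    refine (hC p.1 p.2 θ hθ).trans ?_
    have := Real.rpow_nonneg hθ.1.le (-(3 / 4))
    gcongr
  · refine (Continuous.const_smul ?_ _).continuousAt
    exact continuous_kernelAvg hK (F := fun (q : E × ℝ) y => F y (q.2 * (1 - θ)))
      (hF.1.comp (by fun_prop : Continuous fun p : (E × ℝ) × E => (p.2, p.1.2 * (1 - θ))))
      (fun _ _ => hF.2 _ _) (by fun_prop) continuous_fst

theorem duhamel_sub {a : ℝ} {K : E → W →L[ℝ] V} (hK : GaussianDecay K)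
    {F G : E → ℝ → W} {M M' : ℝ} (hF : IsSource F M) (hG : IsSource G M') {C C' : ℝ}
    (hC : DuhamelBound a K F C) (hC' : DuhamelBound a K G C') (x : E) (t : ℝ) :
    duhamel a K F x t - duhamel a K G x t = duhamel a K (fun x s => F x s - G x s) x t := by
  rw [duhamel, duhamel, ← intervalIntegral.integral_sub (intervalIntegrable_duhamel hK hF hC x t)
    (intervalIntegrable_duhamel hK hG hC' x t)]
  refine intervalIntegral.integral_congr fun θ _ => ?_
  simp only [← smul_sub]
  rw [kernelAvg_sub hK (hF.slice _) (fun _ => hF.2 _ _) (hG.slice _) (fun _ => hG.2 _ _)]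

/-- Differentiating a Duhamel integral in space raises the exponent of the singularity
by `1/2`. -/
theorem hasFDerivAt_duhamel {a : ℝ} {K : E → W →L[ℝ] V} (hK : IsGoodKernel K)
    {F : E → ℝ → W} {M : ℝ} (hF : IsSource F M) {C C' : ℝ} (hC : DuhamelBound a K F C)
    (hC' : DuhamelBound (a + 1 / 2) (derivKernel K) F C') (x : E) {t : ℝ} (ht : 0 < t) :
    HasFDerivAt (fun x => duhamel a K F x t)
      ((√t)⁻¹ • duhamel (a + 1 / 2) (derivKernel K) F x t) x := by
  rw [duhamel, ← intervalIntegral.integral_smul]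
  refine intervalIntegral.hasFDerivAt_integral_of_dominated_of_fderiv_le
    (F := fun x θ => θ ^ (-a) • kernelAvg K (√(t * θ)) (fun y => F y (t * (1 - θ))) x)
    (F' := fun x θ => (√t)⁻¹ • θ ^ (-(a + 1 / 2)) • kernelAvg (derivKernel K) (√(t * θ))
      (fun y => F y (t * (1 - θ))) x)
    (bound := fun θ => (√t)⁻¹ * (C' * (1 + |t|) * θ ^ (-(3 / 4) : ℝ)))
    univ_mem (Eventually.of_forall fun x => aestronglyMeasurable_duhamel_integrand a hK.decay hF
      x t _) (intervalIntegrable_duhamel hK.decay hF hC x t) ?_ ?_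
    (((intervalIntegrable_rpow_three_quarters 0 1).const_mul _).const_mul _) ?_
  · exact (aestronglyMeasurable_duhamel_integrand (a + 1 / 2) hK.decay_derivKernel hF x t _).const_smul
      (√t)⁻¹
  · refine Eventually.of_forall fun θ hθ y _ => ?_
    rw [uIoc_of_le zero_le_one] at hθ
    refine (norm_smul_le (√t)⁻¹ (θ ^ (-(a + 1 / 2)) • kernelAvg (derivKernel K) (√(t * θ))
      (fun y => F y (t * (1 - θ))) y)).trans ?_
    rw [Real.norm_of_nonneg (by positivity)]
    gcongr
    exact hC' y t θ hθ
  · refine Eventually.of_forall fun θ hθ y _ => ?_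
    rw [uIoc_of_le zero_le_one] at hθ
    have hl : √(t * θ) ≠ 0 := (Real.sqrt_pos.2 (mul_pos ht hθ.1)).ne'
    have h1 := (hasFDerivAt_kernelAvg hK (hF.slice (t * (1 - θ))) (fun _ => hF.2 _ _) hl y).const_smul
      (θ ^ (-a))
    refine h1.congr_fderiv ?_
    rw [smul_smul, smul_smul]
    congr 1
    rw [Real.sqrt_mul ht.le, mul_inv, neg_add, Real.rpow_add hθ.1, Real.rpow_neg hθ.1.le (1 / 2),
      ← Real.sqrt_eq_rpow]
    ring

/-- Duhamel integrals of bounded functions with singularity `1/2` are Hölder continuous in space of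
exponent `1/2`, because `∫ (t - s) ^ (-1/2) (t - s) ^ (-1/4) ds` converges. -/
theorem norm_duhamel_sub_le {K : E → W →L[ℝ] V} (hK : IsGoodKernel K)
    {F : E → ℝ → W} {M : ℝ} (hF : IsSource F M) :
    ∃ C, 0 ≤ C ∧ ∀ t x y, ‖√t • duhamel (1 / 2) K F x t - √t • duhamel (1 / 2) K F y t‖ ≤
      C * (1 + |t|) * √‖x - y‖ := by
  obtain ⟨C, hC0, hC⟩ := norm_kernelAvg_sub_le hK
  have hM0 := hF.nonneg
  refine ⟨4 * (C * M), by positivity, fun t x y => ?_⟩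
  rcases le_or_gt t 0 with ht | ht
  · rw [Real.sqrt_eq_zero_of_nonpos ht, zero_smul, zero_smul, sub_zero, norm_zero]
    positivity
  have hD := duhamelBound_of_le (a := 1 / 2) (by norm_num) hK.decay hF
  have h1 : ‖duhamel (1 / 2) K F x t - duhamel (1 / 2) K F y t‖ ≤
      4 * (C * M * (√‖x - y‖ / √√t)) := by
    rw [duhamel, duhamel, ← intervalIntegral.integral_sub (intervalIntegrable_duhamel hK.decay hF hD
      x t) (intervalIntegrable_duhamel hK.decay hF hD y t)]
    have h := intervalIntegral.norm_integral_le_of_norm_le (μ := volume) (zero_le_one' ℝ)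
      (f := fun θ => θ ^ (-(1 / 2) : ℝ) • kernelAvg K (√(t * θ)) (fun y => F y (t * (1 - θ))) x -
        θ ^ (-(1 / 2) : ℝ) • kernelAvg K (√(t * θ)) (fun y => F y (t * (1 - θ))) y)
      (g := fun θ => (C * M * (√‖x - y‖ / √√t)) * θ ^ (-(3 / 4) : ℝ))
      (Eventually.of_forall fun θ hθ => ?_)
      ((intervalIntegrable_rpow_three_quarters 0 1).const_mul _)
    · rw [intervalIntegral.integral_const_mul, integral_rpow_three_quarters] at h
      exact h.trans_eq (by ring)
    · have hl : 0 < √(t * θ) := Real.sqrt_pos.2 (mul_pos ht hθ.1)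
      have h2 := hC _ M (hF.slice (t * (1 - θ))) (fun _ => hF.2 _ _) _ hl x y
      rw [← smul_sub, norm_smul, Real.norm_of_nonneg (Real.rpow_nonneg hθ.1.le _)]
      have e : √√θ = θ ^ (1 / 4 : ℝ) := by
        rw [Real.sqrt_eq_rpow, Real.sqrt_eq_rpow, ← Real.rpow_mul hθ.1.le]; norm_num
      have e2 : θ ^ (-(3 / 4) : ℝ) = θ ^ (-(1 / 2) : ℝ) * (θ ^ (1 / 4 : ℝ))⁻¹ := by
        rw [← Real.rpow_neg hθ.1.le, ← Real.rpow_add hθ.1]; norm_num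
      have e3 : √√(t * θ) = √√t * θ ^ (1 / 4 : ℝ) := by
        rw [Real.sqrt_mul ht.le, Real.sqrt_mul (Real.sqrt_nonneg t), e]
      rw [e3] at h2
      rw [e2]
      have := Real.rpow_nonneg hθ.1.le (-(1 / 2))
      refine (mul_le_mul_of_nonneg_left h2 this).trans_eq ?_
      rw [div_mul_eq_div_div]
      ring
  rw [← smul_sub, norm_smul, Real.norm_of_nonneg (Real.sqrt_nonneg t)]
  have h3 : 0 < √√t := Real.sqrt_pos.2 (Real.sqrt_pos.2 ht)
  have h4 : √√t ≤ 1 + |t| := by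
    rw [Real.sqrt_le_left (by positivity), Real.sqrt_le_left (by positivity), abs_of_pos ht]
    have : (1 : ℝ) ≤ (1 + t) ^ 2 := by nlinarith
    nlinarith
  calc _ ≤ √t * (4 * (C * M * (√‖x - y‖ / √√t))) := by gcongr
    _ = 4 * (C * M) * √‖x - y‖ * (√t / √√t) := by ring
    _ = 4 * (C * M) * √‖x - y‖ * √√t := by rw [Real.div_sqrt]
    _ ≤ 4 * (C * M) * √‖x - y‖ * (1 + |t|) := by gcongr
    _ = _ := by ring

/-- For a source that is differentiable in space the derivative can be moved from the kernel onto
the source. -/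
theorem duhamel_derivKernel_apply {a : ℝ} {K : E → W →L[ℝ] V} (hK : IsGoodKernel K)
    {F : E → ℝ → W} {M C : ℝ} (hF : IsSource F M)
    (hC : DuhamelBound (a + 1 / 2) (derivKernel K) F C) {F' : E → ℝ → E →L[ℝ] W} {M' : ℝ}
    (hF' : IsSource F' M') (hd : ∀ x s, HasFDerivAt (fun y => F y s) (F' x s) x) (x e : E) {t : ℝ}
    (ht : 0 < t) : duhamel (a + 1 / 2) (derivKernel K) F x t e =
      √t • duhamel a K (fun x s => F' x s e) x t := by
  rw [duhamel, duhamel, ContinuousLinearMap.intervalIntegral_apply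
    (intervalIntegrable_duhamel hK.decay_derivKernel hF hC x t), ← intervalIntegral.integral_smul]
  refine intervalIntegral.integral_congr_ae (Eventually.of_forall fun θ hθ => ?_)
  rw [uIoc_of_le zero_le_one] at hθ
  have hl : √(t * θ) ≠ 0 := (Real.sqrt_pos.2 (mul_pos ht hθ.1)).ne'
  have h1 := kernelAvg_derivKernel_apply hK (fun x => hd x (t * (1 - θ)))
    (fun x => hF.2 x _) (hF'.slice _) (fun x => hF'.2 x _) hl x e
  simp only [smul_apply]
  rw [← h1, smul_smul, smul_smul]
  congr 1
  rw [Real.sqrt_mul ht.le, mul_inv, neg_add, Real.rpow_add hθ.1, Real.rpow_neg hθ.1.le (1 / 2),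
    ← Real.sqrt_eq_rpow]
  have : √t ≠ 0 := (Real.sqrt_pos.2 ht).ne'
  field_simp

/-- `e^{tΔ} div B` is the heat flow of the divergence of `B`, for differentiable `B`. -/
theorem kernelAvg_divKer {ι : Type*} [Fintype ι] (b : OrthonormalBasis ι ℝ E) {B : E → E}
    {B' : E → E →L[ℝ] E} (hB : ∀ x, HasFDerivAt B (B' x) x) {M : ℝ} (hM : ∀ x, ‖B x‖ ≤ M)
    (hB' : Continuous B') {M' : ℝ} (hM' : ∀ x, ‖B' x‖ ≤ M') {l : ℝ} (hl : l ≠ 0) (x : E) :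
    l⁻¹ * kernelAvg divKer l B x =
      kernelAvg (heatKer ℝ) l (fun y => ∑ i, inner ℝ (b i) (B' y (b i))) x := by
  have hBc : Continuous B := continuous_iff_continuousAt.2 fun x => (hB x).continuousAt
  have hbM : ∀ i (v : E), ‖(innerSL ℝ (b i)) v‖ ≤ ‖v‖ := fun i v => by
    simpa using norm_inner_le_norm (𝕜 := ℝ) (b i) v
  have hd : ∀ i y, HasFDerivAt (fun y => innerSL ℝ (b i) (B y)) ((innerSL ℝ (b i)).comp (B' y)) y :=
    fun i y => (innerSL ℝ (b i)).hasFDerivAt.comp y (hB y)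
  have hbd : ∀ i y, ‖innerSL ℝ (b i) (B y)‖ ≤ M := fun i y => (hbM i _).trans (hM y)
  have hc' : ∀ i, Continuous fun y => (innerSL ℝ (b i)).comp (B' y) := fun i =>
    continuous_const.clm_comp hB'
  have hbd' : ∀ i y, ‖(innerSL ℝ (b i)).comp (B' y)‖ ≤ M' := fun i y => by
    refine ((innerSL ℝ (b i)).opNorm_comp_le _).trans ?_
    rw [innerSL_apply_norm, b.norm_eq_one, one_mul]
    exact hM' y
  have h1 : ∀ i, l⁻¹ * kernelAvg (derivKernel (heatKer ℝ)) l (fun y => innerSL ℝ (b i) (B y)) x (b i)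
      = kernelAvg (heatKer ℝ) l (fun y => inner ℝ (b i) (B' y (b i))) x := fun i =>
    kernelAvg_derivKernel_apply isGoodKernel_heatKer (hd i) (hbd i) (hc' i) (hbd' i) hl x (b i)
  have h2 : kernelAvg (heatKer ℝ) l (fun y => ∑ i, inner ℝ (b i) (B' y (b i))) x =
      ∑ i, kernelAvg (heatKer ℝ) l (fun y => inner ℝ (b i) (B' y (b i))) x := by
    simp only [kernelAvg, map_sum]
    refine integral_finsetSum _ fun i _ => ?_
    refine integrable_kernelAvg isGoodKernel_heatKer.decay
      (φ := fun y => inner ℝ (b i) (B' y (b i))) (M := M') (by fun_prop) (fun y => ?_) l x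
    have := ((innerSL ℝ (b i)).comp (B' y)).le_of_opNorm_le (hbd' i y) (b i)
    rw [b.norm_eq_one, mul_one] at this
    exact this
  rw [h2]
  simp only [← h1, ← Finset.mul_sum]
  congr 1
  have hint : ∀ i, Integrable (fun z => derivKernel (heatKer ℝ) z (innerSL ℝ (b i) (B (x + l • z)))) :=
    fun i => integrable_kernelAvg isGoodKernel_heatKer.decay_derivKernel
      (φ := fun y => innerSL ℝ (b i) (B y)) (by fun_prop) (hbd i) l x
  simp only [kernelAvg]
  rw [Finset.sum_congr rfl fun i _ => ContinuousLinearMap.integral_apply (hint i) (b i),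
    ← integral_finsetSum _ fun i _ => (hint i).apply_continuousLinearMap (b i)]
  congr 1; ext z
  conv_lhs => rw [← b.sum_repr' (B (x + l • z)), map_sum]
  refine Finset.sum_congr rfl fun i _ => ?_
  simp [derivKernel_heatKer, gradKer_apply]

/-- For a differentiable flux the Duhamel formula in divergence form is the one with source `div B`. -/
theorem duhamel_divKer {ι : Type*} [Fintype ι] (b : OrthonormalBasis ι ℝ E) {B : E → ℝ → E}
    {M : ℝ} (hF : IsSource B M) {B' : E → ℝ → E →L[ℝ] E} {M' : ℝ}
    (hB' : IsSource B' M') (hd : ∀ x s, HasFDerivAt (fun y => B y s) (B' x s) x) (x : E) {t : ℝ}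
    (ht : 0 < t) : duhamel (1 / 2) divKer B x t =
      √t • duhamel 0 (heatKer ℝ) (fun x s => ∑ i, inner ℝ (b i) (B' x s (b i))) x t := by
  rw [duhamel, duhamel, ← intervalIntegral.integral_smul]
  refine intervalIntegral.integral_congr_ae (Eventually.of_forall fun θ hθ => ?_)
  rw [uIoc_of_le zero_le_one] at hθ
  have hl : √(t * θ) ≠ 0 := (Real.sqrt_pos.2 (mul_pos ht hθ.1)).ne'
  have h1 := kernelAvg_divKer b (fun x => hd x (t * (1 - θ)))
    (fun x => hF.2 x _) (hB'.slice _) (fun x => hB'.2 x _) hl x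
  have e : (√(t * θ))⁻¹ = (√t)⁻¹ * (√θ)⁻¹ := by rw [Real.sqrt_mul ht.le, mul_inv]
  rw [← h1, e, Real.rpow_neg hθ.1.le (1 / 2), ← Real.sqrt_eq_rpow, neg_zero, Real.rpow_zero]
  simp only [smul_eq_mul]
  have : √t ≠ 0 := (Real.sqrt_pos.2 ht).ne'
  field_simp

/-- A Leibniz rule in integrated form for `∫ s in 0..t, k (t - s) s`, allowing for an integrable
singularity of `∂k/∂τ` at `τ = 0`: Fubini's theorem on the triangle `0 < s < q < t`. -/
theorem integral_comp_sub_eq_integral {k D : ℝ → ℝ → ℝ} (hk : Continuous (Function.uncurry k))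
    (hkD : ∀ s, ∀ τ, 0 < τ → HasDerivAt (fun τ => k τ s) (D τ s) τ)
    (hD : ContinuousOn (Function.uncurry D) (Ioi 0 ×ˢ univ)) {C : ℝ}
    (hDC : ∀ τ s, 0 < τ → |D τ s| ≤ C * τ ^ (-(3 / 4) : ℝ)) {t : ℝ} (ht : 0 ≤ t) :
    ∫ s in 0..t, k (t - s) s =
      (∫ s in 0..t, k 0 s) + ∫ q in 0..t, ∫ s in 0..q, D (q - s) s := by
  set Ψ : ℝ → ℝ → ℝ := fun q s => indicator {p : ℝ × ℝ | p.2 < p.1}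
    (fun p => D (p.1 - p.2) p.2) (q, s) with hΨ
  have hA : IsOpen {p : ℝ × ℝ | p.2 < p.1} := isOpen_lt continuous_snd continuous_fst
  have hΨm : Measurable (Function.uncurry Ψ) := by
    have h1 : ContinuousOn (fun p : ℝ × ℝ => D (p.1 - p.2) p.2) {p : ℝ × ℝ | p.2 < p.1} :=
      hD.comp (f := fun p : ℝ × ℝ => (p.1 - p.2, p.2)) (by fun_prop)
        (fun p hp => ⟨mem_Ioi.2 (sub_pos.2 hp), mem_univ _⟩)
    classical
    have h2 := h1.measurable_piecewise (g := 0) continuousOn_const hA.measurableSet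
    rwa [piecewise_eq_indicator] at h2
  have hint : Integrable (Function.uncurry Ψ)
      ((volume.restrict (Ioc 0 t)).prod (volume.restrict (Ioc 0 t))) := by
    have hf : Integrable (indicator (Ioc 0 t) (fun _ => (1 : ℝ))) :=
      (integrable_indicator_iff measurableSet_Ioc).2 (by simp)
    have hg : Integrable (indicator (Ioc 0 t) (fun τ => C * τ ^ (-(3 / 4) : ℝ))) :=
      (integrable_indicator_iff measurableSet_Ioc).2
        (((intervalIntegrable_iff_integrableOn_Ioc_of_le ht).1
          (intervalIntegrable_rpow_three_quarters 0 t)).const_mul C)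
    have hfg := hf.convolution_integrand (ContinuousLinearMap.mul ℝ ℝ) hg
    rw [Measure.prod_restrict]
    refine (hfg.integrableOn (s := Ioc 0 t ×ˢ Ioc 0 t)).mono' hΨm.aestronglyMeasurable ?_
    refine (ae_restrict_iff' (measurableSet_Ioc.prod measurableSet_Ioc)).2
      (Eventually.of_forall fun p hp => ?_)
    have hps : p.2 ∈ Ioc 0 t := hp.2
    simp only [Function.uncurry, hΨ, ContinuousLinearMap.mul_apply', indicator_of_mem hps, one_mul]
    by_cases h : p.2 < p.1
    · rw [indicator_of_mem (show (p.1, p.2) ∈ {p : ℝ × ℝ | p.2 < p.1} from h),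
        indicator_of_mem (show p.1 - p.2 ∈ Ioc 0 t from ⟨sub_pos.2 h, by
          linarith [hp.1.2, hps.1]⟩)]
      exact hDC _ _ (sub_pos.2 h)
    · rw [indicator_of_notMem (show (p.1, p.2) ∉ {p : ℝ × ℝ | p.2 < p.1} from h), norm_zero,
        indicator_of_notMem]
      exact fun h' => h (sub_pos.1 h'.1)
  have hDint : ∀ s, 0 ≤ t - s → IntervalIntegrable (fun q => D (q - s) s) volume s t := fun s hs => by
    have h1 : IntervalIntegrable (fun q => C * (q - s) ^ (-(3 / 4) : ℝ)) volume s t := by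
      have := ((intervalIntegrable_rpow_three_quarters 0 (t - s)).comp_sub_right s).const_mul C
      simpa using this
    refine h1.mono_fun' ?_ ?_
    · rw [uIoc_of_le (by linarith)]
      refine ContinuousOn.aestronglyMeasurable ?_ measurableSet_Ioc
      exact hD.comp (f := fun q : ℝ => (q - s, s)) (by fun_prop)
        (fun q hq => ⟨mem_Ioi.2 (sub_pos.2 hq.1), mem_univ _⟩)
    · rw [uIoc_of_le (by linarith)]
      exact (ae_restrict_iff' measurableSet_Ioc).2
        (Eventually.of_forall fun q hq => hDC _ _ (sub_pos.2 hq.1))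
  have e1 : ∫ q in 0..t, ∫ s in 0..q, D (q - s) s =
      ∫ q in Ioc 0 t, ∫ s in Ioc 0 t, Ψ q s := by
    rw [intervalIntegral.integral_of_le ht]
    refine setIntegral_congr_fun measurableSet_Ioc fun q hq => ?_
    rw [intervalIntegral.integral_of_le hq.1.le, integral_Ioc_eq_integral_Ioo]
    have : ∀ s, Ψ q s = indicator (Iio q) (fun s => D (q - s) s) s := fun s => by
      simp only [hΨ, indicator, mem_ofPred_eq, mem_Iio]
    simp only [this]
    rw [setIntegral_indicator measurableSet_Iio]
    congr 2
    ext s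
    simp only [mem_Ioo, mem_inter_iff, mem_Ioc, mem_Iio]
    exact ⟨fun h => ⟨⟨h.1, h.2.le.trans hq.2⟩, h.2⟩, fun h => ⟨h.1.1, h.2⟩⟩
  have e2 : ∫ s in Ioc 0 t, ∫ q in Ioc 0 t, Ψ q s = ∫ s in 0..t, (k (t - s) s - k 0 s) := by
    rw [intervalIntegral.integral_of_le ht]
    refine setIntegral_congr_fun measurableSet_Ioc fun s hs => ?_
    have h3 : ∫ q in s..t, D (q - s) s = k (t - s) s - k (s - s) s := by
      refine intervalIntegral.integral_eq_sub_of_hasDerivAt_of_le hs.2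
        (f := fun q => k (q - s) s)
        (hk.comp (by fun_prop : Continuous fun q : ℝ => (q - s, s))).continuousOn
        (fun q hq => ?_) (hDint s (by linarith [hs.2]))
      have := (hkD s (q - s) (sub_pos.2 hq.1)).comp q ((hasDerivAt_id q).sub_const s)
      simpa [Function.comp_def] using this
    rw [sub_self] at h3
    rw [← h3, intervalIntegral.integral_of_le hs.2]
    have : ∀ q, Ψ q s = indicator (Ioi s) (fun q => D (q - s) s) q := fun q => by
      simp only [hΨ, indicator, mem_ofPred_eq, mem_Ioi]
    simp only [this]
    rw [setIntegral_indicator measurableSet_Ioi]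
    congr 2
    ext q
    simp only [mem_inter_iff, mem_Ioc, mem_Ioi]
    exact ⟨fun h => ⟨h.2, h.1.2⟩, fun h => ⟨⟨hs.1.trans h.1, h.2⟩, h.1⟩⟩
  rw [e1, integral_integral_swap hint, e2, ← intervalIntegral.integral_add]
  · simp
  · exact (hk.comp (by fun_prop : Continuous fun s : ℝ => ((0 : ℝ), s))).intervalIntegrable _ _
  · exact ((hk.comp (by fun_prop : Continuous fun s : ℝ => (t - s, s))).sub
      (hk.comp (by fun_prop : Continuous fun s : ℝ => ((0 : ℝ), s)))).intervalIntegrable _ _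

end Duhamel

/-! ### The heat flow and the inhomogeneous heat equation -/

section HeatFlow

variable {E : Type*} [NormedAddCommGroup E] [InnerProductSpace ℝ E] [FiniteDimensional ℝ E]
  [MeasurableSpace E] [BorelSpace E]
variable {V W : Type*} [NormedAddCommGroup V] [NormedSpace ℝ V]
  [NormedAddCommGroup W] [NormedSpace ℝ W]

theorem norm_kernelAvg_lapKer_le {φ : E → ℝ} (hφ : Continuous φ) {M : ℝ} (hM : ∀ x, ‖φ x‖ ≤ M)
    {H : ℝ} (hH : ∀ x y, ‖φ x - φ y‖ ≤ H * √‖x - y‖) {l : ℝ} (hl : 0 ≤ l) (x : E) :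
    ‖kernelAvg lapKer l φ x‖ ≤ Module.finrank ℝ E *
      ((∫ z : E, ‖derivKernel gradKer z‖ * √‖z‖) * (H * √l)) := by
  rw [kernelAvg_lapKer hφ hM (stdOrthonormalBasis ℝ E)]
  have h1 := norm_kernelAvg_derivKernel_le isGoodKernel_gradKer hφ hM hH hl x
  refine (norm_sum_le_of_le (f := fun i => kernelAvg (derivKernel gradKer) l φ x
    (stdOrthonormalBasis ℝ E i) (stdOrthonormalBasis ℝ E i)) Finset.univ (fun i _ => ?_)).trans_eq
    (by rw [Finset.sum_const, Finset.card_univ, Fintype.card_fin, nsmul_eq_mul])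
  have h2 := (kernelAvg (derivKernel gradKer) l φ x).le_of_opNorm_le h1 (stdOrthonormalBasis ℝ E i)
  have h3 := (kernelAvg (derivKernel gradKer) l φ x (stdOrthonormalBasis ℝ E i)).le_of_opNorm_le h2
    (stdOrthonormalBasis ℝ E i)
  simpa using h3

theorem duhamelBound_lapKer {F : E → ℝ → ℝ} {M : ℝ} (hF : IsSource F M) {H : ℝ}
    (hH : IsHolder F H) : DuhamelBound 1 lapKer F (Module.finrank ℝ E *
      ((∫ z : E, ‖derivKernel gradKer z‖ * √‖z‖) * H)) := by
  have := hH.1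
  refine duhamelBound_one_of_le (by positivity) fun x s l hl => ?_
  refine (norm_kernelAvg_lapKer_le (hF.slice s) (fun y => hF.2 y s)
    (fun x y => hH.2 x y s) hl x).trans_eq (by ring)

theorem IntervalIntegrable.clm_apply_const {f : ℝ → W →L[ℝ] V} {a b : ℝ}
    (hf : IntervalIntegrable f volume a b) (v : W) :
    IntervalIntegrable (fun θ => f θ v) volume a b :=
  ⟨hf.1.apply_continuousLinearMap v, hf.2.apply_continuousLinearMap v⟩

theorem duhamel_lapKer {F : E → ℝ → ℝ} {M : ℝ} (hF : IsSource F M) {H : ℝ}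
    (hH : IsHolder F H) {ι : Type*} [Fintype ι] (b : OrthonormalBasis ι ℝ E) (x : E) (t : ℝ) :
    duhamel 1 lapKer F x t = ∑ i, duhamel 1 (derivKernel gradKer) F x t (b i) (b i) := by
  have hint := intervalIntegrable_duhamel isGoodKernel_gradKer.decay_derivKernel hF
    (duhamelBound_of_holder isGoodKernel_gradKer hF hH) x t
  have e : ∀ i, duhamel 1 (derivKernel gradKer) F x t (b i) (b i) =
      ∫ θ in (0 : ℝ)..1, (θ ^ (-1 : ℝ) • kernelAvg (derivKernel gradKer) (√(t * θ))
        (fun y => F y (t * (1 - θ))) x) (b i) (b i) := fun i => by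
    rw [duhamel, ContinuousLinearMap.intervalIntegral_apply hint,
      ContinuousLinearMap.intervalIntegral_apply (hint.clm_apply_const _)]
  simp only [e]
  rw [← intervalIntegral.integral_finsetSum fun i _ =>
    (hint.clm_apply_const (b i)).clm_apply_const (b i), duhamel]
  refine intervalIntegral.integral_congr fun θ _ => ?_
  simp only [smul_apply, ← Finset.smul_sum]
  rw [kernelAvg_lapKer (hF.slice _) (fun y => hF.2 y _) b]

/-- Return from the self-similar variable `θ` to the time variable `s = q (1 - θ)`. -/
theorem integral_self_similar (g : ℝ → ℝ → ℝ) {q : ℝ} (hq : q ≠ 0) :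
    ∫ θ in (0 : ℝ)..1, g (q * θ) (q * (1 - θ)) = q⁻¹ * ∫ s in 0..q, g (q - s) s := by
  have h := intervalIntegral.integral_comp_sub_mul (a := 0) (b := 1) (fun s => g (q - s) s) hq q
  simp only [mul_one, sub_self, mul_zero, sub_zero, smul_eq_mul] at h
  rw [← h]
  refine intervalIntegral.integral_congr fun θ _ => ?_
  congr 1 <;> ring

/-- The Duhamel integral of the heat semigroup solves the inhomogeneous heat equation. -/
theorem hasDerivAt_duhamel_heatKer {F : E → ℝ → ℝ} {M : ℝ} (hF : IsSource F M) {H : ℝ}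
    (hH : IsHolder F H) (x : E) {t : ℝ} (ht : 0 < t) :
    HasDerivAt (fun t => t * duhamel 0 (heatKer ℝ) F x t)
      (F x t + duhamel 1 lapKer F x t) t := by
  set k : ℝ → ℝ → ℝ := fun τ s => kernelAvg (heatKer ℝ) (√τ) (fun y => F y s) x with hk
  set D : ℝ → ℝ → ℝ := fun τ s => τ⁻¹ * kernelAvg lapKer (√τ) (fun y => F y s) x with hD
  have hkc : Continuous (Function.uncurry k) :=
    continuous_kernelAvg (X := ℝ × ℝ) isGoodKernel_heatKer.decay (F := fun q y => F y q.2)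
      (hF.1.comp (by fun_prop : Continuous fun p : (ℝ × ℝ) × E => (p.2, p.1.2)))
      (fun _ _ => hF.2 _ _) (by fun_prop) continuous_const
  have hlc : Continuous (fun p : ℝ × ℝ => kernelAvg lapKer (√p.1) (fun y => F y p.2) x) :=
    continuous_kernelAvg (X := ℝ × ℝ) gaussianDecay_lapKer (F := fun q y => F y q.2)
      (hF.1.comp (by fun_prop : Continuous fun p : (ℝ × ℝ) × E => (p.2, p.1.2)))
      (fun _ _ => hF.2 _ _) (by fun_prop) continuous_const
  have hDc : ContinuousOn (Function.uncurry D) (Ioi 0 ×ˢ univ) :=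
    (continuous_fst.continuousOn.inv₀ fun p hp => (mem_Ioi.1 hp.1).ne').mul hlc.continuousOn
  set C := Module.finrank ℝ E * ((∫ z : E, ‖derivKernel gradKer z‖ * √‖z‖) * H) with hC
  have hDC : ∀ τ s, 0 < τ → |D τ s| ≤ C * τ ^ (-(3 / 4) : ℝ) := fun τ s hτ => by
    have h1 := norm_kernelAvg_lapKer_le (hF.slice s) (fun y => hF.2 y s)
      (fun x y => hH.2 x y s) (Real.sqrt_nonneg τ) x
    have e : √√τ = τ ^ (1 / 4 : ℝ) := by
      rw [Real.sqrt_eq_rpow, Real.sqrt_eq_rpow, ← Real.rpow_mul hτ.le]; norm_num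
    have e2 : τ ^ (-(3 / 4) : ℝ) = τ⁻¹ * τ ^ (1 / 4 : ℝ) := by
      rw [← Real.rpow_neg_one, ← Real.rpow_add hτ]; norm_num
    rw [hD, abs_mul, abs_of_pos (inv_pos.2 hτ), e2]
    rw [e] at h1
    calc _ ≤ τ⁻¹ * _ := mul_le_mul_of_nonneg_left h1 (by positivity)
      _ = _ := by rw [hC]; ring
  have key : ∀ t, 0 < t → t * duhamel 0 (heatKer ℝ) F x t =
      (∫ s in 0..t, F x s) + ∫ q in 0..t, duhamel 1 lapKer F x q := fun t ht => by
    have h1 := integral_comp_sub_eq_integral hkc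
      (fun s τ hτ => hasDerivAt_kernelAvg_heatKer (hF.slice s) (fun y => hF.2 y s) x hτ)
      hDc hDC ht.le
    have h2 : t * duhamel 0 (heatKer ℝ) F x t = ∫ s in 0..t, k (t - s) s := by
      have h3 := integral_self_similar k ht.ne'
      rw [duhamel]
      simp only [neg_zero, Real.rpow_zero, one_smul]
      rw [h3, mul_inv_cancel_left₀ ht.ne']
    rw [h2, h1]
    congr 1
    · refine intervalIntegral.integral_congr fun s _ => ?_
      simp only [hk]
      rw [Real.sqrt_zero, kernelAvg_zero, integral_heatKer_apply]
    · refine intervalIntegral.integral_congr_ae (Eventually.of_forall fun q hq => ?_)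
      rw [uIoc_of_le ht.le] at hq
      have h3 := integral_self_similar D hq.1.ne'
      rw [eq_inv_mul_iff_mul_eq₀ hq.1.ne', ← intervalIntegral.integral_const_mul] at h3
      rw [← h3, duhamel]
      refine intervalIntegral.integral_congr fun θ _ => ?_
      simp only [hD]
      rw [Real.rpow_neg_one, mul_inv, smul_eq_mul]
      field_simp [hq.1.ne']
  have hF1 : Continuous fun s => F x s :=
    hF.1.comp (by fun_prop : Continuous fun s : ℝ => (x, s))
  have hd1 : Continuous fun s => duhamel 1 lapKer F x s :=
    (continuous_duhamel gaussianDecay_lapKer hF (duhamelBound_lapKer hF hH)).comp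
      (by fun_prop : Continuous fun s : ℝ => (x, s))
  refine ((hF1.integral_hasStrictDerivAt 0 t).hasDerivAt.add
    (hd1.integral_hasStrictDerivAt 0 t).hasDerivAt).congr_of_eventuallyEq ?_
  filter_upwards [Ioi_mem_nhds ht] with s hs using key s hs

/-- The heat flow `e^{tΔ} φ` at `x`; for `t ≤ 0` it is `φ` itself. -/
def heatFlow (φ : E → W) (x : E) (t : ℝ) : W := kernelAvg (heatKer W) (√t) φ x

theorem integral_norm_heatKer_le : ∫ z : E, ‖heatKer W z‖ ≤ 1 := by
  rw [← integral_gaussKer (E := E)]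
  refine integral_mono isGoodKernel_heatKer.decay.integrable.norm
    isGoodKernel_gaussKer.decay.integrable fun z => ?_
  have h := norm_smul_le (gaussKer z) (ContinuousLinearMap.id ℝ W)
  rw [Real.norm_of_nonneg (gaussKer_pos z).le] at h
  exact h.trans (mul_le_of_le_one_right (gaussKer_pos z).le ContinuousLinearMap.norm_id_le)

theorem norm_heatFlow_le {φ : E → W} {M : ℝ} (hM : ∀ x, ‖φ x‖ ≤ M) (x : E)
    (t : ℝ) : ‖heatFlow φ x t‖ ≤ M := by
  have hM0 : 0 ≤ M := (norm_nonneg _).trans (hM 0)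
  exact (norm_kernelAvg_le isGoodKernel_heatKer.decay hM _ _).trans
    (mul_le_of_le_one_left hM0 integral_norm_heatKer_le)

theorem continuous_heatFlow {φ : E → W} (hφ : Continuous φ) {M : ℝ} (hM : ∀ x, ‖φ x‖ ≤ M) :
    Continuous (Function.uncurry (heatFlow φ)) :=
  continuous_kernelAvg (X := E × ℝ) isGoodKernel_heatKer.decay (F := fun _ y => φ y)
    (hφ.comp continuous_snd) (fun _ _ => hM _) (by fun_prop) continuous_fst

theorem heatFlow_of_nonpos [CompleteSpace W] (φ : E → W) (x : E) {t : ℝ} (ht : t ≤ 0) :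
    heatFlow φ x t = φ x := by
  rw [heatFlow, Real.sqrt_eq_zero_of_nonpos ht, kernelAvg_zero, integral_heatKer_apply]

theorem hasFDerivAt_heatFlow {φ : E → W} {φ' : E → E →L[ℝ] W} (hφ : ∀ x, HasFDerivAt φ (φ' x) x)
    {M : ℝ} (hM : ∀ x, ‖φ x‖ ≤ M) (hφ' : Continuous φ') {M' : ℝ} (hM' : ∀ x, ‖φ' x‖ ≤ M') (x : E)
    (t : ℝ) : HasFDerivAt (fun x => heatFlow φ x t) (heatFlow φ' x t) x := by
  refine (hasFDerivAt_kernelAvg_of_hasFDerivAt isGoodKernel_heatKer.decay hφ hM hφ' hM' (√t)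
    x).congr_fderiv ?_
  rw [heatFlow, kernelAvg]
  congr 1

/-- The heat flow of Lipschitz data moves by at most a multiple of `√t`. -/
theorem norm_heatFlow_sub_self_le [CompleteSpace W] : ∃ C, 0 ≤ C ∧ ∀ (φ : E → W) (M L : ℝ),
    Continuous φ → (∀ x, ‖φ x‖ ≤ M) → (∀ x y, ‖φ x - φ y‖ ≤ L * ‖x - y‖) → ∀ x t,
      ‖heatFlow φ x t - φ x‖ ≤ C * L * √t := by
  have hint : Integrable (fun z : E => ‖heatKer W z‖ * ‖z‖) := by
    have := isGoodKernel_gaussKer_smul (E := E).decay.integrable.norm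
    refine this.mono' ((isGoodKernel_heatKer (W := W)).decay.1.norm.mul
      continuous_norm).aestronglyMeasurable (Eventually.of_forall fun z => ?_)
    rw [Real.norm_of_nonneg (by positivity), norm_smul]
    gcongr
    have h := norm_smul_le (gaussKer z) (ContinuousLinearMap.id ℝ W)
    exact h.trans (mul_le_of_le_one_right (norm_nonneg _) ContinuousLinearMap.norm_id_le)
  refine ⟨∫ z : E, ‖heatKer W z‖ * ‖z‖, by positivity, fun φ M L hφ hM hL x t => ?_⟩
  have h1 : heatFlow φ x t - φ x = ∫ z, heatKer W z (φ (x + √t • z) - φ x) := by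
    simp only [map_sub]
    rw [integral_sub (integrable_kernelAvg isGoodKernel_heatKer.decay hφ hM _ x),
      integral_heatKer_apply, heatFlow, kernelAvg]
    simpa using integrable_kernelAvg isGoodKernel_heatKer.decay hφ hM 0 x
  rw [h1, mul_assoc, ← integral_mul_const]
  refine norm_integral_le_of_norm_le (hint.mul_const _) (Eventually.of_forall fun z => ?_)
  have h2 := hL (x + √t • z) x
  rw [add_sub_cancel_left, norm_smul, Real.norm_of_nonneg (Real.sqrt_nonneg t)] at h2
  calc _ ≤ ‖heatKer W z‖ * (L * (√t * ‖z‖)) := (heatKer W z).le_opNorm_of_le h2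
    _ = _ := by ring

theorem norm_heatFlow_sub_le_of_lipschitz {φ : E → W} (hφ : Continuous φ) {M L : ℝ}
    (hM : ∀ x, ‖φ x‖ ≤ M) (hL : ∀ x y, ‖φ x - φ y‖ ≤ L * ‖x - y‖) (x y : E) (t : ℝ) :
    ‖heatFlow φ x t - heatFlow φ y t‖ ≤ L * ‖x - y‖ := by
  have h1 : heatFlow φ x t - heatFlow φ y t = ∫ z, heatKer W z (φ (x + √t • z) - φ (y + √t • z)) := by
    simp only [map_sub]
    rw [integral_sub (integrable_kernelAvg isGoodKernel_heatKer.decay hφ hM _ x)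
      (integrable_kernelAvg isGoodKernel_heatKer.decay hφ hM _ y)]
    rfl
  have h0 : 0 ≤ L * ‖x - y‖ := (norm_nonneg _).trans (hL x y)
  rw [h1]
  calc _ ≤ ∫ z : E, ‖heatKer W z‖ * (L * ‖x - y‖) := by
        refine norm_integral_le_of_norm_le (isGoodKernel_heatKer.decay.integrable.norm.mul_const _)
          (Eventually.of_forall fun z => (heatKer W z).le_opNorm_of_le ?_)
        simpa using hL (x + √t • z) (y + √t • z)
    _ = (∫ z : E, ‖heatKer W z‖) * (L * ‖x - y‖) := integral_mul_const _ _
    _ ≤ _ := mul_le_of_le_one_left h0 integral_norm_heatKer_le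

/-- For `C²` data the time derivative of the heat flow is the trace of the heat flow of the second
derivative. -/
theorem hasDerivAt_heatFlow {φ : E → ℝ} {φ' : E → E →L[ℝ] ℝ} {φ'' : E → E →L[ℝ] E →L[ℝ] ℝ}
    (hφ : ∀ x, HasFDerivAt φ (φ' x) x) (hφ' : ∀ x, HasFDerivAt φ' (φ'' x) x)
    (hφ'' : Continuous φ'') {M M' M'' : ℝ} (hM : ∀ x, ‖φ x‖ ≤ M) (hM' : ∀ x, ‖φ' x‖ ≤ M')
    (hM'' : ∀ x, ‖φ'' x‖ ≤ M'') {ι : Type*} [Fintype ι] (b : OrthonormalBasis ι ℝ E) (x : E)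
    {t : ℝ} (ht : 0 < t) :
    HasDerivAt (fun t => heatFlow φ x t) (∑ i, heatFlow φ'' x t (b i) (b i)) t := by
  have hφc : Continuous φ := continuous_iff_continuousAt.2 fun x => (hφ x).continuousAt
  have hφ'c : Continuous φ' := continuous_iff_continuousAt.2 fun x => (hφ' x).continuousAt
  have hs : √t ≠ 0 := (Real.sqrt_pos.2 ht).ne'
  have hD1 : ∀ x, heatFlow φ' x t = (√t)⁻¹ • kernelAvg gradKer (√t) φ x := fun x => by
    have h1 := hasFDerivAt_kernelAvg isGoodKernel_heatKer hφc hM hs x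
    rw [funext derivKernel_heatKer] at h1
    exact (hasFDerivAt_heatFlow hφ hM hφ'c hM' x t).unique h1
  have hD2 : heatFlow φ'' x t = (√t)⁻¹ • (√t)⁻¹ • kernelAvg (derivKernel gradKer) (√t) φ x := by
    have h1 := (hasFDerivAt_kernelAvg isGoodKernel_gradKer hφc hM hs x).const_smul (√t)⁻¹
    have h2 := hasFDerivAt_heatFlow hφ' hM' hφ'' hM'' x t
    rw [show (fun x => heatFlow φ' x t) = fun x => (√t)⁻¹ • kernelAvg gradKer (√t) φ x from
      funext hD1] at h2
    exact h2.unique h1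
  refine (hasDerivAt_kernelAvg_heatKer hφc hM x ht).congr_deriv ?_
  rw [kernelAvg_lapKer hφc hM b, hD2]
  simp only [smul_apply, smul_smul, ← Finset.smul_sum, ← mul_inv, Real.mul_self_sqrt ht.le]
  rfl

/-- Duhamel's formula `e^{tΔ} φ + ∫₀ᵗ K_{t-s} * F(s) ds` for a kernel with singularity `1/2`. -/
def duhamelHalf (φ : E → V) (K : E → W →L[ℝ] V) (F : E → ℝ → W) (x : E) (t : ℝ) : V :=
  heatFlow φ x t + √t • duhamel (1 / 2) K F x t

/-- The space derivative of `duhamelHalf φ K F` for a Hölder continuous source; here `φ'` is the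
derivative of `φ`. -/
def duhamelHalfDeriv (φ' : E → E →L[ℝ] V) (K : E → W →L[ℝ] V) (F : E → ℝ → W) (x : E) (t : ℝ) :
    E →L[ℝ] V :=
  heatFlow φ' x t + duhamel 1 (derivKernel K) F x t

theorem duhamelBound_half {K : E → W →L[ℝ] V} (hK : GaussianDecay K)
    {F : E → ℝ → W} {M : ℝ} (hF : IsSource F M) :
    DuhamelBound (1 / 2) K F ((∫ z, ‖K z‖) * M) :=
  duhamelBound_of_le (by norm_num) hK hF

theorem continuous_duhamelHalf {φ : E → V} (hφ : Continuous φ) {M : ℝ} (hM : ∀ x, ‖φ x‖ ≤ M)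
    {K : E → W →L[ℝ] V} (hK : GaussianDecay K) {F : E → ℝ → W} {MF : ℝ} (hF : IsSource F MF) :
    Continuous (Function.uncurry (duhamelHalf φ K F)) :=
  (continuous_heatFlow hφ hM).add ((Real.continuous_sqrt.comp continuous_snd).smul
    (continuous_duhamel hK hF (duhamelBound_half hK hF)))

theorem continuous_duhamelHalfDeriv [CompleteSpace V] {φ' : E → E →L[ℝ] V} (hφ : Continuous φ')
    {M : ℝ} (hM : ∀ x, ‖φ' x‖ ≤ M) {K : E → W →L[ℝ] V} (hK : IsGoodKernel K) {F : E → ℝ → W}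
    {MF : ℝ} (hF : IsSource F MF) {H : ℝ} (hH : IsHolder F H) :
    Continuous (Function.uncurry (duhamelHalfDeriv φ' K F)) :=
  (continuous_heatFlow hφ hM).add
    (continuous_duhamel hK.decay_derivKernel hF (duhamelBound_of_holder hK hF hH))

theorem duhamel_derivKernel_of_nonpos [CompleteSpace V] (a : ℝ) {K : E → W →L[ℝ] V}
    (hK : IsGoodKernel K) (F : E → ℝ → W) (x : E) {t : ℝ} (ht : t ≤ 0) :
    duhamel a (derivKernel K) F x t = 0 := by
  rw [duhamel]
  refine intervalIntegral.integral_zero_ae (Eventually.of_forall fun θ hθ => ?_)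
  rw [uIoc_of_le zero_le_one] at hθ
  rw [Real.sqrt_eq_zero_of_nonpos (mul_nonpos_of_nonpos_of_nonneg ht hθ.1.le), kernelAvg_zero,
    integral_derivKernel_apply hK, smul_zero]

theorem hasFDerivAt_duhamelHalf [CompleteSpace V] {φ : E → V} {φ' : E → E →L[ℝ] V}
    (hφ : ∀ x, HasFDerivAt φ (φ' x) x)
    {M : ℝ} (hM : ∀ x, ‖φ x‖ ≤ M) (hφ' : Continuous φ') {M' : ℝ} (hM' : ∀ x, ‖φ' x‖ ≤ M')
    {K : E → W →L[ℝ] V} (hK : IsGoodKernel K) {F : E → ℝ → W}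
    {MF : ℝ} (hF : IsSource F MF) {H : ℝ} (hH : IsHolder F H) (x : E) (t : ℝ) :
    HasFDerivAt (fun x => duhamelHalf φ K F x t) (duhamelHalfDeriv φ' K F x t) x := by
  refine (hasFDerivAt_heatFlow hφ hM hφ' hM' x t).add ?_
  rcases le_or_gt t 0 with ht | ht
  · rw [duhamel_derivKernel_of_nonpos 1 hK F x ht]
    simp only [Real.sqrt_eq_zero_of_nonpos ht, zero_smul]
    exact hasFDerivAt_const _ _
  · have hb := duhamelBound_of_holder hK hF hH
    have h1 := (hasFDerivAt_duhamel (a := 1 / 2) (C' := (∫ z, ‖derivKernel K z‖ * √‖z‖) * H) hK hF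
      (duhamelBound_half hK.decay hF) (by convert hb using 1; norm_num) x ht).const_smul (√t)
    refine h1.congr_fderiv ?_
    rw [smul_inv_smul₀ (Real.sqrt_pos.2 ht).ne']
    norm_num

/-- The solution `e^{tΔ} φ + ∫₀ᵗ e^{(t-s)Δ} F(s) ds` of the inhomogeneous heat equation. -/
def heatSolution (φ : E → ℝ) (F : E → ℝ → ℝ) (x : E) (t : ℝ) : ℝ :=
  heatFlow φ x t + t * duhamel 0 (heatKer ℝ) F x t

theorem duhamelBound_zero {K : E → W →L[ℝ] V} (hK : GaussianDecay K)
    {F : E → ℝ → W} {M : ℝ} (hF : IsSource F M) : DuhamelBound 0 K F ((∫ z, ‖K z‖) * M) :=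
  duhamelBound_of_le (by norm_num) hK hF

theorem continuous_heatSolution {φ : E → ℝ} (hφ : Continuous φ) {M : ℝ} (hM : ∀ x, ‖φ x‖ ≤ M)
    {F : E → ℝ → ℝ} {MF : ℝ} (hF : IsSource F MF) :
    Continuous (Function.uncurry (heatSolution φ F)) :=
  (continuous_heatFlow hφ hM).add (continuous_snd.mul
    (continuous_duhamel isGoodKernel_heatKer.decay hF
      (duhamelBound_zero isGoodKernel_heatKer.decay hF)))

theorem hasFDerivAt_heatSolution {φ : E → ℝ} {φ' : E → E →L[ℝ] ℝ}
    (hφ : ∀ x, HasFDerivAt φ (φ' x) x)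
    {M : ℝ} (hM : ∀ x, ‖φ x‖ ≤ M) (hφ' : Continuous φ') {M' : ℝ} (hM' : ∀ x, ‖φ' x‖ ≤ M')
    {F : E → ℝ → ℝ} {MF : ℝ} (hF : IsSource F MF) (x : E) {t : ℝ} (ht : 0 ≤ t) :
    HasFDerivAt (fun x => heatSolution φ F x t) (duhamelHalf φ' gradKer F x t) x := by
  refine (hasFDerivAt_heatFlow hφ hM hφ' hM' x t).add ?_
  rcases ht.eq_or_lt with rfl | ht
  · simp only [Real.sqrt_zero, zero_smul, zero_mul]
    exact hasFDerivAt_const _ _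
  · have hg := funext (derivKernel_heatKer (E := E))
    have h1 := (hasFDerivAt_duhamel (a := 0) isGoodKernel_heatKer hF
      (duhamelBound_zero isGoodKernel_heatKer.decay hF)
      (C' := (∫ z : E, ‖gradKer z‖) * MF) (by
        rw [hg, zero_add]; exact duhamelBound_half isGoodKernel_gradKer.decay hF) x ht).const_mul t
    refine h1.congr_fderiv ?_
    rw [hg, zero_add, smul_smul, ← div_eq_mul_inv, Real.div_sqrt]

/-- The heat equation for `heatSolution`, the Laplacian being the trace of the second derivative
`duhamelHalfDeriv φ'' gradKer F`. -/
theorem hasDerivAt_heatSolution {φ : E → ℝ} {φ' : E → E →L[ℝ] ℝ} {φ'' : E → E →L[ℝ] E →L[ℝ] ℝ}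
    (hφ : ∀ x, HasFDerivAt φ (φ' x) x) (hφ' : ∀ x, HasFDerivAt φ' (φ'' x) x)
    (hφ'' : Continuous φ'') {M M' M'' : ℝ} (hM : ∀ x, ‖φ x‖ ≤ M) (hM' : ∀ x, ‖φ' x‖ ≤ M')
    (hM'' : ∀ x, ‖φ'' x‖ ≤ M'') {F : E → ℝ → ℝ} {MF : ℝ} (hF : IsSource F MF) {H : ℝ}
    (hH : IsHolder F H) {ι : Type*} [Fintype ι] (b : OrthonormalBasis ι ℝ E) (x : E)
    {t : ℝ} (ht : 0 < t) :
    HasDerivAt (fun t => heatSolution φ F x t)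
      (∑ i, duhamelHalfDeriv φ'' gradKer F x t (b i) (b i) + F x t) t := by
  refine ((hasDerivAt_heatFlow hφ hφ' hφ'' hM hM' hM'' b x ht).add
    (hasDerivAt_duhamel_heatKer hF hH x ht)).congr_deriv ?_
  rw [duhamel_lapKer hF hH b]
  simp only [duhamelHalfDeriv, add_apply, Finset.sum_add_distrib]
  ring

end HeatFlow

/-! ### Mild solutions by contraction -/

section MildSolution

variable {E : Type*} [NormedAddCommGroup E] [InnerProductSpace ℝ E] [FiniteDimensional ℝ E]
  [MeasurableSpace E] [BorelSpace E]
variable {V W : Type*} [NormedAddCommGroup V] [NormedSpace ℝ V]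
  [NormedAddCommGroup W] [NormedSpace ℝ W]

theorem kernelAvg_add (K : E → W →L[ℝ] V) (l : ℝ) (φ : E → W) (x e : E) :
    kernelAvg K l φ (x + e) = kernelAvg K l (fun y => φ (y + e)) x := by
  simp only [kernelAvg, add_right_comm]

theorem duhamelHalf_add (φ : E → V) (K : E → W →L[ℝ] V) (F : E → ℝ → W) (x e : E) (t : ℝ) :
    duhamelHalf φ K F (x + e) t =
      duhamelHalf (fun y => φ (y + e)) K (fun y s => F (y + e) s) x t := by
  simp only [duhamelHalf, heatFlow, duhamel, kernelAvg_add]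

/-- The factor `√t` makes the map of the contraction argument contracting for small horizons. -/
theorem norm_duhamel_half_le {K : E → W →L[ℝ] V} (hK : GaussianDecay K) {F : E → ℝ → W} {M : ℝ}
    (hF : IsSource F M) (x : E) {t : ℝ} (ht : t ≤ 1) :
    ‖√t • duhamel (1 / 2) K F x t‖ ≤ 8 * (∫ z, ‖K z‖) * M * √t := by
  have hM := hF.nonneg
  have hA : 0 ≤ ∫ z, ‖K z‖ := by positivity
  rcases le_or_gt t 0 with h0 | h0
  · rw [Real.sqrt_eq_zero_of_nonpos h0]
    simp
  · have h1 := norm_duhamel_le (duhamelBound_half hK hF) x t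
    rw [norm_smul, Real.norm_of_nonneg (Real.sqrt_nonneg t)]
    have h2 : 4 * ((∫ z, ‖K z‖) * M) * (1 + |t|) ≤ 4 * ((∫ z, ‖K z‖) * M) * 2 := by
      gcongr
      rw [abs_of_pos h0]
      linarith
    calc _ ≤ √t * (4 * ((∫ z, ‖K z‖) * M) * 2) := by gcongr; exact h1.trans h2
      _ = _ := by ring

theorem IsSource.sub {F G : E → ℝ → W} {M M' δ : ℝ} (hF : IsSource F M) (hG : IsSource G M')
    (h : ∀ x s, ‖F x s - G x s‖ ≤ δ) : IsSource (fun x s => F x s - G x s) δ :=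
  ⟨hF.1.sub hG.1, h⟩

theorem norm_duhamelHalf_sub_le (φ : E → V) {K : E → W →L[ℝ] V} (hK : GaussianDecay K)
    {F G : E → ℝ → W} {M M' δ : ℝ}
    (hF : IsSource F M) (hG : IsSource G M') (h : ∀ x s, ‖F x s - G x s‖ ≤ δ) (x : E) {t : ℝ}
    (ht : t ≤ 1) :
    ‖duhamelHalf φ K F x t - duhamelHalf φ K G x t‖ ≤ 8 * (∫ z, ‖K z‖) * δ * √t := by
  rw [duhamelHalf, duhamelHalf, add_sub_add_left_eq_sub, ← smul_sub,
    duhamel_sub hK hF hG (duhamelBound_half hK hF) (duhamelBound_half hK hG)]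
  exact norm_duhamel_half_le hK (hF.sub hG h) x ht

theorem norm_duhamelHalf_le {φ : E → V} {Mφ : ℝ} (hφ : ∀ x, ‖φ x‖ ≤ Mφ) {K : E → W →L[ℝ] V}
    (hK : GaussianDecay K) {F : E → ℝ → W} {M : ℝ}
    (hF : IsSource F M) (x : E) {t : ℝ} (ht : t ≤ 1) :
    ‖duhamelHalf φ K F x t‖ ≤ Mφ + 8 * (∫ z, ‖K z‖) * M := by
  refine (norm_add_le _ _).trans (add_le_add (norm_heatFlow_le hφ x t) ?_)
  refine (norm_duhamel_half_le hK hF x ht).trans (mul_le_of_le_one_right ?_ ?_)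
  · have := hF.nonneg
    positivity
  · exact Real.sqrt_le_one.2 ht

/-- The projection of a time onto the interval `[0, T]`. -/
def clampTime (T t : ℝ) : ℝ := max 0 (min t T)

theorem continuous_clampTime (T : ℝ) : Continuous (clampTime T) := by
  unfold clampTime; fun_prop

theorem clampTime_mem {T : ℝ} (hT : 0 ≤ T) (t : ℝ) : clampTime T t ∈ Icc 0 T :=
  ⟨le_max_left _ _, max_le hT (min_le_right _ _)⟩

theorem clampTime_of_mem {T t : ℝ} (ht : t ∈ Icc 0 T) : clampTime T t = t := by
  rw [clampTime, min_eq_left ht.2, max_eq_right ht.1]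

/-- The source of the backward equation, in reversed time, along the pair `(p, m)`. -/
def gradSource (Fn : E → (E →L[ℝ] ℝ) × ℝ → ℝ) (T : ℝ) (p : E → ℝ → E →L[ℝ] ℝ) (m : E → ℝ → ℝ)
    (x : E) (s : ℝ) : ℝ := Fn x (p x s, m x (T - s))

/-- The flux of the forward equation along the pair `(p, m)`, where `p` is in reversed time. -/
def fluxSource (B : (E →L[ℝ] ℝ) × ℝ → E) (T : ℝ) (p : E → ℝ → E →L[ℝ] ℝ) (m : E → ℝ → ℝ)
    (x : E) (t : ℝ) : E := B (p x (T - t), m x t)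

/-- Mild solutions on `[0, T]` of the forward-backward system. The unknowns are the density `m` and
the derivative `p` of the value function in reversed time; both are extended to all times by their
values at the end points of `[0, T]`. -/
structure IsMildSolution (φp : E → E →L[ℝ] ℝ) (φm : E → ℝ) (Fn : E → (E →L[ℝ] ℝ) × ℝ → ℝ)
    (B : (E →L[ℝ] ℝ) × ℝ → E) (T : ℝ) (p : E → ℝ → E →L[ℝ] ℝ) (m : E → ℝ → ℝ) : Prop where
  grad : ∀ x t, p x t = duhamelHalf φp gradKer (gradSource Fn T p m) x (clampTime T t)
  density : ∀ x t, m x t = duhamelHalf φm divKer (fluxSource B T p m) x (clampTime T t)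

variable {φp : E → E →L[ℝ] ℝ} {φm : E → ℝ} {Fn : E → (E →L[ℝ] ℝ) × ℝ → ℝ}
  {B : (E →L[ℝ] ℝ) × ℝ → E} {T : ℝ} {p : E → ℝ → E →L[ℝ] ℝ} {m : E → ℝ → ℝ}

theorem isSource_gradSource {M : ℝ} (hFn : Continuous (Function.uncurry Fn))
    (hM : ∀ x w, ‖Fn x w‖ ≤ M) (T : ℝ) (hp : Continuous (Function.uncurry p))
    (hm : Continuous (Function.uncurry m)) : IsSource (gradSource Fn T p m) M := by
  refine ⟨?_, fun _ _ => hM _ _⟩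
  have h1 : Continuous fun q : E × ℝ => p q.1 q.2 := hp
  have h2 : Continuous fun q : E × ℝ => m q.1 (T - q.2) :=
    hm.comp (by fun_prop : Continuous fun q : E × ℝ => (q.1, T - q.2))
  exact hFn.comp (continuous_fst.prodMk (h1.prodMk h2))

theorem isSource_fluxSource {M : ℝ} (hB : Continuous B)
    (hM : ∀ w, ‖B w‖ ≤ M) (T : ℝ) (hp : Continuous (Function.uncurry p))
    (hm : Continuous (Function.uncurry m)) : IsSource (fluxSource B T p m) M := by
  refine ⟨?_, fun _ _ => hM _⟩
  have h1 : Continuous fun q : E × ℝ => p q.1 (T - q.2) :=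
    hp.comp (by fun_prop : Continuous fun q : E × ℝ => (q.1, T - q.2))
  have h2 : Continuous fun q : E × ℝ => m q.1 q.2 := hm
  exact hB.comp (h1.prodMk h2)

/-- For short time there is a mild solution by the contraction mapping principle. It inherits every
period that is common to the data, since it is the only fixed point. -/
theorem exists_isMildSolution {M L : ℝ} (hL : 0 ≤ L) (hFn : Continuous (Function.uncurry Fn))
    (hFM : ∀ x w, ‖Fn x w‖ ≤ M) (hFL : ∀ x w w', ‖Fn x w - Fn x w'‖ ≤ L * ‖w - w'‖)
    (hB : Continuous B) (hBM : ∀ w, ‖B w‖ ≤ M) (hBL : ∀ w w', ‖B w - B w'‖ ≤ L * ‖w - w'‖)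
    (hφp : Continuous φp) (hφpM : ∀ x, ‖φp x‖ ≤ M) (hφm : Continuous φm) (hφmM : ∀ x, ‖φm x‖ ≤ M) :
    ∃ T₀, 0 < T₀ ∧ ∀ T ∈ Ioc 0 T₀, ∃ p m M', IsSource p M' ∧ IsSource m M' ∧
      IsMildSolution φp φm Fn B T p m ∧
      ∀ e, (∀ x, φp (x + e) = φp x) → (∀ x, φm (x + e) = φm x) →
        (∀ x w, Fn (x + e) w = Fn x w) → ∀ x t, p (x + e) t = p x t ∧ m (x + e) t = m x t := by
  have hM0 : 0 ≤ M := (norm_nonneg _).trans (hφpM 0)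
  set A : ℝ := (∫ z : E, ‖gradKer z‖) + ∫ z : E, ‖divKer z‖ with hA
  have hg0 : 0 ≤ ∫ z : E, ‖gradKer z‖ := by positivity
  have hd0 : 0 ≤ ∫ z : E, ‖divKer z‖ := by positivity
  have hA0 : 0 ≤ A := by positivity
  -- the Lipschitz constant of the fixed point map is `8 * A * L * √T`, which has to be at most `1/2`
  refine ⟨min 1 ((1 / (16 * (A * L + 1))) ^ 2), by positivity, fun T hT => ?_⟩
  have hT0 : 0 ≤ T := hT.1.le
  have hT1 : T ≤ 1 := hT.2.trans (min_le_left _ _)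
  have hsT : √T ≤ 1 / (16 * (A * L + 1)) :=
    Real.sqrt_le_iff.2 ⟨by positivity, hT.2.trans (min_le_right _ _)⟩
  have hsmall : 8 * A * L * √T ≤ 1 / 2 := by
    have h1 : 8 * A * L * √T ≤ 8 * A * L * (1 / (16 * (A * L + 1))) := by gcongr
    refine h1.trans ?_
    rw [mul_one_div, div_le_div_iff₀ (by positivity) (by norm_num)]
    nlinarith [mul_nonneg hA0 hL]
  have hc1 : ∀ t, clampTime T t ≤ 1 := fun t => (clampTime_mem hT0 t).2.trans hT1
  -- the sources are continuous along every bounded continuous pair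
  have hsF : ∀ w : BoundedContinuousFunction (E × ℝ) ((E →L[ℝ] ℝ) × ℝ),
      IsSource (gradSource Fn T (fun x t => (w (x, t)).1) (fun x t => (w (x, t)).2)) M := fun w =>
    isSource_gradSource hFn hFM T (continuous_fst.comp w.continuous) (continuous_snd.comp w.continuous)
  have hsB : ∀ w : BoundedContinuousFunction (E × ℝ) ((E →L[ℝ] ℝ) × ℝ),
      IsSource (fluxSource B T (fun x t => (w (x, t)).1) (fun x t => (w (x, t)).2)) M := fun w =>
    isSource_fluxSource hB hBM T (continuous_fst.comp w.continuous) (continuous_snd.comp w.continuous)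
  let f : BoundedContinuousFunction (E × ℝ) ((E →L[ℝ] ℝ) × ℝ) → E × ℝ → (E →L[ℝ] ℝ) × ℝ := fun w q =>
    (duhamelHalf φp gradKer
        (gradSource Fn T (fun x t => (w (x, t)).1) (fun x t => (w (x, t)).2)) q.1 (clampTime T q.2),
      duhamelHalf φm divKer
        (fluxSource B T (fun x t => (w (x, t)).1) (fun x t => (w (x, t)).2)) q.1 (clampTime T q.2))
  have hcq : Continuous fun q : E × ℝ => (q.1, clampTime T q.2) :=
    continuous_fst.prodMk ((continuous_clampTime T).comp continuous_snd)
  have hfc : ∀ w, Continuous (f w) := fun w =>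
    ((continuous_duhamelHalf hφp hφpM isGoodKernel_gradKer.decay (hsF w)).comp hcq).prodMk
      ((continuous_duhamelHalf hφm hφmM isGoodKernel_divKer.decay (hsB w)).comp hcq)
  have hfb : ∀ w q, ‖f w q‖ ≤ M + 8 * A * M := fun w q => by
    refine max_le ?_ ?_
    · refine (norm_duhamelHalf_le hφpM isGoodKernel_gradKer.decay (hsF w) _ (hc1 _)).trans ?_
      gcongr
      linarith
    · refine (norm_duhamelHalf_le hφmM isGoodKernel_divKer.decay (hsB w) _ (hc1 _)).trans ?_
      gcongr
      linarith
  let Φ : BoundedContinuousFunction (E × ℝ) ((E →L[ℝ] ℝ) × ℝ) →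
      BoundedContinuousFunction (E × ℝ) ((E →L[ℝ] ℝ) × ℝ) := fun w =>
    BoundedContinuousFunction.ofNormedAddCommGroup (f w) (hfc w) _ (hfb w)
  have hΦ : ContractingWith (1 / 2) Φ := by
    refine ⟨by rw [← NNReal.coe_lt_coe]; norm_num, LipschitzWith.of_dist_le_mul fun w w' => ?_⟩
    rw [BoundedContinuousFunction.dist_le (by positivity)]
    intro q
    have hww : ∀ x t t', ‖(((w (x, t)).1, (w (x, t')).2) : (E →L[ℝ] ℝ) × ℝ) -
        ((w' (x, t)).1, (w' (x, t')).2)‖ ≤ dist w w' := fun x t t' => by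
      refine max_le ?_ ?_
      · exact (norm_fst_le (w (x, t) - w' (x, t))).trans
          ((dist_eq_norm _ _).symm.le.trans (w.dist_coe_le_dist _))
      · exact (norm_snd_le (w (x, t') - w' (x, t'))).trans
          ((dist_eq_norm _ _).symm.le.trans (w.dist_coe_le_dist _))
    have hbound : ∀ a, a ≤ A → 0 ≤ a → 8 * a * (L * dist w w') * √(clampTime T q.2) ≤
        ((1 / 2 : NNReal) : ℝ) * dist w w' := fun a ha ha0 => by
      calc _ ≤ 8 * A * (L * dist w w') * √T := by gcongr; exact (clampTime_mem hT0 _).2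
        _ = (8 * A * L * √T) * dist w w' := by ring
        _ ≤ (1 / 2) * dist w w' := by gcongr
        _ = _ := by norm_num
    rw [dist_eq_norm]
    refine max_le ?_ ?_
    · refine (norm_duhamelHalf_sub_le φp isGoodKernel_gradKer.decay (hsF w) (hsF w')
        (fun x s => (hFL x _ _).trans (mul_le_mul_of_nonneg_left (hww x s (T - s)) hL)) q.1
        (hc1 q.2)).trans (hbound _ (by linarith) hg0)
    · refine (norm_duhamelHalf_sub_le φm isGoodKernel_divKer.decay (hsB w) (hsB w')
        (fun x s => (hBL _ _).trans (mul_le_mul_of_nonneg_left (hww x (T - s) s) hL)) q.1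
        (hc1 q.2)).trans (hbound _ (by linarith) hd0)
  set w := hΦ.fixedPoint Φ with hw
  have hfix : Φ w = w := hΦ.fixedPoint_isFixedPt
  refine ⟨fun x t => (w (x, t)).1, fun x t => (w (x, t)).2, ‖w‖,
    ⟨continuous_fst.comp w.continuous, fun x s => (norm_fst_le _).trans (w.norm_coe_le_norm _)⟩,
    ⟨continuous_snd.comp w.continuous, fun x s => (norm_snd_le _).trans (w.norm_coe_le_norm _)⟩,
    ⟨fun x t => ?_, fun x t => ?_⟩, fun e hpe hme hFe x t => ?_⟩
  · exact congrArg Prod.fst (DFunLike.congr_fun hfix (x, t)).symm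
  · exact congrArg Prod.snd (DFunLike.congr_fun hfix (x, t)).symm
  · -- the translate of the fixed point is a fixed point
    let w' : BoundedContinuousFunction (E × ℝ) ((E →L[ℝ] ℝ) × ℝ) :=
      w.compContinuous ⟨fun q => (q.1 + e, q.2), by fun_prop⟩
    have hw' : Φ w' = w' := by
      refine DFunLike.ext _ _ fun q => ?_
      have h1 := DFunLike.congr_fun hfix (q.1 + e, q.2)
      refine Eq.trans (Prod.ext ?_ ?_) h1
      · change duhamelHalf _ _ _ _ _ = duhamelHalf _ _ _ _ _
        rw [duhamelHalf_add]
        simp only [hpe, gradSource, hFe]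
        rfl
      · change duhamelHalf _ _ _ _ _ = duhamelHalf _ _ _ _ _
        rw [duhamelHalf_add]
        simp only [hme]
        rfl
    have h2 : w' = w := hΦ.fixedPoint_unique hw'
    have h3 : w (x + e, t) = w (x, t) := DFunLike.congr_fun h2 (x, t)
    exact ⟨congrArg Prod.fst h3, congrArg Prod.snd h3⟩

end MildSolution

/-! ### Parabolic regularity -/

section Regularity

variable {E : Type*} [NormedAddCommGroup E] [InnerProductSpace ℝ E] [FiniteDimensional ℝ E]
  [MeasurableSpace E] [BorelSpace E]
variable {V W : Type*} [NormedAddCommGroup V] [NormedSpace ℝ V]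
  [NormedAddCommGroup W] [NormedSpace ℝ W]

/-- `w` is of class `C^{2,1}` on `E × (0,T)` and continuous up to the boundary, with first and
second space derivatives `G` and `A` and time derivative `wt`. -/
structure IsParabolic (T : ℝ) (w : E → ℝ → ℝ) (G : E → ℝ → E →L[ℝ] ℝ)
    (A : E → ℝ → E →L[ℝ] E →L[ℝ] ℝ) (wt : E → ℝ → ℝ) : Prop where
  continuousOn : ContinuousOn (Function.uncurry w) (univ ×ˢ Icc 0 T)
  hasFDerivAt : ∀ x, ∀ t ∈ Ioo 0 T, HasFDerivAt (fun x => w x t) (G x t) x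
  hasFDerivAt_two : ∀ x, ∀ t ∈ Ioo 0 T, HasFDerivAt (fun x => G x t) (A x t) x
  hasDerivAt : ∀ x, ∀ t ∈ Ioo 0 T, HasDerivAt (w x) (wt x t) t
  continuousOn_fderiv : ContinuousOn (Function.uncurry G) (univ ×ˢ Ioo 0 T)
  continuousOn_fderiv_two : ContinuousOn (Function.uncurry A) (univ ×ˢ Ioo 0 T)
  continuousOn_deriv : ContinuousOn (Function.uncurry wt) (univ ×ˢ Ioo 0 T)

/-- A `C²` function that is bounded together with its first two derivatives `φ'` and `φ''`. -/
structure IsC2Bounded (φ : E → ℝ) (φ' : E → E →L[ℝ] ℝ) (φ'' : E → E →L[ℝ] E →L[ℝ] ℝ) (M : ℝ) :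
    Prop where
  hasFDerivAt : ∀ x, HasFDerivAt φ (φ' x) x
  hasFDerivAt_two : ∀ x, HasFDerivAt φ' (φ'' x) x
  continuous_two : Continuous φ''
  bound : ∀ x, ‖φ x‖ ≤ M
  bound_one : ∀ x, ‖φ' x‖ ≤ M
  bound_two : ∀ x, ‖φ'' x‖ ≤ M

theorem norm_sub_le_of_hasFDerivAt {φ : E → V} {φ' : E → E →L[ℝ] V}
    (h : ∀ x, HasFDerivAt φ (φ' x) x) {M : ℝ} (hM : ∀ x, ‖φ' x‖ ≤ M) (x y : E) :
    ‖φ x - φ y‖ ≤ M * ‖x - y‖ :=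
  convex_univ.norm_image_sub_le_of_norm_hasFDerivWithin_le
    (fun x _ => (h x).hasFDerivWithinAt) (fun x _ => hM x) (mem_univ y) (mem_univ x)

theorem IsC2Bounded.continuous_one {φ : E → ℝ} {φ' : E → E →L[ℝ] ℝ} {φ'' : E → E →L[ℝ] E →L[ℝ] ℝ}
    {M : ℝ} (h : IsC2Bounded φ φ' φ'' M) : Continuous φ' :=
  continuous_iff_continuousAt.2 fun x => (h.hasFDerivAt_two x).continuousAt

theorem IsC2Bounded.continuous {φ : E → ℝ} {φ' : E → E →L[ℝ] ℝ} {φ'' : E → E →L[ℝ] E →L[ℝ] ℝ}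
    {M : ℝ} (h : IsC2Bounded φ φ' φ'' M) : Continuous φ :=
  continuous_iff_continuousAt.2 fun x => (h.hasFDerivAt x).continuousAt

theorem IsC2Bounded.lipschitz {φ : E → ℝ} {φ' : E → E →L[ℝ] ℝ} {φ'' : E → E →L[ℝ] E →L[ℝ] ℝ}
    {M : ℝ} (h : IsC2Bounded φ φ' φ'' M) (x y : E) : ‖φ x - φ y‖ ≤ M * ‖x - y‖ :=
  norm_sub_le_of_hasFDerivAt h.hasFDerivAt h.bound_one x y

theorem IsC2Bounded.lipschitz_one {φ : E → ℝ} {φ' : E → E →L[ℝ] ℝ} {φ'' : E → E →L[ℝ] E →L[ℝ] ℝ}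
    {M : ℝ} (h : IsC2Bounded φ φ' φ'' M) (x y : E) : ‖φ' x - φ' y‖ ≤ M * ‖x - y‖ :=
  norm_sub_le_of_hasFDerivAt h.hasFDerivAt_two h.bound_two x y

/-- The classical regularity theorem for the heat equation with Hölder continuous source. -/
theorem isParabolic_heatSolution {φ : E → ℝ} {φ' : E → E →L[ℝ] ℝ} {φ'' : E → E →L[ℝ] E →L[ℝ] ℝ}
    {M : ℝ} (hφ : IsC2Bounded φ φ' φ'' M) {F : E → ℝ → ℝ} {MF H : ℝ} (hF : IsSource F MF)
    (hH : IsHolder F H) {ι : Type*} [Fintype ι] (b : OrthonormalBasis ι ℝ E) (T : ℝ) :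
    IsParabolic T (heatSolution φ F) (duhamelHalf φ' gradKer F) (duhamelHalfDeriv φ'' gradKer F)
      (fun x t => ∑ i, duhamelHalfDeriv φ'' gradKer F x t (b i) (b i) + F x t) := by
  have hA := continuous_duhamelHalfDeriv hφ.continuous_two hφ.bound_two isGoodKernel_gradKer hF hH
  refine ⟨(continuous_heatSolution hφ.continuous hφ.bound hF).continuousOn,
    fun x t ht => hasFDerivAt_heatSolution hφ.hasFDerivAt hφ.bound hφ.continuous_one hφ.bound_one hF
      x ht.1.le,
    fun x t _ => hasFDerivAt_duhamelHalf hφ.hasFDerivAt_two hφ.bound_one hφ.continuous_two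
      hφ.bound_two isGoodKernel_gradKer hF hH x t,
    fun x t ht => hasDerivAt_heatSolution hφ.hasFDerivAt hφ.hasFDerivAt_two hφ.continuous_two
      hφ.bound hφ.bound_one hφ.bound_two hF hH b x ht.1,
    (continuous_duhamelHalf hφ.continuous_one hφ.bound_one isGoodKernel_gradKer.decay
      hF).continuousOn, hA.continuousOn, Continuous.continuousOn ?_⟩
  have hA' : Continuous fun q : E × ℝ => duhamelHalfDeriv φ'' gradKer F q.1 q.2 := hA
  have hF' : Continuous fun q : E × ℝ => F q.1 q.2 := hF.1
  exact (continuous_finsetSum _ fun i _ => (hA'.clm_apply continuous_const).clm_apply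
    continuous_const).add hF'

/-- A bounded quantity that is Lipschitz at small distances is Hölder of exponent `1/2` at all
distances. -/
theorem le_mul_sqrt_of_lipschitz_of_bounded {L M d r : ℝ} (hL : 0 ≤ L) (hM : 0 ≤ M)
    (h1 : r ≤ 1 → d ≤ L * √r) (h2 : d ≤ M) : d ≤ (L + M) * √r := by
  rcases le_total r 1 with h | h
  · exact (h1 h).trans (by nlinarith [mul_nonneg hM (Real.sqrt_nonneg r)])
  · have := Real.one_le_sqrt.2 h
    nlinarith [mul_nonneg hL (Real.sqrt_nonneg r)]

theorem le_sqrt_of_le_one {r : ℝ} (h0 : 0 ≤ r) (h1 : r ≤ 1) : r ≤ √r :=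
  Real.le_sqrt_of_sq_le (by nlinarith)

/-- The first step of the bootstrap: bounded sources give Hölder continuous unknowns. -/
theorem exists_holder_duhamelHalf {φ : E → V} {M L : ℝ} (hφ : Continuous φ)
    (hM : ∀ x, ‖φ x‖ ≤ M) (hL0 : 0 ≤ L) (hL : ∀ x y, ‖φ x - φ y‖ ≤ L * ‖x - y‖) {K : E → W →L[ℝ] V}
    (hK : IsGoodKernel K) {F : E → ℝ → W} {MF : ℝ} (hF : IsSource F MF) (T : ℝ) :
    ∃ C, 0 ≤ C ∧ ∀ t ∈ Icc 0 T, ∀ x y,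
      ‖duhamelHalf φ K F x t - duhamelHalf φ K F y t‖ ≤ C * √‖x - y‖ := by
  obtain ⟨C, hC0, hC⟩ := norm_duhamel_sub_le hK hF
  have hM0 : 0 ≤ M := (norm_nonneg _).trans (hM 0)
  refine ⟨(L + 2 * M) + C * (1 + |T|), by positivity, fun t ht x y => ?_⟩
  have h1 : ‖heatFlow φ x t - heatFlow φ y t‖ ≤ (L + 2 * M) * √‖x - y‖ := by
    refine le_mul_sqrt_of_lipschitz_of_bounded hL0 (by positivity) (fun h => ?_) ?_
    · refine (norm_heatFlow_sub_le_of_lipschitz hφ hM hL x y t).trans ?_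
      gcongr
      exact le_sqrt_of_le_one (norm_nonneg _) h
    · refine (norm_sub_le _ _).trans ?_
      linarith [norm_heatFlow_le hM x t, norm_heatFlow_le hM y t]
  have h2 : ‖√t • duhamel (1 / 2) K F x t - √t • duhamel (1 / 2) K F y t‖ ≤
      C * (1 + |T|) * √‖x - y‖ := by
    refine (hC t x y).trans ?_
    gcongr
    · exact ht.1
    · exact ht.2
  rw [duhamelHalf, duhamelHalf, add_sub_add_comm, add_mul]
  exact (norm_add_le _ _).trans (add_le_add h1 h2)

theorem norm_clm_le_sum {ι : Type*} [Fintype ι] (b : OrthonormalBasis ι ℝ E) (A : E →L[ℝ] V) :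
    ‖A‖ ≤ ∑ i, ‖A (b i)‖ := by
  refine A.opNorm_le_bound (Finset.sum_nonneg fun i _ => norm_nonneg _) fun v => ?_
  conv_lhs => rw [← b.sum_repr' v, map_sum]
  rw [Finset.sum_mul]
  refine norm_sum_le_of_le _ fun i _ => ?_
  rw [map_smul, norm_smul, mul_comm]
  gcongr
  simpa using norm_inner_le_norm (𝕜 := ℝ) (b i) v

theorem exists_bound_duhamelHalfDeriv [CompleteSpace V] {φ' : E → E →L[ℝ] V}
    {M : ℝ} (hM : ∀ x, ‖φ' x‖ ≤ M) {K : E → W →L[ℝ] V} (hK : IsGoodKernel K) {F : E → ℝ → W}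
    {MF : ℝ} (hF : IsSource F MF) {H : ℝ} (hH : IsHolder F H) (T : ℝ) :
    ∃ C, ∀ t ∈ Icc 0 T, ∀ x, ‖duhamelHalfDeriv φ' K F x t‖ ≤ C := by
  have hb := duhamelBound_of_holder hK hF hH
  have h0 : 0 ≤ (∫ z, ‖derivKernel K z‖ * √‖z‖) * H := mul_nonneg (by positivity) hH.1
  refine ⟨M + 4 * ((∫ z, ‖derivKernel K z‖ * √‖z‖) * H) * (1 + T), fun t ht x => ?_⟩
  refine (norm_add_le _ _).trans (add_le_add (norm_heatFlow_le hM x t)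
    ((norm_duhamel_le hb x t).trans ?_))
  gcongr
  rw [abs_of_nonneg ht.1]
  exact ht.2

/-- The second derivative of a solution with merely continuous `φ''` is Hölder continuous away from
the initial time if the source is differentiable in space. -/
theorem exists_holder_duhamelHalfDeriv [CompleteSpace V] {φ' : E → E →L[ℝ] V}
    {M : ℝ} (hφ' : Continuous φ') (hM : ∀ x, ‖φ' x‖ ≤ M) {K : E → W →L[ℝ] V} (hK : IsGoodKernel K)
    {F : E → ℝ → W} {MF : ℝ} (hF : IsSource F MF) {H : ℝ} (hH : IsHolder F H)
    {F' : E → ℝ → E →L[ℝ] W} {M' : ℝ} (hF' : IsSource F' M')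
    (hd : ∀ x s, HasFDerivAt (fun y => F y s) (F' x s) x) {ε : ℝ} (hε : 0 < ε) (T : ℝ) :
    ∃ C, 0 ≤ C ∧ ∀ t ∈ Icc ε T, ∀ x y,
      ‖duhamelHalfDeriv φ' K F x t - duhamelHalfDeriv φ' K F y t‖ ≤ C * √‖x - y‖ := by
  obtain ⟨C₁, hC₁0, hC₁⟩ := norm_kernelAvg_sub_le (isGoodKernel_heatKer (E := E) (W := E →L[ℝ] V))
  set b := stdOrthonormalBasis ℝ E with hb
  have hbs : ∀ i, IsSource (fun x s => F' x s (b i)) M' := fun i => by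
    have h1 : Continuous fun q : E × ℝ => F' q.1 q.2 := hF'.1
    refine ⟨h1.clm_apply continuous_const, fun x s => ?_⟩
    have := (F' x s).le_of_opNorm_le (hF'.2 x s) (b i)
    rwa [b.norm_eq_one, mul_one] at this
  choose C hC0 hC using fun i => norm_duhamel_sub_le hK (hbs i)
  have hM0 : 0 ≤ M := (norm_nonneg _).trans (hM 0)
  refine ⟨C₁ * M / √√ε + (∑ i, C i) * (1 + |T|), by
    have := Finset.sum_nonneg fun i (_ : i ∈ Finset.univ) => hC0 i
    positivity, fun t ht x y => ?_⟩
  have ht0 : 0 < t := hε.trans_le ht.1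
  have h1 : ‖heatFlow φ' x t - heatFlow φ' y t‖ ≤ C₁ * M / √√ε * √‖x - y‖ := by
    refine (hC₁ φ' M hφ' hM _ (Real.sqrt_pos.2 ht0) x y).trans ?_
    rw [mul_div_assoc', div_mul_eq_mul_div]
    have := Real.sqrt_pos.2 (Real.sqrt_pos.2 hε)
    gcongr
    exact ht.1
  have h2 : ‖duhamel 1 (derivKernel K) F x t - duhamel 1 (derivKernel K) F y t‖ ≤
      (∑ i, C i) * (1 + |T|) * √‖x - y‖ := by
    have hbd := duhamelBound_of_holder hK hF hH
    have e : ∀ x i, duhamel 1 (derivKernel K) F x t (b i) =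
        √t • duhamel (1 / 2) K (fun x s => F' x s (b i)) x t := fun x i => by
      have h := duhamel_derivKernel_apply (a := 1 / 2)
        (C := (∫ z, ‖derivKernel K z‖ * √‖z‖) * H) hK hF
        (by convert hbd using 1; norm_num) hF' hd x (b i) ht0
      rwa [show (1 / 2 + 1 / 2 : ℝ) = 1 by norm_num] at h
    refine (norm_clm_le_sum b _).trans ?_
    rw [Finset.sum_mul, Finset.sum_mul]
    refine Finset.sum_le_sum fun i _ => ?_
    rw [sub_apply, e, e]
    refine (hC i t x y).trans ?_
    have := hC0 i
    gcongr
    exact ht.2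
  rw [duhamelHalfDeriv, duhamelHalfDeriv, add_sub_add_comm, add_mul]
  exact (norm_add_le _ _).trans (add_le_add h1 h2)

/-- The solution of the heat equation at time `t` depends only on the source up to time `t`. -/
theorem heatSolution_congr {φ : E → ℝ} {F G : E → ℝ → ℝ} {t : ℝ} (ht : 0 ≤ t)
    (h : ∀ s ∈ Icc 0 t, ∀ x, F x s = G x s) (x : E) :
    heatSolution φ F x t = heatSolution φ G x t := by
  rw [heatSolution, heatSolution, duhamel, duhamel]
  congr 2
  refine intervalIntegral.integral_congr fun θ hθ => ?_
  rw [uIcc_of_le zero_le_one] at hθ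
  rw [show (fun y => F y (t * (1 - θ))) = fun y => G y (t * (1 - θ)) from funext fun y =>
    h _ ⟨mul_nonneg ht (by linarith [hθ.2]), mul_le_of_le_one_right ht (by linarith [hθ.1])⟩ y]

end Regularity

/-! ### Mild solutions are classical -/

section MildRegularity

variable {E : Type*} [NormedAddCommGroup E] [InnerProductSpace ℝ E] [FiniteDimensional ℝ E]
  [MeasurableSpace E] [BorelSpace E]

theorem IsParabolic.congr {T : ℝ} {w w' : E → ℝ → ℝ} {G G' : E → ℝ → E →L[ℝ] ℝ}
    {A A' : E → ℝ → E →L[ℝ] E →L[ℝ] ℝ} {wt wt' : E → ℝ → ℝ} (h : IsParabolic T w G A wt)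
    (hw : ∀ t ∈ Icc 0 T, ∀ x, w' x t = w x t) (hG : ∀ t ∈ Ioo 0 T, ∀ x, G' x t = G x t)
    (hA : ∀ t ∈ Ioo 0 T, ∀ x, A' x t = A x t) (hwt : ∀ t ∈ Ioo 0 T, ∀ x, wt' x t = wt x t) :
    IsParabolic T w' G' A' wt' := by
  refine ⟨h.continuousOn.congr fun q hq => hw q.2 hq.2 q.1, fun x t ht => ?_, fun x t ht => ?_,
    fun x t ht => ?_, h.continuousOn_fderiv.congr fun q hq => hG q.2 hq.2 q.1,
    h.continuousOn_fderiv_two.congr fun q hq => hA q.2 hq.2 q.1,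
    h.continuousOn_deriv.congr fun q hq => hwt q.2 hq.2 q.1⟩
  · rw [hG t ht]
    exact (h.hasFDerivAt x t ht).congr_of_eventuallyEq
      (Eventually.of_forall fun y => hw t (Ioo_subset_Icc_self ht) y)
  · rw [hA t ht]
    exact (h.hasFDerivAt_two x t ht).congr_of_eventuallyEq (Eventually.of_forall fun y => hG t ht y)
  · rw [hwt t ht]
    refine (h.hasDerivAt x t ht).congr_of_eventuallyEq ?_
    filter_upwards [Icc_mem_nhds ht.1 ht.2] with s hs using hw s hs x

/-- Interior regularity on `(0, T)` follows from regularity on `(0, T')` for all `T' < T`. -/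
theorem isParabolic_of_forall_lt {T : ℝ} {w : E → ℝ → ℝ} {G : E → ℝ → E →L[ℝ] ℝ}
    {A : E → ℝ → E →L[ℝ] E →L[ℝ] ℝ} {wt : E → ℝ → ℝ}
    (hw : ContinuousOn (Function.uncurry w) (univ ×ˢ Icc 0 T))
    (h : ∀ T' ∈ Ioo 0 T, IsParabolic T' w G A wt) : IsParabolic T w G A wt := by
  have hex : ∀ t ∈ Ioo 0 T, ∃ T' ∈ Ioo 0 T, t ∈ Ioo 0 T' := fun t ht =>
    ⟨(t + T) / 2, ⟨by linarith [ht.1, ht.2], by linarith [ht.2]⟩, ht.1, by linarith [ht.2]⟩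
  have hc : ∀ {V : Type _} [TopologicalSpace V] (f : E × ℝ → V),
      (∀ T' ∈ Ioo 0 T, ContinuousOn f (univ ×ˢ Ioo 0 T')) → ContinuousOn f (univ ×ˢ Ioo 0 T) :=
    fun f hf q hq => by
      obtain ⟨T', hT', ht⟩ := hex q.2 hq.2
      exact ((hf T' hT').continuousAt ((isOpen_univ.prod isOpen_Ioo).mem_nhds
        ⟨mem_univ _, ht⟩)).continuousWithinAt
  have hcR : ∀ (f : E × ℝ → ℝ),
      (∀ T' ∈ Ioo 0 T, ContinuousOn f (univ ×ˢ Ioo 0 T')) → ContinuousOn f (univ ×ˢ Ioo 0 T) :=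
    fun f hf q hq => by
      obtain ⟨T', hT', ht⟩ := hex q.2 hq.2
      exact ((hf T' hT').continuousAt ((isOpen_univ.prod isOpen_Ioo).mem_nhds
        ⟨mem_univ _, ht⟩)).continuousWithinAt
  refine ⟨hw, fun x t ht => ?_, fun x t ht => ?_, fun x t ht => ?_,
    hc _ fun T' hT' => (h T' hT').continuousOn_fderiv,
    hc _ fun T' hT' => (h T' hT').continuousOn_fderiv_two,
    hcR _ fun T' hT' => (h T' hT').continuousOn_deriv⟩ <;>
  obtain ⟨T', hT', ht'⟩ := hex t ht
  · exact (h T' hT').hasFDerivAt x t ht'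
  · exact (h T' hT').hasFDerivAt_two x t ht'
  · exact (h T' hT').hasDerivAt x t ht'

/-- Bounds and regularity of the nonlinearities that the existence theory requires. Here `Fn x (P, r)`
is the source of the equation for the value function in reversed time, and `B (P, r)` the flux of the
equation for the density, at gradient `P` and density `r`. -/
structure IsNonlinearity (Fn : E → (E →L[ℝ] ℝ) × ℝ → ℝ) (B : (E →L[ℝ] ℝ) × ℝ → E) (M L : ℝ) :
    Prop where
  nonneg : 0 ≤ L
  contDiff : ContDiff ℝ 1 (Function.uncurry Fn)
  bound : ∀ x w, ‖Fn x w‖ ≤ M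
  lipschitz : ∀ q q', ‖Function.uncurry Fn q - Function.uncurry Fn q'‖ ≤ L * ‖q - q'‖
  contDiff_flux : ContDiff ℝ 1 B
  bound_flux : ∀ w, ‖B w‖ ≤ M
  lipschitz_flux : ∀ w w', ‖B w - B w'‖ ≤ L * ‖w - w'‖
  lipschitz_fderiv_flux : ∀ w w', ‖fderiv ℝ B w - fderiv ℝ B w'‖ ≤ L * ‖w - w'‖

variable {φu φm : E → ℝ} {φu' φm' : E → E →L[ℝ] ℝ} {φu'' φm'' : E → E →L[ℝ] E →L[ℝ] ℝ}
  {Fn : E → (E →L[ℝ] ℝ) × ℝ → ℝ} {M M' L : ℝ}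
  {B : (E →L[ℝ] ℝ) × ℝ → E} {T : ℝ} {p : E → ℝ → E →L[ℝ] ℝ} {m : E → ℝ → ℝ}

theorem Continuous.clmProd {X V₁ V₂ V₃ : Type*} [TopologicalSpace X]
    [NormedAddCommGroup V₁] [NormedSpace ℝ V₁] [NormedAddCommGroup V₂] [NormedSpace ℝ V₂]
    [NormedAddCommGroup V₃] [NormedSpace ℝ V₃] {f : X → V₁ →L[ℝ] V₂} {g : X → V₁ →L[ℝ] V₃}
    (hf : Continuous f) (hg : Continuous g) : Continuous fun x => (f x).prod (g x) :=
  (ContinuousLinearMap.prodₗᵢ (𝕜 := ℝ) (E := V₁) (F := V₂) (G := V₃) ℝ).continuous.comp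
    (hf.prodMk hg)

theorem norm_clmProd_le {V₁ V₂ V₃ : Type*} [NormedAddCommGroup V₁] [NormedSpace ℝ V₁]
    [NormedAddCommGroup V₂] [NormedSpace ℝ V₂] [NormedAddCommGroup V₃] [NormedSpace ℝ V₃]
    {f : V₁ →L[ℝ] V₂} {g : V₁ →L[ℝ] V₃} {C : ℝ} (hf : ‖f‖ ≤ C) (hg : ‖g‖ ≤ C) :
    ‖f.prod g‖ ≤ C := by
  rw [ContinuousLinearMap.opNorm_prod]
  exact max_le hf hg

theorem opNorm_comp_le_of_le {V₁ V₂ V₃ : Type*} [NormedAddCommGroup V₁] [NormedSpace ℝ V₁]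
    [NormedAddCommGroup V₂] [NormedSpace ℝ V₂] [NormedAddCommGroup V₃] [NormedSpace ℝ V₃]
    {f : V₂ →L[ℝ] V₃} {g : V₁ →L[ℝ] V₂} {C D : ℝ} (hf : ‖f‖ ≤ C) (hg : ‖g‖ ≤ D) :
    ‖f.comp g‖ ≤ C * D :=
  (f.opNorm_comp_le g).trans (mul_le_mul hf hg (norm_nonneg _) ((norm_nonneg _).trans hf))

/-- Space derivative of a function given by a half-order Duhamel formula with Hölder continuous
source. -/
theorem exists_isSource_fderiv {V W : Type*} [NormedAddCommGroup V] [NormedSpace ℝ V]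
    [CompleteSpace V] [NormedAddCommGroup W] [NormedSpace ℝ W] {φ : E → V} {φ' : E → E →L[ℝ] V}
    {M₀ M₁ : ℝ}
    (hφ : ∀ x, HasFDerivAt φ (φ' x) x) (hM₀ : ∀ x, ‖φ x‖ ≤ M₀) (hφ' : Continuous φ')
    (hM₁ : ∀ x, ‖φ' x‖ ≤ M₁) {K : E → W →L[ℝ] V} (hK : IsGoodKernel K) {F : E → ℝ → W} {MF H : ℝ}
    (hF : IsSource F MF) (hH : IsHolder F H) (hT : 0 ≤ T) {q : E → ℝ → V}
    (hq : ∀ x t, q x t = duhamelHalf φ K F x (clampTime T t)) :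
    ∃ (Dq : E → ℝ → E →L[ℝ] V) (C : ℝ), IsSource Dq C ∧
      (∀ x t, HasFDerivAt (fun y => q y t) (Dq x t) x) ∧
      ∀ x, ∀ t ∈ Icc 0 T, Dq x t = duhamelHalfDeriv φ' K F x t := by
  obtain ⟨C, hC⟩ := exists_bound_duhamelHalfDeriv hM₁ hK hF hH T
  have h0 : Continuous fun p : E × ℝ => (p.1, clampTime T p.2) :=
    continuous_fst.prodMk ((continuous_clampTime T).comp continuous_snd)
  have h1 : Continuous fun p : E × ℝ => duhamelHalfDeriv φ' K F p.1 (clampTime T p.2) := by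
    have h := (continuous_duhamelHalfDeriv hφ' hM₁ hK hF hH).comp h0
    simpa only [Function.comp_def, Function.uncurry_apply_pair] using h
  have h2 : IsSource (fun x t => duhamelHalfDeriv φ' K F x (clampTime T t)) C :=
    ⟨h1, fun x t => hC _ (clampTime_mem hT t) x⟩
  refine ⟨_, C, h2, fun x t => ?_, fun x t ht => by rw [clampTime_of_mem ht]⟩
  rw [show (fun y => q y t) = fun y => duhamelHalf φ K F y (clampTime T t) from
    funext fun y => hq y t]
  exact hasFDerivAt_duhamelHalf hφ hM₀ hφ' hM₁ hK hF hH x (clampTime T t)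

theorem isHolder_gradSource (hN : IsNonlinearity Fn B M L) (hM : 0 ≤ M) {C : ℝ} (hC : 0 ≤ C)
    (h : ∀ t s x y, ‖(p x t, m x s) - (p y t, m y s)‖ ≤ C * √‖x - y‖) :
    IsHolder (gradSource Fn T p m) (L * (1 + C) + 2 * M) := by
  have hL := hN.nonneg
  refine ⟨by positivity, fun x y s => ?_⟩
  refine le_mul_sqrt_of_lipschitz_of_bounded (by positivity) (by positivity) (fun h1 => ?_) ?_
  · refine (hN.lipschitz (x, (p x s, m x (T - s))) (y, (p y s, m y (T - s)))).trans ?_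
    rw [mul_assoc]
    gcongr
    have h3 := Real.sqrt_nonneg ‖x - y‖
    refine max_le ?_ ((h s (T - s) x y).trans ?_)
    · refine (le_sqrt_of_le_one (norm_nonneg _) h1).trans ?_
      exact le_mul_of_one_le_left h3 (by linarith)
    · gcongr
      linarith
  · refine (norm_sub_le _ _).trans ?_
    have h1 := hN.bound x (p x s, m x (T - s))
    have h2 := hN.bound y (p y s, m y (T - s))
    rw [gradSource, gradSource]
    linarith

theorem isHolder_fluxSource (hN : IsNonlinearity Fn B M L) {C : ℝ} (hC : 0 ≤ C)
    (h : ∀ t s x y, ‖(p x t, m x s) - (p y t, m y s)‖ ≤ C * √‖x - y‖) :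
    IsHolder (fluxSource B T p m) (L * C) := by
  refine ⟨mul_nonneg hN.nonneg hC, fun x y s => (hN.lipschitz_flux _ _).trans ?_⟩
  rw [mul_assoc]
  exact mul_le_mul_of_nonneg_left (h _ _ x y) hN.nonneg

theorem exists_isSource_fderiv_gradSource (hN : IsNonlinearity Fn B M L)
    (hp : IsSource p M') (hm : IsSource m M')
    {Dp : E → ℝ → E →L[ℝ] E →L[ℝ] ℝ} {Dm : E → ℝ → E →L[ℝ] ℝ} {C₁ C₂ : ℝ}
    (hDp : IsSource Dp C₁) (hDm : IsSource Dm C₂)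
    (hpd : ∀ x t, HasFDerivAt (fun y => p y t) (Dp x t) x)
    (hmd : ∀ x t, HasFDerivAt (fun y => m y t) (Dm x t) x) :
    ∃ (DF : E → ℝ → E →L[ℝ] ℝ) (C : ℝ), IsSource DF C ∧
      ∀ x s, HasFDerivAt (fun y => gradSource Fn T p m y s) (DF x s) x := by
  have hL := hN.nonneg
  have hC10 := hDp.nonneg
  have hC20 := hDm.nonneg
  have hDpc : Continuous fun q : E × ℝ => Dp q.1 q.2 := hDp.1
  have hDmc : Continuous fun q : E × ℝ => Dm q.1 q.2 := hDm.1
  have hpc : Continuous fun q : E × ℝ => p q.1 q.2 := hp.1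
  have hmc : Continuous fun q : E × ℝ => m q.1 q.2 := hm.1
  have hrev : Continuous fun q : E × ℝ => (q.1, T - q.2) := by fun_prop
  refine ⟨fun x s => (fderiv ℝ (Function.uncurry Fn) (x, (p x s, m x (T - s)))).comp
      ((ContinuousLinearMap.id ℝ E).prod ((Dp x s).prod (Dm x (T - s)))), L * (1 + C₁ + C₂),
      ⟨?_, fun x s => ?_⟩, fun x s => ?_⟩
  · have h1 : Continuous fun q : E × ℝ => fderiv ℝ (Function.uncurry Fn)
        (q.1, (p q.1 q.2, m q.1 (T - q.2))) :=
      (hN.contDiff.continuous_fderiv (by norm_num)).comp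
        (continuous_fst.prodMk (hpc.prodMk (hmc.comp hrev)))
    have h2 : Continuous fun q : E × ℝ => (ContinuousLinearMap.id ℝ E).prod
        ((Dp q.1 q.2).prod (Dm q.1 (T - q.2))) :=
      continuous_const.clmProd (hDpc.clmProd (hDmc.comp hrev))
    exact h1.clm_comp h2
  · have h1 : ‖fderiv ℝ (Function.uncurry Fn) (x, (p x s, m x (T - s)))‖ ≤ L :=
      norm_fderiv_le_of_lip' ℝ hL (Eventually.of_forall fun q' => hN.lipschitz q' _)
    refine opNorm_comp_le_of_le h1 (norm_clmProd_le
      (ContinuousLinearMap.norm_id_le.trans (by linarith))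
      (norm_clmProd_le ((hDp.2 x s).trans ?_) ((hDm.2 x (T - s)).trans ?_))) <;> linarith
  · exact ((hN.contDiff.differentiable (by norm_num)) _).hasFDerivAt.comp x
      ((hasFDerivAt_id x).prodMk ((hpd x s).prodMk (hmd x (T - s))))

/-- The space derivative of `fluxSource`, in terms of the derivatives of `p` and `m`. -/
def fluxDeriv (B : (E →L[ℝ] ℝ) × ℝ → E) (T : ℝ) (p : E → ℝ → E →L[ℝ] ℝ) (m : E → ℝ → ℝ)
    (Dp : E → ℝ → E →L[ℝ] E →L[ℝ] ℝ) (Dm : E → ℝ → E →L[ℝ] ℝ) (x : E) (t : ℝ) : E →L[ℝ] E :=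
  (fderiv ℝ B (p x (T - t), m x t)).comp ((Dp x (T - t)).prod (Dm x t))

theorem IsNonlinearity.norm_fderiv_flux_le (hN : IsNonlinearity Fn B M L) (w) :
    ‖fderiv ℝ B w‖ ≤ L :=
  norm_fderiv_le_of_lip' ℝ hN.nonneg (Eventually.of_forall fun w' => hN.lipschitz_flux w' w)

theorem hasFDerivAt_fluxSource (hN : IsNonlinearity Fn B M L)
    {Dp : E → ℝ → E →L[ℝ] E →L[ℝ] ℝ} {Dm : E → ℝ → E →L[ℝ] ℝ}
    (hpd : ∀ x t, HasFDerivAt (fun y => p y t) (Dp x t) x)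
    (hmd : ∀ x t, HasFDerivAt (fun y => m y t) (Dm x t) x) (x : E) (t : ℝ) :
    HasFDerivAt (fun y => fluxSource B T p m y t) (fluxDeriv B T p m Dp Dm x t) x :=
  ((hN.contDiff_flux.differentiable (by norm_num)) _).hasFDerivAt.comp x
    ((hpd x (T - t)).prodMk (hmd x t))

theorem isSource_fluxDeriv (hN : IsNonlinearity Fn B M L)
    (hp : IsSource p M') (hm : IsSource m M')
    {Dp : E → ℝ → E →L[ℝ] E →L[ℝ] ℝ} {Dm : E → ℝ → E →L[ℝ] ℝ} {C₁ C₂ : ℝ}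
    (hDp : IsSource Dp C₁) (hDm : IsSource Dm C₂) :
    IsSource (fluxDeriv B T p m Dp Dm) (L * (C₁ + C₂)) := by
  have hC10 := hDp.nonneg
  have hC20 := hDm.nonneg
  have hDpc : Continuous fun q : E × ℝ => Dp q.1 q.2 := hDp.1
  have hDmc : Continuous fun q : E × ℝ => Dm q.1 q.2 := hDm.1
  have hpc : Continuous fun q : E × ℝ => p q.1 q.2 := hp.1
  have hmc : Continuous fun q : E × ℝ => m q.1 q.2 := hm.1
  have hrev : Continuous fun q : E × ℝ => (q.1, T - q.2) := by fun_prop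
  refine ⟨?_, fun x s => ?_⟩
  · have h1 : Continuous fun q : E × ℝ => fderiv ℝ B (p q.1 (T - q.2), m q.1 q.2) :=
      (hN.contDiff_flux.continuous_fderiv (by norm_num)).comp ((hpc.comp hrev).prodMk hmc)
    have h2 : Continuous fun q : E × ℝ => (Dp q.1 (T - q.2)).prod (Dm q.1 q.2) :=
      (hDpc.comp hrev).clmProd hDmc
    exact h1.clm_comp h2
  · refine opNorm_comp_le_of_le (hN.norm_fderiv_flux_le _)
      (norm_clmProd_le ((hDp.2 x (T - s)).trans ?_) ((hDm.2 x s).trans ?_)) <;> linarith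

theorem norm_fluxDeriv_sub_le (hN : IsNonlinearity Fn B M L)
    {Dp : E → ℝ → E →L[ℝ] E →L[ℝ] ℝ} {Dm : E → ℝ → E →L[ℝ] ℝ} {C₁ C₂ C₃ C₄ C₅ d t : ℝ} {x y : E}
    (hC₁ : 0 ≤ C₁) (hC₂ : 0 ≤ C₂) (hC₄ : 0 ≤ C₄) (hC₅ : 0 ≤ C₅) (hd : 0 ≤ d)
    (hDp : ‖Dp x (T - t)‖ ≤ C₁) (hDm : ‖Dm x t‖ ≤ C₂)
    (hpm : ‖(p x (T - t), m x t) - (p y (T - t), m y t)‖ ≤ C₃ * d)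
    (hDp' : ‖Dp x (T - t) - Dp y (T - t)‖ ≤ C₄ * d) (hDm' : ‖Dm x t - Dm y t‖ ≤ C₅ * d) :
    ‖fluxDeriv B T p m Dp Dm x t - fluxDeriv B T p m Dp Dm y t‖ ≤
      (L * C₃ * (C₁ + C₂) + L * (C₄ + C₅)) * d := by
  have hL := hN.nonneg
  have e2 : fluxDeriv B T p m Dp Dm x t - fluxDeriv B T p m Dp Dm y t =
      (fderiv ℝ B (p x (T - t), m x t) - fderiv ℝ B (p y (T - t), m y t)).comp
        ((Dp x (T - t)).prod (Dm x t)) +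
      (fderiv ℝ B (p y (T - t), m y t)).comp
        ((Dp x (T - t) - Dp y (T - t)).prod (Dm x t - Dm y t)) := by
    ext v
    simp only [fluxDeriv, add_apply, sub_apply, ContinuousLinearMap.comp_apply,
      ContinuousLinearMap.prod_apply]
    rw [← Prod.mk_sub_mk, map_sub]
    abel_nf
  rw [e2, add_mul]
  refine (norm_add_le _ _).trans (add_le_add ?_ ?_)
  · have h1 := (hN.lipschitz_fderiv_flux (p x (T - t), m x t) (p y (T - t), m y t)).trans
      (mul_le_mul_of_nonneg_left hpm hL)
    refine (opNorm_comp_le_of_le h1 (norm_clmProd_le (C := C₁ + C₂) (hDp.trans ?_)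
      (hDm.trans ?_))).trans_eq (by ring) <;> linarith
  · refine (opNorm_comp_le_of_le (hN.norm_fderiv_flux_le _) (norm_clmProd_le
      (C := (C₄ + C₅) * d) (hDp'.trans ?_) (hDm'.trans ?_))).trans_eq (by ring) <;>
    gcongr <;> linarith

/-- The trace of `A` in the orthonormal basis `b`. -/
def basisTrace {ι : Type*} [Fintype ι] (b : OrthonormalBasis ι ℝ E) (A : E →L[ℝ] E) : ℝ :=
  ∑ i, inner ℝ (b i) (A (b i))

theorem basisTrace_sub {ι : Type*} [Fintype ι] (b : OrthonormalBasis ι ℝ E) (A A' : E →L[ℝ] E) :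
    basisTrace b (A - A') = basisTrace b A - basisTrace b A' := by
  simp only [basisTrace, ← Finset.sum_sub_distrib, sub_apply, inner_sub_right]

theorem norm_basisTrace_le {ι : Type*} [Fintype ι] (b : OrthonormalBasis ι ℝ E) (A : E →L[ℝ] E) :
    ‖basisTrace b A‖ ≤ Fintype.card ι * ‖A‖ := by
  refine (norm_sum_le_of_le (f := fun i => inner ℝ (b i) (A (b i))) Finset.univ
    (n := fun _ => ‖A‖) fun i _ => ?_).trans_eq (by
      rw [Finset.sum_const, Finset.card_univ, nsmul_eq_mul])
  refine (norm_inner_le_norm _ _).trans ?_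
  have := A.le_opNorm (b i)
  rw [b.norm_eq_one, mul_one] at this
  rwa [b.norm_eq_one, one_mul]

theorem isSource_basisTrace {ι : Type*} [Fintype ι] (b : OrthonormalBasis ι ℝ E)
    {DB : E → ℝ → E →L[ℝ] E} {C : ℝ} (h : IsSource DB C) :
    IsSource (fun x t => basisTrace b (DB x t)) (Fintype.card ι * C) := by
  refine ⟨?_, fun x t => (norm_basisTrace_le b _).trans (by gcongr; exact h.2 x t)⟩
  have h1 : Continuous fun q : E × ℝ => DB q.1 q.2 := h.1
  exact continuous_finsetSum _ fun i _ => continuous_const.inner (h1.clm_apply continuous_const)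

/-- Once the flux is differentiable, the density is given by the Duhamel formula with source `div B`. -/
theorem eq_heatSolution_of_duhamelHalf_divKer {ι : Type*} [Fintype ι]
    (b : OrthonormalBasis ι ℝ E) {Bs : E → ℝ → E} {DB : E → ℝ → E →L[ℝ] E} {C C' : ℝ}
    (hB : IsSource Bs C) (hDB : IsSource DB C')
    (hd : ∀ x t, HasFDerivAt (fun y => Bs y t) (DB x t) x) {t : ℝ} (ht : 0 ≤ t) (x : E) :
    duhamelHalf φm divKer Bs x t = heatSolution φm (fun x t => basisTrace b (DB x t)) x t := by
  rw [duhamelHalf, heatSolution]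
  congr 1
  rcases ht.eq_or_lt with rfl | h0
  · simp
  · rw [duhamel_divKer b hB hDB hd x h0, smul_smul, Real.mul_self_sqrt ht, smul_eq_mul]
    rfl

/-- A solution of the heat equation whose source is Hölder continuous up to every time before the
terminal time is classical. -/
theorem isParabolic_of_eq_heatSolution (hm : IsC2Bounded φm φm' φm'' M) {g : E → ℝ → ℝ} {C : ℝ}
    (hg : IsSource g C) (hgH : ∀ T' ∈ Ioo 0 T, ∃ H, 0 ≤ H ∧ ∀ t ∈ Icc 0 T', ∀ x y,
      ‖g x t - g y t‖ ≤ H * √‖x - y‖) (hmc : Continuous (Function.uncurry m))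
    (hmg : ∀ t ∈ Icc 0 T, ∀ x, m x t = heatSolution φm g x t) {Dm : E → ℝ → E →L[ℝ] ℝ}
    (hmd : ∀ x t, HasFDerivAt (fun y => m y t) (Dm x t) x)
    {ι : Type*} [Fintype ι] (b : OrthonormalBasis ι ℝ E) :
    IsParabolic T m Dm (fun x t => fderiv ℝ (fun y => Dm y t) x)
      (fun x t => ∑ i, fderiv ℝ (fun y => Dm y t) x (b i) (b i) + g x t) := by
  refine isParabolic_of_forall_lt hmc.continuousOn fun T' hT' => ?_
  obtain ⟨H, hH0, hH⟩ := hgH T' hT'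
  obtain ⟨g', hg'⟩ : ∃ g' : E → ℝ → ℝ, ∀ x t, g' x t = g x (clampTime T' t) := ⟨_, fun _ _ => rfl⟩
  have hg'S : IsSource g' C := by
    obtain rfl : g' = fun x t => g x (clampTime T' t) := funext₂ hg'
    exact ⟨hg.1.comp (continuous_fst.prodMk ((continuous_clampTime T').comp continuous_snd)),
      fun x t => hg.2 _ _⟩
  have hg'H : IsHolder g' H :=
    ⟨hH0, fun x y t => by rw [hg', hg']; exact hH _ (clampTime_mem hT'.1.le t) x y⟩
  have hgg' : ∀ t ∈ Icc 0 T', ∀ x, m x t = heatSolution φm g' x t := fun t ht x => by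
    rw [hmg t ⟨ht.1, ht.2.trans hT'.2.le⟩]
    refine heatSolution_congr ht.1 (fun s hs y => ?_) x
    rw [hg', clampTime_of_mem (⟨hs.1, hs.2.trans ht.2⟩ : s ∈ Icc 0 T')]
  have hpar := isParabolic_heatSolution hm hg'S hg'H b T'
  have hDm' : ∀ t ∈ Ioo 0 T', ∀ x, Dm x t = duhamelHalf φm' gradKer g' x t := fun t ht x =>
    (hmd x t).unique ((hpar.hasFDerivAt x t ht).congr_of_eventuallyEq
      (Eventually.of_forall fun y => hgg' t (Ioo_subset_Icc_self ht) y))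
  have hD2 : ∀ t ∈ Ioo 0 T', ∀ x, fderiv ℝ (fun y => Dm y t) x =
      duhamelHalfDeriv φm'' gradKer g' x t := fun t ht x =>
    ((hpar.hasFDerivAt_two x t ht).congr_of_eventuallyEq
      (Eventually.of_forall fun y => hDm' t ht y)).fderiv
  refine hpar.congr hgg' hDm' hD2 fun t ht x => ?_
  simp only [hD2 t ht, hg', clampTime_of_mem (Ioo_subset_Icc_self ht)]

/-- Mild solutions are classical. Regularity is gained step by step: the unknowns are Hölder
continuous in space, hence so are the sources; therefore the unknowns, and with them the sources,
are differentiable in space. The density then solves the heat equation with source `div B`, which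
is again Hölder continuous in space, away from the terminal time. -/
theorem IsMildSolution.exists_isParabolic (hN : IsNonlinearity Fn B M L)
    (hu : IsC2Bounded φu φu' φu'' M) (hm : IsC2Bounded φm φm' φm'' M) (hT : 0 < T)
    (hp : IsSource p M') (hms : IsSource m M') (h : IsMildSolution φu' φm Fn B T p m)
    {ι : Type*} [Fintype ι] (b : OrthonormalBasis ι ℝ E) :
    ∃ (Dp : E → ℝ → E →L[ℝ] E →L[ℝ] ℝ) (Dm : E → ℝ → E →L[ℝ] ℝ)
      (D2m : E → ℝ → E →L[ℝ] E →L[ℝ] ℝ),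
      IsParabolic T (heatSolution φu (gradSource Fn T p m)) p Dp
        (fun x t => ∑ i, Dp x t (b i) (b i) + gradSource Fn T p m x t) ∧
      IsParabolic T m Dm D2m (fun x t => ∑ i, D2m x t (b i) (b i) +
        basisTrace b (fderiv ℝ (fun y => fluxSource B T p m y t) x)) := by
  have hM0 : 0 ≤ M := (norm_nonneg _).trans (hu.bound 0)
  have hF : IsSource (gradSource Fn T p m) M :=
    isSource_gradSource hN.contDiff.continuous hN.bound T hp.1 hms.1
  have hB : IsSource (fluxSource B T p m) M :=
    isSource_fluxSource hN.contDiff_flux.continuous hN.bound_flux T hp.1 hms.1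
  obtain ⟨Cp, hCp0, hCp⟩ := exists_holder_duhamelHalf hu.continuous_one hu.bound_one hM0
    hu.lipschitz_one isGoodKernel_gradKer hF T
  obtain ⟨Cm, hCm0, hCm⟩ := exists_holder_duhamelHalf hm.continuous hm.bound hM0
    hm.lipschitz isGoodKernel_divKer hB T
  have hpair : ∀ t s x y, ‖(p x t, m x s) - (p y t, m y s)‖ ≤ (Cp + Cm) * √‖x - y‖ :=
    fun t s x y => by
      have h1 := Real.sqrt_nonneg ‖x - y‖
      have hpH := hCp _ (clampTime_mem hT.le t) x y
      have hmH := hCm _ (clampTime_mem hT.le s) x y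
      rw [← h.grad, ← h.grad] at hpH
      rw [← h.density, ← h.density] at hmH
      refine max_le (hpH.trans ?_) (hmH.trans ?_) <;> gcongr <;> linarith
  have hFH := isHolder_gradSource (T := T) hN hM0 (add_nonneg hCp0 hCm0) hpair
  have hBH := isHolder_fluxSource (T := T) hN (add_nonneg hCp0 hCm0) hpair
  obtain ⟨Dp, C1, hDps, hpD, hDp⟩ := exists_isSource_fderiv hu.hasFDerivAt_two hu.bound_one
    hu.continuous_two hu.bound_two isGoodKernel_gradKer hF hFH hT.le h.grad
  obtain ⟨Dm, C2, hDms, hmD, -⟩ := exists_isSource_fderiv hm.hasFDerivAt hm.bound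
    hm.continuous_one hm.bound_one isGoodKernel_divKer hB hBH hT.le h.density
  obtain ⟨DF, CF, hDFs, hFd⟩ := exists_isSource_fderiv_gradSource (T := T) hN hp hms hDps hDms
    hpD hmD
  have hDBs := isSource_fluxDeriv (T := T) hN hp hms hDps hDms
  have hBd := hasFDerivAt_fluxSource (T := T) hN hpD hmD
  have hgS := isSource_basisTrace b hDBs
  have hmg : ∀ t ∈ Icc 0 T, ∀ x, m x t =
      heatSolution φm (fun x t => basisTrace b (fluxDeriv B T p m Dp Dm x t)) x t :=
    fun t ht x => by
      rw [h.density, clampTime_of_mem ht]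
      exact eq_heatSolution_of_duhamelHalf_divKer b hB hDBs hBd ht.1 x
  have hDmg : ∀ t ∈ Icc 0 T, ∀ x, Dm x t = duhamelHalf φm' gradKer
      (fun x t => basisTrace b (fluxDeriv B T p m Dp Dm x t)) x t := fun t ht x =>
    (hmD x t).unique ((hasFDerivAt_heatSolution hm.hasFDerivAt hm.bound hm.continuous_one
      hm.bound_one hgS x ht.1).congr_of_eventuallyEq (Eventually.of_forall fun y => hmg t ht y))
  obtain ⟨C3, hC30, hC3⟩ := exists_holder_duhamelHalf hm.continuous_one hm.bound_one hM0
    hm.lipschitz_one isGoodKernel_gradKer hgS T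
  refine ⟨Dp, Dm, fun x t => fderiv ℝ (fun y => Dm y t) x, ?_, ?_⟩
  · refine (isParabolic_heatSolution hu hF hFH b T).congr (fun _ _ _ => rfl) (fun t ht x => ?_)
      (fun t ht x => hDp x t (Ioo_subset_Icc_self ht)) (fun t ht x => ?_)
    · rw [h.grad, clampTime_of_mem (Ioo_subset_Icc_self ht)]
    · simp only [hDp x t (Ioo_subset_Icc_self ht)]
  · refine (isParabolic_of_eq_heatSolution hm hgS (fun T' hT' => ?_) hms.1 hmg hmD b).congr
      (fun _ _ _ => rfl) (fun _ _ _ => rfl) (fun _ _ _ => rfl) fun t ht x => ?_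
    · -- the terminal time is excluded because `φu''` is merely continuous
      obtain ⟨C4, hC40, hC4⟩ := exists_holder_duhamelHalfDeriv hu.continuous_two hu.bound_two
        isGoodKernel_gradKer hF hFH hDFs hFd (sub_pos.2 hT'.2) T
      have hL := hN.nonneg
      have hC10 := hDps.nonneg
      have hC20 := hDms.nonneg
      refine ⟨Fintype.card ι * (L * (Cp + Cm) * (C1 + C2) + L * (C4 + C3)), by positivity,
        fun t ht x y => ?_⟩
      have hr : T - t ∈ Icc (T - T') T := ⟨by linarith [ht.2], by linarith [ht.1]⟩
      have hr0 : T - t ∈ Icc 0 T := ⟨by linarith [hr.1, hT'.2], hr.2⟩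
      have ht0 : t ∈ Icc 0 T := ⟨ht.1, ht.2.trans hT'.2.le⟩
      rw [← basisTrace_sub, mul_assoc]
      refine (norm_basisTrace_le b _).trans (mul_le_mul_of_nonneg_left ?_ (Nat.cast_nonneg _))
      refine norm_fluxDeriv_sub_le hN hC10 hC20 hC40 hC30
        (Real.sqrt_nonneg _) (hDps.2 _ _) (hDms.2 _ _) (hpair _ _ _ _) ?_ ?_
      · rw [hDp x _ hr0, hDp y _ hr0]
        exact hC4 _ hr x y
      · rw [hDmg t ht0, hDmg t ht0]
        exact hC3 t ht0 x y
    · rw [(hBd x t).fderiv]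

end MildRegularity

/-! ### Functions on the torus and classical functions -/

section Torus

variable {N : ℕ} {β : Type*}

/-- The integer part of a vector, taken in each coordinate. -/
def floorVec (x : EuclideanSpace ℝ (Fin N)) : EuclideanSpace ℝ (Fin N) :=
  ∑ i, ⌊x i⌋ • EuclideanSpace.single i (1 : ℝ)

theorem floorVec_apply (x : EuclideanSpace ℝ (Fin N)) (j : Fin N) : floorVec x j = ⌊x j⌋ := by
  simp only [floorVec, WithLp.ofLp_sum, Finset.sum_apply, ← Int.cast_smul_eq_zsmul ℝ,
    WithLp.ofLp_smul, Pi.smul_apply, PiLp.single_apply, smul_eq_mul, mul_ite, mul_one, mul_zero]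
  simp

theorem IsTorusFun.sub_floorVec {φ : EuclideanSpace ℝ (Fin N) → β} (h : IsTorusFun φ)
    (x : EuclideanSpace ℝ (Fin N)) : φ (x - floorVec x) = φ x := by
  have key : ∀ (s : Finset (Fin N)) (y : EuclideanSpace ℝ (Fin N)),
      φ (y - ∑ i ∈ s, ⌊x i⌋ • EuclideanSpace.single i (1 : ℝ)) = φ y := by
    intro s
    induction s using Finset.induction_on with
    | empty => simp
    | insert i s hi ih =>
      intro y
      rw [Finset.sum_insert hi, add_comm, ← sub_sub, (h i).sub_zsmul_eq, ih]
  exact key Finset.univ x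

theorem sub_floorVec_mem (x : EuclideanSpace ℝ (Fin N)) (i : Fin N) :
    (x - floorVec x) i ∈ Ico (0 : ℝ) 1 := by
  rw [PiLp.sub_apply, floorVec_apply]
  exact ⟨sub_nonneg.2 (Int.floor_le _), by linarith [Int.lt_floor_add_one (x i)]⟩

/-- The closed unit cube. -/
def closedCube (N : ℕ) : Set (EuclideanSpace ℝ (Fin N)) := {x | ∀ i, x i ∈ Icc (0 : ℝ) 1}

theorem isCompact_closedCube : IsCompact (closedCube N) := by
  have h := (isCompact_univ_pi fun _ : Fin N => isCompact_Icc (a := (0 : ℝ)) (b := 1)).image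
    (PiLp.continuous_toLp 2 fun _ : Fin N => ℝ)
  convert h using 1
  ext x
  constructor
  · intro hx
    exact ⟨WithLp.ofLp x, fun i _ => hx i, rfl⟩
  · rintro ⟨y, hy, rfl⟩ i
    exact hy i (mem_univ i)

theorem convex_closedCube : Convex ℝ (closedCube N) := by
  intro x hx y hy a b ha hb hab i
  exact convex_Icc (0 : ℝ) 1 (hx i) (hy i) ha hb hab

theorem sub_floorVec_mem_closedCube (x : EuclideanSpace ℝ (Fin N)) :
    x - floorVec x ∈ closedCube N := fun i => Ico_subset_Icc_self (sub_floorVec_mem x i)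

theorem IsTorusFun.fderiv {V : Type*} [NormedAddCommGroup V] [NormedSpace ℝ V]
    {φ : EuclideanSpace ℝ (Fin N) → V} (h : IsTorusFun φ) : IsTorusFun (fderiv ℝ φ) := fun i x => by
  rw [← fderiv_comp_add_right]
  congr 1
  exact funext (h i)

/-- A continuous function on the torus times a compact interval is bounded. -/
theorem exists_bound_of_isTorusFun_prod {V : Type*} [NormedAddCommGroup V]
    {g : EuclideanSpace ℝ (Fin N) × ℝ → V} {c d : ℝ}
    (hg : ContinuousOn g (univ ×ˢ Icc c d)) (hper : ∀ r ∈ Icc c d, IsTorusFun fun x => g (x, r)) :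
    ∃ C, 0 ≤ C ∧ ∀ x, ∀ r ∈ Icc c d, ‖g (x, r)‖ ≤ C := by
  obtain ⟨C, hC⟩ := (isCompact_closedCube.prod isCompact_Icc).exists_bound_of_continuousOn
    (hg.mono (prod_mono_left (subset_univ _)))
  refine ⟨max C 0, le_max_right _ _, fun x r hr => ?_⟩
  rw [← (hper r hr).sub_floorVec]
  exact (hC (_, r) ⟨sub_floorVec_mem_closedCube x, hr⟩).trans (le_max_left _ _)

theorem IsTorusFun.exists_bound {V : Type*} [NormedAddCommGroup V]
    {φ : EuclideanSpace ℝ (Fin N) → V} (h : IsTorusFun φ) (hc : Continuous φ) :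
    ∃ C, 0 ≤ C ∧ ∀ x, ‖φ x‖ ≤ C := by
  obtain ⟨C, hC, hC'⟩ := exists_bound_of_isTorusFun_prod (c := 0) (d := 0)
    (g := fun q : EuclideanSpace ℝ (Fin N) × ℝ => φ q.1) (hc.comp continuous_fst).continuousOn
    (fun _ _ => h)
  exact ⟨C, hC, fun x => hC' x 0 (left_mem_Icc.2 le_rfl)⟩

theorem IsTorusFun.exists_pos_le {φ : EuclideanSpace ℝ (Fin N) → ℝ} (h : IsTorusFun φ)
    (hc : Continuous φ) (hpos : ∀ x, 0 < φ x) : ∃ δ, 0 < δ ∧ ∀ x, δ ≤ φ x := by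
  obtain ⟨x₀, -, hx₀⟩ := isCompact_closedCube.exists_isMinOn
    ⟨0 - floorVec 0, sub_floorVec_mem_closedCube (N := N) 0⟩ hc.continuousOn
  refine ⟨φ x₀, hpos x₀, fun x => ?_⟩
  rw [← h.sub_floorVec x]
  exact hx₀ (sub_floorVec_mem_closedCube x)

theorem IsTorusFun.exists_isC2Bounded {φ : EuclideanSpace ℝ (Fin N) → ℝ} (h : IsTorusFun φ)
    (hc : ContDiff ℝ 2 φ) :
    ∃ M, IsC2Bounded φ (_root_.fderiv ℝ φ) (_root_.fderiv ℝ (_root_.fderiv ℝ φ)) M := by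
  have h1 : ContDiff ℝ 1 (_root_.fderiv ℝ φ) := hc.fderiv_right (by norm_num)
  have h2 : Continuous (_root_.fderiv ℝ (_root_.fderiv ℝ φ)) := h1.continuous_fderiv (by norm_num)
  obtain ⟨C0, hC00, hC0⟩ := h.exists_bound hc.continuous
  obtain ⟨C1, hC10, hC1⟩ := h.fderiv.exists_bound h1.continuous
  obtain ⟨C2, hC20, hC2⟩ := h.fderiv.fderiv.exists_bound h2
  exact ⟨C0 + C1 + C2, fun x => (hc.differentiable (by norm_num) x).hasFDerivAt,
    fun x => (h1.differentiable (by norm_num) x).hasFDerivAt, h2,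
    fun x => (hC0 x).trans (by linarith), fun x => (hC1 x).trans (by linarith),
    fun x => (hC2 x).trans (by linarith)⟩

end Torus

section Classical

variable {N : ℕ} {T : ℝ} {w : EuclideanSpace ℝ (Fin N) → ℝ → ℝ}
  {G : EuclideanSpace ℝ (Fin N) → ℝ → EuclideanSpace ℝ (Fin N) →L[ℝ] ℝ}
  {A : EuclideanSpace ℝ (Fin N) → ℝ →
    EuclideanSpace ℝ (Fin N) →L[ℝ] EuclideanSpace ℝ (Fin N) →L[ℝ] ℝ}
  {wt : EuclideanSpace ℝ (Fin N) → ℝ → ℝ}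

/-- The second iterated derivative is the image of the second derivative, as a bilinear map, under a
fixed isometry; so the two are continuous at the same time. -/
theorem exists_isometry_iteratedFDeriv_two (E : Type*) [NormedAddCommGroup E] [NormedSpace ℝ E] :
    ∃ Φ : (E →L[ℝ] E →L[ℝ] ℝ) ≃ₗᵢ[ℝ] (E [×2]→L[ℝ] ℝ), ∀ (φ : E → ℝ) (x : E),
      iteratedFDeriv ℝ 2 φ x = Φ (fderiv ℝ (fderiv ℝ φ) x) :=
  ⟨(continuousMultilinearCurryFin0 ℝ E (E →L[ℝ] E →L[ℝ] ℝ)).symm.trans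
    ((continuousMultilinearCurryRightEquiv' ℝ 0 E (E →L[ℝ] ℝ)).symm.trans
      (continuousMultilinearCurryRightEquiv' ℝ 1 E ℝ).symm), fun φ x => by
    rw [iteratedFDeriv_succ_eq_comp_right, Function.comp_apply, iteratedFDeriv_succ_eq_comp_right,
      Function.comp_apply, iteratedFDeriv_zero_eq_comp]
    rfl⟩

theorem laplacian_eq_sum {φ : EuclideanSpace ℝ (Fin N) → ℝ} {ι : Type*} [Fintype ι]
    (b : OrthonormalBasis ι ℝ (EuclideanSpace ℝ (Fin N))) (x : EuclideanSpace ℝ (Fin N)) :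
    Laplacian.laplacian φ x = ∑ i, fderiv ℝ (fderiv ℝ φ) x (b i) (b i) := by
  rw [InnerProductSpace.laplacian_eq_iteratedFDeriv_orthonormalBasis φ b]
  simp [iteratedFDeriv_two_apply]

theorem IsParabolic.fderiv_eq (h : IsParabolic T w G A wt) {t : ℝ} (ht : t ∈ Ioo 0 T) :
    fderiv ℝ (fun y => w y t) = fun y => G y t := funext fun x => (h.hasFDerivAt x t ht).fderiv

theorem IsParabolic.fderiv_fderiv_eq (h : IsParabolic T w G A wt) {t : ℝ} (ht : t ∈ Ioo 0 T)
    (x : EuclideanSpace ℝ (Fin N)) : fderiv ℝ (fderiv ℝ (fun y => w y t)) x = A x t := by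
  rw [h.fderiv_eq ht]
  exact (h.hasFDerivAt_two x t ht).fderiv

theorem continuous_slice {X V : Type*} [TopologicalSpace X] [TopologicalSpace V] {F : X → ℝ → V}
    {s : Set ℝ} (h : ContinuousOn (Function.uncurry F) (univ ×ˢ s)) {t : ℝ} (ht : t ∈ s) :
    Continuous fun x => F x t := by
  rw [← continuousOn_univ]
  exact h.comp (f := fun x : X => (x, t)) (by fun_prop) fun x _ => ⟨mem_univ _, ht⟩

theorem IsParabolic.isClassicalFun (h : IsParabolic T w G A wt)
    (hper : ∀ t ∈ Icc 0 T, IsTorusFun (fun x => w x t)) : IsClassicalFun T w := by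
  obtain ⟨Φ, hΦ⟩ := exists_isometry_iteratedFDeriv_two (EuclideanSpace ℝ (Fin N))
  refine ⟨hper, h.continuousOn, fun t ht => ?_, fun x t ht => (h.hasDerivAt x t ht).differentiableAt,
    h.continuousOn_deriv.congr fun q hq => (h.hasDerivAt q.1 q.2 hq.2).deriv,
    h.continuousOn_fderiv.congr fun q hq => (h.hasFDerivAt q.1 q.2 hq.2).fderiv,
    (Φ.continuous.comp_continuousOn h.continuousOn_fderiv_two).congr fun q hq => ?_⟩
  · refine (contDiff_succ_iff_hasFDerivAt (n := 1)).2 ⟨fun x => G x t, ?_,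
      fun x => h.hasFDerivAt x t ht⟩
    exact contDiff_one_iff_hasFDerivAt.2 ⟨fun x => A x t,
      continuous_slice h.continuousOn_fderiv_two ht, fun x => h.hasFDerivAt_two x t ht⟩
  · rw [hΦ, h.fderiv_fderiv_eq hq.2]
    rfl

theorem IsClassicalFun.isParabolic (h : IsClassicalFun T w) :
    IsParabolic T w (fun x t => fderiv ℝ (fun y => w y t) x)
      (fun x t => fderiv ℝ (fderiv ℝ fun y => w y t) x) (fun x t => deriv (w x) t) := by
  obtain ⟨Φ, hΦ⟩ := exists_isometry_iteratedFDeriv_two (EuclideanSpace ℝ (Fin N))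
  refine ⟨h.continuous_closed, fun x t ht =>
    ((h.contDiff_space t ht).differentiable (by norm_num) x).hasFDerivAt, fun x t ht =>
    (((h.contDiff_space t ht).fderiv_right (m := 1) (by norm_num)).differentiable
      (by norm_num) x).hasFDerivAt, fun x t ht => (h.differentiable_time x t ht).hasDerivAt,
    h.continuous_deriv_space, ?_, h.continuous_deriv_time⟩
  refine (Φ.symm.continuous.comp_continuousOn h.continuous_deriv_space_two).congr fun q hq => ?_
  rw [Function.comp_apply, hΦ, Φ.symm_apply_apply]
  rfl

/-- Time reversal. -/
theorem IsParabolic.comp_sub (h : IsParabolic T w G A wt) :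
    IsParabolic T (fun x t => w x (T - t)) (fun x t => G x (T - t)) (fun x t => A x (T - t))
      (fun x t => - wt x (T - t)) := by
  have hm : ∀ t ∈ Ioo 0 T, T - t ∈ Ioo 0 T := fun t ht =>
    ⟨by linarith [ht.2], by linarith [ht.1]⟩
  have hc : Continuous fun q : EuclideanSpace ℝ (Fin N) × ℝ => (q.1, T - q.2) := by fun_prop
  have hm' : MapsTo (fun q : EuclideanSpace ℝ (Fin N) × ℝ => (q.1, T - q.2)) (univ ×ˢ Ioo 0 T)
      (univ ×ˢ Ioo 0 T) := fun q hq => ⟨mem_univ _, hm _ hq.2⟩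
  refine ⟨h.continuousOn.comp hc.continuousOn fun q hq => ⟨mem_univ _, ?_⟩,
    fun x t ht => h.hasFDerivAt x _ (hm t ht), fun x t ht => h.hasFDerivAt_two x _ (hm t ht),
    fun x t ht => ?_, h.continuousOn_fderiv.comp hc.continuousOn hm',
    h.continuousOn_fderiv_two.comp hc.continuousOn hm',
    (h.continuousOn_deriv.comp hc.continuousOn hm').neg⟩
  · exact ⟨by linarith [hq.2.2], by linarith [hq.2.1]⟩
  · have h1 : HasDerivAt (fun t => T - t) (-1) t := by
      simpa using (hasDerivAt_id t).const_sub T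
    have h2 := (h.hasDerivAt x _ (hm t ht)).scomp t h1
    rw [neg_one_smul] at h2
    exact h2

end Classical

/-! ### Truncation of the nonlinearities -/

section Truncation

variable {N : ℕ}

theorem exists_cutoff_Icc {c d ε : ℝ} (hε : 0 < ε) (hcd : c ≤ d) :
    ∃ χ : ℝ → ℝ, ContDiff ℝ 3 χ ∧ (∀ r ∈ Icc c d, χ r = 1) ∧
      ∀ r, r ∉ Ioo (c - ε) (d + ε) → χ r = 0 := by
  let b : ContDiffBump ((c + d) / 2) :=
    ⟨(d - c) / 2 + ε / 2, (d - c) / 2 + ε, by linarith, by linarith⟩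
  refine ⟨b, b.contDiff, fun r hr => b.one_of_mem_closedBall ?_, fun r hr => ?_⟩
  · rw [mem_closedBall_iff_norm, Real.norm_eq_abs, abs_le]
    change -((d - c) / 2 + ε / 2) ≤ _ ∧ _ ≤ (d - c) / 2 + ε / 2
    constructor <;> linarith [hr.1, hr.2]
  · refine b.zero_of_le_dist ?_
    change (d - c) / 2 + ε ≤ _
    rw [Real.dist_eq, le_abs]
    rw [mem_Ioo, not_and_or, not_lt, not_lt] at hr
    rcases hr with hr | hr
    · right; linarith
    · left; linarith

/-- A cutoff of the Hamiltonian that agrees with it near the ball of radius `R`, and hence has the same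
gradient there. -/
theorem exists_truncation {E : Type*} [NormedAddCommGroup E] [InnerProductSpace ℝ E]
    [FiniteDimensional ℝ E] {H : E → ℝ} (hH : ContDiff ℝ 3 H) (R : ℝ) :
    ∃ K : E → ℝ, ContDiff ℝ 3 K ∧ HasCompactSupport K ∧ ∀ v, ‖v‖ ≤ R → K =ᶠ[𝓝 v] H := by
  let b : ContDiffBump (0 : E) :=
    ⟨|R| + 1, |R| + 2, by positivity, by linarith⟩
  refine ⟨fun v => b v * H v, b.contDiff.mul hH, b.hasCompactSupport.mul_right, fun v hv => ?_⟩
  have : v ∈ Metric.ball (0 : E) b.rIn := by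
    rw [mem_ball_zero_iff]
    change _ < |R| + 1
    linarith [le_abs_self R]
  filter_upwards [b.eventuallyEq_one_of_mem_ball this] with y hy
  rw [hy, Pi.one_apply, one_mul]

/-- A cutoff of the coupling in the density. As it vanishes for `r ≤ δ / 2`, it extends smoothly to
negative densities, where `f` carries no information. -/
theorem exists_truncated_coupling {f : EuclideanSpace ℝ (Fin N) → ℝ → ℝ}
    (hf_per : ∀ r ∈ Ici (0 : ℝ), IsTorusFun (fun x => f x r))
    (hf : ContDiffOn ℝ 3 (fun p : EuclideanSpace ℝ (Fin N) × ℝ => f p.1 p.2)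
      (univ ×ˢ Ici (0 : ℝ))) {δ M : ℝ} (hδ : 0 < δ) (hM : δ ≤ M) :
    ∃ (g : EuclideanSpace ℝ (Fin N) → ℝ → ℝ) (C : ℝ), ContDiff ℝ 1 (Function.uncurry g) ∧
      (∀ r, IsTorusFun fun x => g x r) ∧ (∀ x, ∀ r ∈ Icc δ M, g x r = f x r) ∧ 0 ≤ C ∧
      (∀ x r, ‖g x r‖ ≤ C) ∧
      ∀ q q', ‖Function.uncurry g q - Function.uncurry g q'‖ ≤ C * ‖q - q'‖ := by
  obtain ⟨χ, hχ, h1, h0⟩ := exists_cutoff_Icc (half_pos hδ) hM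
  obtain ⟨g, hg⟩ : ∃ g : EuclideanSpace ℝ (Fin N) → ℝ → ℝ, ∀ x r, g x r = χ r * f x r :=
    ⟨_, fun _ _ => rfl⟩
  set c := δ - δ / 2 with hc
  set d := M + δ / 2 with hd
  have hc0 : 0 < c := by rw [hc]; linarith
  have hz : ∀ x r, r ∉ Icc c d → g x r = 0 := fun x r hr => by
    rw [hg, h0 r fun h => hr (Ioo_subset_Icc_self h), zero_mul]
  have hev : ∀ q : EuclideanSpace ℝ (Fin N) × ℝ, q.2 ∉ Icc c d →
      Function.uncurry g =ᶠ[𝓝 q] fun _ => 0 := fun q hq => by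
    filter_upwards [(isClosed_Icc.isOpen_compl.preimage continuous_snd).mem_nhds
      (show q ∈ Prod.snd ⁻¹' (Icc c d)ᶜ from hq)] with q' hq'
    exact hz _ _ hq'
  have hgc : ContDiff ℝ 1 (Function.uncurry g) := by
    refine contDiff_iff_contDiffAt.2 fun q => ?_
    by_cases hq : 0 < q.2
    · have h2 : ContDiffAt ℝ 1 (fun p : EuclideanSpace ℝ (Fin N) × ℝ => χ p.2 * f p.1 p.2) q :=
        ((hχ.of_le (by norm_num)).comp contDiff_snd).contDiffAt.mul
          ((hf.contDiffAt (prod_mem_nhds univ_mem (Ici_mem_nhds hq))).of_le (by norm_num))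
      exact h2.congr_of_eventuallyEq (Eventually.of_forall fun p => hg p.1 p.2)
    · refine contDiffAt_const.congr_of_eventuallyEq (hev q fun h => hq (hc0.trans_le h.1))
  have hper : ∀ r, IsTorusFun fun x => g x r := fun r i x => by
    by_cases hr : 0 ≤ r
    · simp only [hg]
      exact congrArg (χ r * ·) (hf_per r hr i x)
    · have : r ∉ Icc c d := fun h => hr (hc0.le.trans h.1)
      simp only [hz _ r this]
  have hper' : ∀ r, IsTorusFun fun x => fderiv ℝ (Function.uncurry g) (x, r) := fun r i x => by
    have h3 := fderiv_comp_add_right (𝕜 := ℝ) (f := Function.uncurry g) (x := (x, r))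
      ((EuclideanSpace.single i (1 : ℝ), (0 : ℝ)))
    rw [Prod.mk_add_mk, add_zero] at h3
    simp only
    rw [← h3]
    congr 1
    funext q
    obtain ⟨y, s⟩ := q
    rw [Prod.mk_add_mk, add_zero]
    exact hper s i y
  obtain ⟨C, hC0, hC⟩ := exists_bound_of_isTorusFun_prod (c := c) (d := d)
    hgc.continuous.continuousOn fun r _ => hper r
  obtain ⟨D, hD0, hD⟩ := exists_bound_of_isTorusFun_prod (c := c) (d := d)
    (hgc.continuous_fderiv (by norm_num)).continuousOn fun r _ => hper' r
  refine ⟨g, C + D, hgc, hper, fun x r hr => by rw [hg, h1 r hr, one_mul], by positivity,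
    fun x r => ?_, fun q q' => ?_⟩
  · by_cases hr : r ∈ Icc c d
    · exact (hC x r hr).trans (by linarith)
    · rw [hz x r hr, norm_zero]; positivity
  · refine convex_univ.norm_image_sub_le_of_norm_fderiv_le (𝕜 := ℝ) (fun q _ =>
      (hgc.differentiable (by norm_num)) q) (fun q _ => ?_) (mem_univ _) (mem_univ _)
    by_cases hr : q.2 ∈ Icc c d
    · exact (hD q.1 q.2 hr).trans (by linarith)
    · rw [(hev q hr).fderiv_eq, fderiv_fun_const, Pi.zero_apply, norm_zero]; positivity

theorem IsNonlinearity.mono {E : Type*} [NormedAddCommGroup E] [InnerProductSpace ℝ E]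
    [FiniteDimensional ℝ E] {Fn : E → (E →L[ℝ] ℝ) × ℝ → ℝ}
    {B : (E →L[ℝ] ℝ) × ℝ → E} {M M' L : ℝ} (h : IsNonlinearity Fn B M L) (hM : M ≤ M') :
    IsNonlinearity Fn B M' L :=
  ⟨h.nonneg, h.contDiff, fun x w => (h.bound x w).trans hM, h.lipschitz, h.contDiff_flux,
    fun w => (h.bound_flux w).trans hM, h.lipschitz_flux, h.lipschitz_fderiv_flux⟩

/-- The Riesz isomorphism from linear forms to vectors. -/
def sharp (E : Type*) [NormedAddCommGroup E] [InnerProductSpace ℝ E] [CompleteSpace E] :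
    (E →L[ℝ] ℝ) ≃ₗᵢ[ℝ] E := (InnerProductSpace.toDual ℝ E).symm

theorem gradient_eq_sharp {E : Type*} [NormedAddCommGroup E] [InnerProductSpace ℝ E]
    [CompleteSpace E] (φ : E → ℝ) (x : E) : gradient φ x = sharp E (fderiv ℝ φ x) := rfl

theorem exists_lipschitz_of_hasCompactSupport {E V : Type*} [NormedAddCommGroup E]
    [NormedSpace ℝ E] [NormedAddCommGroup V] [NormedSpace ℝ V] {g : E → V} (hg : ContDiff ℝ 1 g)
    (hs : HasCompactSupport g) : ∃ C, 0 ≤ C ∧ (∀ x, ‖g x‖ ≤ C) ∧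
      ∀ x y, ‖g x - g y‖ ≤ C * ‖x - y‖ := by
  obtain ⟨C, hC⟩ := hg.continuous.bounded_above_of_compact_support hs
  obtain ⟨D, hD⟩ := hg.lipschitzWith_of_hasCompactSupport hs (by norm_num)
  have hC0 := (norm_nonneg _).trans (hC 0)
  refine ⟨C + D, by positivity, fun x => (hC x).trans (by linarith [D.2]), fun x y => ?_⟩
  refine (hD.norm_sub_le x y).trans ?_
  gcongr
  linarith

/-- The nonlinearities of the system can be modified, for large values of the gradient and for
values of the density that are large or close to zero, so as to become bounded and Lipschitz. -/
theorem exists_isNonlinearity {f : EuclideanSpace ℝ (Fin N) → ℝ → ℝ}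
    {H : EuclideanSpace ℝ (Fin N) → ℝ} (hf_per : ∀ r ∈ Ici (0 : ℝ), IsTorusFun (fun x => f x r))
    (hf : ContDiffOn ℝ 3 (fun p : EuclideanSpace ℝ (Fin N) × ℝ => f p.1 p.2)
      (univ ×ˢ Ici (0 : ℝ))) (hH : ContDiff ℝ 3 H) {δ M : ℝ} (hδ : 0 < δ) (hM : δ ≤ M) (R : ℝ) :
    ∃ (Fn : EuclideanSpace ℝ (Fin N) → (EuclideanSpace ℝ (Fin N) →L[ℝ] ℝ) × ℝ → ℝ)
      (B : (EuclideanSpace ℝ (Fin N) →L[ℝ] ℝ) × ℝ → EuclideanSpace ℝ (Fin N)) (C : ℝ),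
      IsNonlinearity Fn B C C ∧ (∀ w, IsTorusFun fun x => Fn x w) ∧
      ∀ (P : EuclideanSpace ℝ (Fin N) →L[ℝ] ℝ) (r : ℝ), ‖P‖ ≤ R → r ∈ Icc δ M →
        (∀ x, Fn x (P, r) = -(H (sharp _ P) + f x r)) ∧
          B (P, r) = r • gradient H (sharp _ P) := by
  obtain ⟨g, Cg, hg, hgper, hgf, hCg0, hCg, hCg'⟩ := exists_truncated_coupling hf_per hf hδ hM
  obtain ⟨K, hK, hKs, hKH⟩ := exists_truncation hH R
  obtain ⟨χ, hχ, h1, h0⟩ := exists_cutoff_Icc one_pos hM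
  obtain ⟨CK, hCK0, hCK, hCK'⟩ := exists_lipschitz_of_hasCompactSupport (hK.of_le (by norm_num)) hKs
  obtain ⟨B, hB⟩ : ∃ B : (EuclideanSpace ℝ (Fin N) →L[ℝ] ℝ) × ℝ → EuclideanSpace ℝ (Fin N),
      ∀ w, B w = (χ w.2 * w.2) • sharp _ (fderiv ℝ K (sharp _ w.1)) := ⟨_, fun _ => rfl⟩
  have hBc : ContDiff ℝ 2 B := by
    have hK' : ContDiff ℝ 2 (fderiv ℝ K) := hK.fderiv_right (by norm_num)
    have h2 : ContDiff ℝ 2 fun w : (EuclideanSpace ℝ (Fin N) →L[ℝ] ℝ) × ℝ =>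
        (χ w.2 * w.2) • sharp _ (fderiv ℝ K (sharp _ w.1)) :=
      (((hχ.of_le (by norm_num)).comp contDiff_snd).mul contDiff_snd).smul
        ((sharp _).contDiff.comp (hK'.comp ((sharp _).contDiff.comp contDiff_fst)))
    exact (funext hB : B = _) ▸ h2
  have hBs : HasCompactSupport B := by
    have hcp : IsCompact ((sharp (EuclideanSpace ℝ (Fin N))) ⁻¹' (tsupport K)) :=
      (sharp (EuclideanSpace ℝ (Fin N))).toHomeomorph.isCompact_preimage.2 hKs
    refine HasCompactSupport.intro (hcp.prod (isCompact_Icc (a := δ - 1) (b := M + 1)))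
      fun w hw => ?_
    rw [hB]
    rw [mem_prod, not_and_or] at hw
    rcases hw with hw | hw
    · rw [fderiv_of_notMem_tsupport (𝕜 := ℝ) hw, map_zero, smul_zero]
    · rw [h0 _ fun h => hw (Ioo_subset_Icc_self h), zero_mul, zero_smul]
  obtain ⟨CB, hCB0, hCB, hCB'⟩ := exists_lipschitz_of_hasCompactSupport (hBc.of_le (by norm_num)) hBs
  obtain ⟨CD, hCD0, -, hCD⟩ := exists_lipschitz_of_hasCompactSupport
    (hBc.fderiv_right (m := 1) (by norm_num)) (hBs.fderiv ℝ)
  refine ⟨fun x w => -(K (sharp _ w.1) + g x w.2), B, Cg + CK + CB + CD, ?_, fun w i x => ?_,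
    fun P r hP hr => ⟨fun x => ?_, ?_⟩⟩
  · refine ⟨by positivity, ?_, fun x w => ?_, fun q q' => ?_, hBc.of_le (by norm_num),
      fun w => (hCB w).trans (by linarith), fun w w' => (hCB' w w').trans (by gcongr; linarith),
      fun w w' => (hCD w w').trans (by gcongr; linarith)⟩
    · exact (((hK.of_le (by norm_num)).comp ((sharp _).contDiff.comp
        (contDiff_fst.comp contDiff_snd))).add (hg.comp (contDiff_fst.prodMk
          (contDiff_snd.comp contDiff_snd)))).neg
    · rw [norm_neg]
      refine (norm_add_le _ _).trans ?_
      linarith [hCK (sharp _ w.1), hCg x w.2]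
    · obtain ⟨x, P, r⟩ := q
      obtain ⟨x', P', r'⟩ := q'
      have e1 := hCK' (sharp _ P) (sharp _ P')
      rw [← map_sub, LinearIsometryEquiv.norm_map] at e1
      have e2 := hCg' (x, r) (x', r')
      have n1 : ‖P - P'‖ ≤ ‖(x, P, r) - (x', P', r')‖ :=
        (norm_fst_le (P - P', r - r')).trans (norm_snd_le (x - x', P - P', r - r'))
      have n2 : ‖(x, r) - (x', r')‖ ≤ ‖(x, P, r) - (x', P', r')‖ :=
        max_le (norm_fst_le (x - x', P - P', r - r'))
          ((norm_snd_le (P - P', r - r')).trans (norm_snd_le (x - x', P - P', r - r')))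
      have e3 : Function.uncurry (fun x (w : (EuclideanSpace ℝ (Fin N) →L[ℝ] ℝ) × ℝ) =>
            -(K (sharp _ w.1) + g x w.2)) (x, P, r) -
          Function.uncurry (fun x (w : (EuclideanSpace ℝ (Fin N) →L[ℝ] ℝ) × ℝ) =>
            -(K (sharp _ w.1) + g x w.2)) (x', P', r') =
          -((K (sharp _ P) - K (sharp _ P')) + (g x r - g x' r')) := by
        simp only [Function.uncurry_apply_pair]; ring
      rw [e3, norm_neg]
      refine (norm_add_le _ _).trans ?_
      have n3 := e1.trans (mul_le_mul_of_nonneg_left n1 hCK0)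
      have n4 := e2.trans (mul_le_mul_of_nonneg_left n2 hCg0)
      have n5 := norm_nonneg ((x, P, r) - (x', P', r'))
      simp only [Function.uncurry_apply_pair] at n4
      nlinarith [mul_nonneg hCB0 n5, mul_nonneg hCD0 n5]
  · exact congrArg (fun s => -(K (sharp _ w.1) + s)) (hgper w.2 i x)
  · simp only
    rw [hgf x r hr, (hKH _ (by rwa [LinearIsometryEquiv.norm_map])).eq_of_nhds]
  · rw [hB, h1 r hr, one_mul, gradient_eq_sharp,
      (hKH (sharp _ P) (by rwa [LinearIsometryEquiv.norm_map])).fderiv_eq]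

end Truncation

/-! ### Existence of classical solutions -/

section Existence

section General

variable {E : Type*} [NormedAddCommGroup E] [InnerProductSpace ℝ E] [FiniteDimensional ℝ E]
  [MeasurableSpace E] [BorelSpace E]
variable {V W : Type*} [NormedAddCommGroup V] [NormedSpace ℝ V]
  [NormedAddCommGroup W] [NormedSpace ℝ W]

theorem heatSolution_add (φ : E → ℝ) (F : E → ℝ → ℝ) (x e : E) (t : ℝ) :
    heatSolution φ F (x + e) t =
      heatSolution (fun y => φ (y + e)) (fun y s => F (y + e) s) x t := by
  simp only [heatSolution, heatFlow, duhamel, kernelAvg_add]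

/-- The deviation from the initial data is of order `√t`, uniformly in the source. -/
theorem exists_norm_duhamelHalf_sub_le [CompleteSpace V] {φ : E → V} {M L : ℝ} (hφ : Continuous φ)
    (hM : ∀ x, ‖φ x‖ ≤ M) (hL0 : 0 ≤ L) (hL : ∀ x y, ‖φ x - φ y‖ ≤ L * ‖x - y‖)
    {K : E → W →L[ℝ] V} (hK : GaussianDecay K) {MF : ℝ} (hMF : 0 ≤ MF) :
    ∃ C, 0 ≤ C ∧ ∀ (F : E → ℝ → W), IsSource F MF → ∀ x t, t ≤ 1 →
      ‖duhamelHalf φ K F x t - φ x‖ ≤ C * √t := by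
  obtain ⟨C, hC0, hC⟩ := norm_heatFlow_sub_self_le (E := E) (W := V)
  refine ⟨C * L + 8 * (∫ z, ‖K z‖) * MF, by positivity, fun F hF x t ht => ?_⟩
  rw [duhamelHalf, add_sub_right_comm, add_mul]
  exact (norm_add_le _ _).trans (add_le_add (hC φ M L hφ hM hL x t)
    (norm_duhamel_half_le hK hF x ht))

theorem exists_norm_heatSolution_sub_le {φ : E → ℝ} {M L : ℝ} (hφ : Continuous φ)
    (hM : ∀ x, ‖φ x‖ ≤ M) (hL0 : 0 ≤ L) (hL : ∀ x y, ‖φ x - φ y‖ ≤ L * ‖x - y‖)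
    {MF : ℝ} (hMF : 0 ≤ MF) :
    ∃ C, 0 ≤ C ∧ ∀ (F : E → ℝ → ℝ), IsSource F MF → ∀ x, ∀ t ∈ Icc (0 : ℝ) 1,
      ‖heatSolution φ F x t - φ x‖ ≤ C * √t := by
  obtain ⟨C, hC0, hC⟩ := norm_heatFlow_sub_self_le (E := E) (W := ℝ)
  refine ⟨C * L + 4 * ((∫ z : E, ‖heatKer ℝ z‖) * MF) * 2, by positivity, fun F hF x t ht => ?_⟩
  rw [heatSolution, add_sub_right_comm, add_mul]
  refine (norm_add_le _ _).trans (add_le_add (hC φ M L hφ hM hL x t) ?_)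
  have h1 := norm_duhamel_le (duhamelBound_zero isGoodKernel_heatKer.decay hF) x t
  rw [norm_mul, Real.norm_eq_abs, abs_of_nonneg ht.1, mul_comm]
  have h2 : t ≤ √t := le_sqrt_of_le_one ht.1 ht.2
  refine mul_le_mul (h1.trans ?_) h2 ht.1 (by positivity)
  rw [abs_of_nonneg ht.1]
  gcongr
  linarith [ht.2]

theorem IsC2Bounded.mono {φ : E → ℝ} {φ' : E → E →L[ℝ] ℝ} {φ'' : E → E →L[ℝ] E →L[ℝ] ℝ} {M M' : ℝ}
    (h : IsC2Bounded φ φ' φ'' M) (hM : M ≤ M') : IsC2Bounded φ φ' φ'' M' :=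
  ⟨h.hasFDerivAt, h.hasFDerivAt_two, h.continuous_two, fun x => (h.bound x).trans hM,
    fun x => (h.bound_one x).trans hM, fun x => (h.bound_two x).trans hM⟩

end General

variable {N : ℕ}

theorem divergence_eq_basisTrace (V : EuclideanSpace ℝ (Fin N) → EuclideanSpace ℝ (Fin N))
    (x : EuclideanSpace ℝ (Fin N)) :
    divergence V x = basisTrace (EuclideanSpace.basisFun (Fin N) ℝ) (fderiv ℝ V x) := by
  simp only [divergence, basisTrace, EuclideanSpace.basisFun_apply, EuclideanSpace.inner_single_left,
    map_one, one_mul]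

/-- A mild solution for truncated nonlinearities is a classical solution of the system if its values
lie in the range where the truncated nonlinearities agree with the given ones. The value function is
recovered by the Duhamel formula; its gradient is then the unknown `p`. -/
theorem isClassicalMFGSolution_of_isMildSolution {f : EuclideanSpace ℝ (Fin N) → ℝ → ℝ}
    {H m₀ uT : EuclideanSpace ℝ (Fin N) → ℝ}
    {φu' φm' : EuclideanSpace ℝ (Fin N) → EuclideanSpace ℝ (Fin N) →L[ℝ] ℝ}
    {φu'' φm'' : EuclideanSpace ℝ (Fin N) →
      EuclideanSpace ℝ (Fin N) →L[ℝ] EuclideanSpace ℝ (Fin N) →L[ℝ] ℝ}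
    {Fn : EuclideanSpace ℝ (Fin N) → (EuclideanSpace ℝ (Fin N) →L[ℝ] ℝ) × ℝ → ℝ}
    {B : (EuclideanSpace ℝ (Fin N) →L[ℝ] ℝ) × ℝ → EuclideanSpace ℝ (Fin N)} {M L M' T R δ D : ℝ}
    {p : EuclideanSpace ℝ (Fin N) → ℝ → EuclideanSpace ℝ (Fin N) →L[ℝ] ℝ}
    {m : EuclideanSpace ℝ (Fin N) → ℝ → ℝ}
    (hN : IsNonlinearity Fn B M L) (hu : IsC2Bounded uT φu' φu'' M)
    (hm : IsC2Bounded m₀ φm' φm'' M) (hT : 0 < T)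
    (hp : IsSource p M') (hms : IsSource m M') (h : IsMildSolution φu' m₀ Fn B T p m)
    (hFB : ∀ (P : EuclideanSpace ℝ (Fin N) →L[ℝ] ℝ) (r : ℝ), ‖P‖ ≤ R → r ∈ Icc δ D →
        (∀ x, Fn x (P, r) = -(H (sharp _ P) + f x r)) ∧
          B (P, r) = r • gradient H (sharp _ P))
    (hFper : ∀ w, IsTorusFun fun x => Fn x w) (huper : IsTorusFun uT)
    (hpper : ∀ t, IsTorusFun fun x => p x t) (hmper : ∀ t, IsTorusFun fun x => m x t)
    (hpR : ∀ x, ∀ t ∈ Icc 0 T, ‖p x t‖ ≤ R) (hmD : ∀ x, ∀ t ∈ Icc 0 T, m x t ∈ Icc δ D)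
    (hδ : 0 ≤ δ) :
    IsClassicalMFGSolution f H m₀ uT T
      (fun x t => heatSolution uT (gradSource Fn T p m) x (T - t)) m ∧
    ∀ t ∈ Ioo 0 T, ∀ x, fderiv ℝ (fun y => heatSolution uT (gradSource Fn T p m) y (T - t)) x =
      p x (T - t) := by
  obtain ⟨Dp, Dm, D2m, h1, h2⟩ := h.exists_isParabolic hN hu hm hT hp hms
    (EuclideanSpace.basisFun (Fin N) ℝ)
  have h3 := h1.comp_sub
  have hr : ∀ t ∈ Icc 0 T, T - t ∈ Icc 0 T := fun t ht => ⟨by linarith [ht.2], by linarith [ht.1]⟩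
  have hIoo : ∀ t ∈ Ioo 0 T, t ∈ Icc 0 T := fun t ht => Ioo_subset_Icc_self ht
  have hper : ∀ t ∈ Icc 0 T,
      IsTorusFun fun x => heatSolution uT (gradSource Fn T p m) x (T - t) := fun t _ i x => by
    simp only [heatSolution_add]
    congr 1
    · exact funext fun y => huper i y
    · funext y s
      simp only [gradSource]
      have e1 : p (y + EuclideanSpace.single i 1) s = p y s := hpper s i y
      have e2 : m (y + EuclideanSpace.single i 1) (T - s) = m y (T - s) := hmper _ i y
      rw [e1, e2]
      exact hFper _ i y
  refine ⟨⟨h3.isClassicalFun hper, h2.isClassicalFun fun t _ => hmper t,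
    fun x t ht => hδ.trans (hmD x t ht).1, fun x t ht => ?_, fun x t ht => ?_, fun x => ?_,
    fun x => ?_⟩, fun t ht x => (h3.hasFDerivAt x t ht).fderiv⟩
  · rw [(h3.hasDerivAt x t ht).deriv, laplacian_eq_sum (EuclideanSpace.basisFun (Fin N) ℝ),
      gradient_eq_sharp, (h3.hasFDerivAt x t ht).fderiv, h3.fderiv_fderiv_eq ht, gradSource,
      sub_sub_cancel, (hFB _ _ (hpR x _ (hr t (hIoo t ht))) (hmD x t (hIoo t ht))).1 x]
    ring
  · have e : (fun y => m y t • gradient H (gradient (fun z => heatSolution uT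
        (gradSource Fn T p m) z (T - t)) y)) = fun y => fluxSource B T p m y t := by
      funext y
      rw [gradient_eq_sharp (fun z => heatSolution uT (gradSource Fn T p m) z (T - t)),
        (h3.hasFDerivAt y t ht).fderiv, fluxSource,
        (hFB _ _ (hpR y _ (hr t (hIoo t ht))) (hmD y t (hIoo t ht))).2]
    rw [e, divergence_eq_basisTrace, (h2.hasDerivAt x t ht).deriv,
      laplacian_eq_sum (EuclideanSpace.basisFun (Fin N) ℝ), h2.fderiv_fderiv_eq ht]
    ring
  · rw [h.density, clampTime_of_mem (left_mem_Icc.2 hT.le), duhamelHalf,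
      heatFlow_of_nonpos _ _ le_rfl]
    simp
  · simp only [sub_self]
    rw [heatSolution, heatFlow_of_nonpos _ _ le_rfl]
    simp

/-- For small horizons there is a classical solution close to the data. -/
theorem exists_isClassicalMFGSolution {f : EuclideanSpace ℝ (Fin N) → ℝ → ℝ}
    {H m₀ uT : EuclideanSpace ℝ (Fin N) → ℝ}
    (hf_per : ∀ r ∈ Ici (0 : ℝ), IsTorusFun (fun x => f x r))
    (hf : ContDiffOn ℝ 3 (fun p : EuclideanSpace ℝ (Fin N) × ℝ => f p.1 p.2)
      (univ ×ˢ Ici (0 : ℝ)))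
    (hH : ContDiff ℝ 3 H)
    (hm₀_per : IsTorusFun m₀) (hm₀ : ContDiff ℝ 2 m₀) (hm₀_pos : ∀ x, 0 < m₀ x)
    (huT_per : IsTorusFun uT) (huT : ContDiff ℝ 2 uT) {a : ℝ} (ha : 0 < a) :
    ∃ T₀ : ℝ, 0 < T₀ ∧ ∀ T ∈ Ioc 0 T₀, ∃ u m : EuclideanSpace ℝ (Fin N) → ℝ → ℝ,
      IsClassicalMFGSolution f H m₀ uT T u m ∧ IsCloseToData m₀ uT T a u m := by
  obtain ⟨δ, hδ, hδm⟩ := hm₀_per.exists_pos_le hm₀.continuous hm₀_pos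
  obtain ⟨Mu, hMu⟩ := huT_per.exists_isC2Bounded huT
  obtain ⟨Mm, hMm⟩ := hm₀_per.exists_isC2Bounded hm₀
  have hδM : δ ≤ max Mu Mm :=
    (hδm 0).trans (((le_abs_self _).trans (hMm.bound 0)).trans (le_max_right _ _))
  obtain ⟨Fn, B, C, hN, hFper, hFB⟩ := exists_isNonlinearity hf_per hf hH (half_pos hδ)
    (by linarith : δ / 2 ≤ max Mu Mm + a) (max Mu Mm + a)
  set M := max (max Mu Mm) C with hM
  have hM0 : 0 ≤ M := (hδ.le.trans hδM).trans (le_max_left _ _)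
  have hu := hMu.mono ((le_max_left Mu Mm).trans (le_max_left _ C))
  have hm := hMm.mono ((le_max_right Mu Mm).trans (le_max_left _ C))
  have hN' := hN.mono (le_max_right (max Mu Mm) C)
  rw [← hM] at hu hm hN'
  obtain ⟨C₁, hC₁0, hC₁⟩ := exists_norm_heatSolution_sub_le hu.continuous hu.bound hM0 hu.lipschitz
    hM0
  obtain ⟨C₂, hC₂0, hC₂⟩ := exists_norm_duhamelHalf_sub_le hu.continuous_one hu.bound_one hM0
    hu.lipschitz_one (isGoodKernel_gradKer (E := EuclideanSpace ℝ (Fin N))).decay hM0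
  obtain ⟨C₃, hC₃0, hC₃⟩ := exists_norm_duhamelHalf_sub_le hm.continuous hm.bound hM0
    hm.lipschitz (isGoodKernel_divKer (E := EuclideanSpace ℝ (Fin N))).decay hM0
  obtain ⟨T₀, hT₀, hT₀'⟩ := exists_isMildSolution hN.nonneg hN'.contDiff.continuous hN'.bound
    (fun x w w' => by
      have := hN.lipschitz (x, w) (x, w')
      rwa [Prod.mk_sub_mk, sub_self, Prod.norm_mk, norm_zero, max_eq_right (norm_nonneg _)] at this)
    hN'.contDiff_flux.continuous hN'.bound_flux hN'.lipschitz_flux hu.continuous_one hu.bound_one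
    hm.continuous hm.bound
  -- a deviation of at most `δ / 2` keeps the density above `δ / 2`, where nothing was truncated
  have ha' : 0 < min a (δ / 2) := lt_min ha (half_pos hδ)
  have hCC : 0 < C₁ + C₂ + C₃ + 1 := by positivity
  refine ⟨min T₀ (min 1 ((min a (δ / 2) / (C₁ + C₂ + C₃ + 1)) ^ 2)), by positivity,
    fun T hT => ?_⟩
  have hT1 : T ≤ 1 := hT.2.trans ((min_le_right _ _).trans (min_le_left _ _))
  have hTs : ∀ t ≤ T, (C₁ + C₂ + C₃ + 1) * √t ≤ min a (δ / 2) := fun t ht => by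
    rw [mul_comm, ← le_div_iff₀ hCC]
    refine Real.sqrt_le_left (by positivity) |>.2 ?_
    exact ht.trans (hT.2.trans ((min_le_right _ _).trans (min_le_right _ _)))
  have hsm : ∀ {c t : ℝ}, t ≤ T → c ≤ C₁ + C₂ + C₃ + 1 → c * √t ≤ min a (δ / 2) :=
    fun {c t} ht hc => (mul_le_mul_of_nonneg_right hc (Real.sqrt_nonneg t)).trans (hTs t ht)
  obtain ⟨p, m, M', hp, hms, hmild, hper⟩ := hT₀' T ⟨hT.1, hT.2.trans (min_le_left _ _)⟩
  have hper' : ∀ i x t, p (x + EuclideanSpace.single i 1) t = p x t ∧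
      m (x + EuclideanSpace.single i 1) t = m x t := fun i =>
    hper _ (fun x => huT_per.fderiv i x) (fun x => hm₀_per i x) (fun x w => hFper w i x)
  have hF : IsSource (gradSource Fn T p m) M :=
    isSource_gradSource hN'.contDiff.continuous hN'.bound T hp.1 hms.1
  have hB : IsSource (fluxSource B T p m) M :=
    isSource_fluxSource hN'.contDiff_flux.continuous hN'.bound_flux T hp.1 hms.1
  have hpc : ∀ x, ∀ t ∈ Icc 0 T, ‖p x t - fderiv ℝ uT x‖ ≤ min a (δ / 2) := fun x t ht => by
    rw [hmild.grad, clampTime_of_mem ht]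
    exact (hC₂ _ hF x t (ht.2.trans hT1)).trans (hsm ht.2 (by linarith))
  have hmc : ∀ x, ∀ t ∈ Icc 0 T, ‖m x t - m₀ x‖ ≤ min a (δ / 2) := fun x t ht => by
    rw [hmild.density, clampTime_of_mem ht]
    exact (hC₃ _ hB x t (ht.2.trans hT1)).trans (hsm ht.2 (by linarith))
  have huc : ∀ x, ∀ t ∈ Icc 0 T, ‖heatSolution uT (gradSource Fn T p m) x t - uT x‖ ≤
      min a (δ / 2) := fun x t ht =>
    (hC₁ _ hF x t ⟨ht.1, ht.2.trans hT1⟩).trans (hsm ht.2 (by linarith))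
  have hpR : ∀ x, ∀ t ∈ Icc 0 T, ‖p x t‖ ≤ max Mu Mm + a := fun x t ht => by
    have e1 := norm_le_norm_add_norm_sub' (p x t) (fderiv ℝ uT x)
    have e2 := (hpc x t ht).trans (min_le_left _ _)
    have e3 := (hMu.bound_one x).trans (le_max_left Mu Mm)
    linarith
  have hmD : ∀ x, ∀ t ∈ Icc 0 T, m x t ∈ Icc (δ / 2) (max Mu Mm + a) := fun x t ht => by
    have e1 := abs_le.1 (hmc x t ht)
    have e2 := hδm x
    have e3 := ((le_abs_self _).trans (hMm.bound x)).trans (le_max_right Mu Mm)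
    constructor <;> linarith [e1.1, e1.2, min_le_left a (δ / 2), min_le_right a (δ / 2)]
  obtain ⟨hsol, hgrad⟩ := isClassicalMFGSolution_of_isMildSolution hN' hu hm hT.1 hp hms hmild hFB
    hFper huT_per (fun t i x => (hper' i x t).1) (fun t i x => (hper' i x t).2) hpR hmD
    (half_pos hδ).le
  refine ⟨_, m, hsol, fun x t ht => ?_⟩
  have ht' : T - t ∈ Icc 0 T := ⟨by linarith [ht.2], by linarith [ht.1]⟩
  refine ⟨(huc x _ ht').trans (min_le_left _ _), ?_,
    (hmc x t (Ioo_subset_Icc_self ht)).trans (min_le_left _ _)⟩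
  rw [gradient_eq_sharp, gradient_eq_sharp, ← map_sub, LinearIsometryEquiv.norm_map, hgrad t ht]
  exact (hpc x _ ht').trans (min_le_left _ _)

end Existence

/-! ### Integration over the torus -/

section TorusIntegral

open scoped Pointwise

variable {N : ℕ}

theorem unitCube_eq_fundamentalDomain :
    unitCube N = ZSpan.fundamentalDomain (EuclideanSpace.basisFun (Fin N) ℝ).toBasis := by
  ext x
  simp [unitCube, ZSpan.mem_fundamentalDomain]

theorem isAddFundamentalDomain_unitCube :
    IsAddFundamentalDomain
      (Submodule.span ℤ (range (EuclideanSpace.basisFun (Fin N) ℝ).toBasis)).toAddSubgroup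
      (unitCube N) volume :=
  unitCube_eq_fundamentalDomain (N := N) ▸ ZSpan.isAddFundamentalDomain' _ _

instance countable_integerLattice : Countable
    (Submodule.span ℤ (range (EuclideanSpace.basisFun (Fin N) ℝ).toBasis)).toAddSubgroup :=
  inferInstanceAs
    (Countable (Submodule.span ℤ (range (EuclideanSpace.basisFun (Fin N) ℝ).toBasis)))

instance isFiniteMeasure_restrict_unitCube :
    IsFiniteMeasure (volume.restrict (unitCube N)) := by
  refine isFiniteMeasure_restrict.2 ?_
  rw [unitCube_eq_fundamentalDomain]
  exact (ZSpan.fundamentalDomain_isBounded _).measure_lt_top.ne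

theorem IsTorusFun.vadd {β : Type*} {φ : EuclideanSpace ℝ (Fin N) → β} (h : IsTorusFun φ)
    (g : (Submodule.span ℤ (range (EuclideanSpace.basisFun (Fin N) ℝ).toBasis)).toAddSubgroup)
    (x : EuclideanSpace ℝ (Fin N)) : φ (g +ᵥ x) = φ x := by
  obtain ⟨g, hg⟩ := g
  change φ (g + x) = φ x
  rw [Submodule.mem_toAddSubgroup] at hg
  induction hg using Submodule.span_induction generalizing x with
  | mem y hy =>
    obtain ⟨i, rfl⟩ := hy
    rw [add_comm]
    simpa using h i x
  | zero => rw [zero_add]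
  | add y z _ _ hy hz => rw [add_assoc, hy, hz]
  | smul n y _ hy =>
    have : Function.Periodic φ y := fun x => by rw [add_comm, hy]
    rw [add_comm]
    exact this.zsmul n x

/-- Integrals over the torus are invariant under translations: a translate of the unit cube is again a
fundamental domain of the integer lattice. -/
theorem IsTorusFun.integral_add {φ : EuclideanSpace ℝ (Fin N) → ℝ} (h : IsTorusFun φ)
    (v : EuclideanSpace ℝ (Fin N)) :
    ∫ x in unitCube N, φ (x + v) = ∫ x in unitCube N, φ x := by
  have h1 := isAddFundamentalDomain_unitCube (N := N)
  have h2 := h1.vadd_of_comm v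
  rw [h1.setIntegral_eq h2 h.vadd]
  have h3 := (measurePreserving_add_left volume v).setIntegral_image_emb
    (measurableEmbedding_addLeft v) φ (unitCube N)
  have h4 : v +ᵥ unitCube N = (fun x => v + x) '' unitCube N := rfl
  rw [h4, h3]
  simp only [add_comm v]

theorem IsTorusFun.integrable {φ : EuclideanSpace ℝ (Fin N) → ℝ} (h : IsTorusFun φ)
    (hc : Continuous φ) : Integrable φ (volume.restrict (unitCube N)) := by
  obtain ⟨C, -, hC⟩ := h.exists_bound hc
  exact Integrable.of_bound hc.aestronglyMeasurable C (Eventually.of_forall hC)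

/-- The integral of a derivative over the torus vanishes, because integrals over the torus are
invariant under translations. -/
theorem IsTorusFun.integral_fderiv_apply {φ : EuclideanSpace ℝ (Fin N) → ℝ} (h : IsTorusFun φ)
    (hc : ContDiff ℝ 1 φ) (v : EuclideanSpace ℝ (Fin N)) :
    ∫ x in unitCube N, _root_.fderiv ℝ φ x v = 0 := by
  have hc' := hc.continuous_fderiv (by norm_num)
  obtain ⟨C, hC0, hC⟩ := h.fderiv.exists_bound hc'
  have hd : ∀ x (s : ℝ), HasDerivAt (fun s : ℝ => φ (x + s • v))
      (_root_.fderiv ℝ φ (x + s • v) v) s := fun x s => by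
    have h1 : HasDerivAt (fun s : ℝ => x + s • v) v s := by
      simpa using ((hasDerivAt_id s).smul_const v).const_add x
    exact ((hc.differentiable (by norm_num)) _).hasFDerivAt.comp_hasDerivAt s h1
  have key := hasDerivAt_integral_of_dominated_loc_of_deriv_le
    (μ := volume.restrict (unitCube N)) (F := fun (s : ℝ) x => φ (x + s • v))
    (F' := fun s x => _root_.fderiv ℝ φ (x + s • v) v) (x₀ := 0) (s := univ)
    (bound := fun _ => C * ‖v‖) univ_mem
    (Eventually.of_forall fun s =>
      (hc.continuous.comp (continuous_id.add continuous_const)).aestronglyMeasurable)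
    (by simpa using h.integrable hc.continuous)
    (((hc'.comp (continuous_id.add continuous_const)).clm_apply
      continuous_const).aestronglyMeasurable)
    (Eventually.of_forall fun x s _ => (_root_.fderiv ℝ φ (x + s • v)).le_of_opNorm_le (hC _) v)
    (integrable_const _) (Eventually.of_forall fun x s _ => hd x s)
  have e : (fun s : ℝ => ∫ x in unitCube N, φ (x + s • v)) = fun _ => ∫ x in unitCube N, φ x :=
    funext fun s => h.integral_add (s • v)
  -- the integral of the translates is constant, so its derivative at `0` vanishes
  have h2 := key.2
  rw [e] at h2
  simpa using h2.unique (hasDerivAt_const 0 _)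

/-- Integration by parts on the torus. -/
theorem integral_mul_basisTrace {ρ : EuclideanSpace ℝ (Fin N) → ℝ}
    {V : EuclideanSpace ℝ (Fin N) → EuclideanSpace ℝ (Fin N)} (hρ : IsTorusFun ρ)
    (hρc : ContDiff ℝ 1 ρ) (hV : IsTorusFun V) (hVc : ContDiff ℝ 1 V) :
    ∫ x in unitCube N, (ρ x * basisTrace (EuclideanSpace.basisFun (Fin N) ℝ) (fderiv ℝ V x) +
      fderiv ℝ ρ x (V x)) = 0 := by
  set b := EuclideanSpace.basisFun (Fin N) ℝ with hb
  have hi : ∀ i, ContDiff ℝ 1 fun x => ρ x * inner ℝ (b i) (V x) := fun i =>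
    hρc.mul (contDiff_const.inner ℝ hVc)
  have hp : ∀ i, IsTorusFun fun x => ρ x * inner ℝ (b i) (V x) := fun i j x => by
    simp only [hρ j x, hV j x]
  have hd : ∀ i x, fderiv ℝ (fun x => ρ x * inner ℝ (b i) (V x)) x (b i) =
      ρ x * inner ℝ (b i) (fderiv ℝ V x (b i)) + fderiv ℝ ρ x (b i) * inner ℝ (b i) (V x) :=
    fun i x => by
      have h1 : HasFDerivAt (fun x => inner ℝ (b i) (V x))
          ((innerSL ℝ (b i)).comp (fderiv ℝ V x)) x :=
        (innerSL ℝ (b i)).hasFDerivAt.comp x ((hVc.differentiable (by norm_num)) x).hasFDerivAt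
      have h2 := ((hρc.differentiable (by norm_num)) x).hasFDerivAt.mul h1
      rw [show fderiv ℝ (fun x => ρ x * inner ℝ (b i) (V x)) x = _ from h2.fderiv]
      simp [mul_comm]
  have hs : ∀ x, ρ x * basisTrace b (fderiv ℝ V x) + fderiv ℝ ρ x (V x) =
      ∑ i, fderiv ℝ (fun x => ρ x * inner ℝ (b i) (V x)) x (b i) := fun x => by
    simp only [hd, Finset.sum_add_distrib, basisTrace, Finset.mul_sum]
    congr 1
    conv_lhs => rw [← b.sum_repr' (V x), map_sum]
    refine Finset.sum_congr rfl fun i _ => ?_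
    rw [map_smul, smul_eq_mul, mul_comm]
  simp only [hs]
  rw [integral_finsetSum _ fun i _ => ?_]
  · exact Finset.sum_eq_zero fun i _ => (hp i).integral_fderiv_apply (hi i) (b i)
  · refine IsTorusFun.integrable (fun j x => ?_)
      (((hi i).continuous_fderiv (by norm_num)).clm_apply continuous_const)
    exact congrArg (fun A : EuclideanSpace ℝ (Fin N) →L[ℝ] ℝ => A (b i)) ((hp i).fderiv j x)

/-- A continuous function on the torus with vanishing `L²` norm is zero. The set where it does not vanish
is invariant under the integer lattice, hence it is null in all of space. -/
theorem IsTorusFun.eq_zero_of_integral_sq {φ : EuclideanSpace ℝ (Fin N) → ℝ} (h : IsTorusFun φ)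
    (hc : Continuous φ) (h0 : ∫ x in unitCube N, φ x ^ 2 = 0) (x : EuclideanSpace ℝ (Fin N)) :
    φ x = 0 := by
  have hsq : IsTorusFun fun x => φ x ^ 2 := fun i x => by simp only [h i x]
  have h1 : (fun x => φ x ^ 2) =ᵐ[volume.restrict (unitCube N)] 0 :=
    (integral_eq_zero_iff_of_nonneg (fun x => sq_nonneg (φ x)) (hsq.integrable (hc.pow 2))).1 h0
  have h2 : volume {x | φ x ≠ 0} = 0 := by
    refine isAddFundamentalDomain_unitCube.measure_zero_of_invariant _ (fun g => ?_) ?_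
    · ext x
      rw [mem_vadd_set_iff_neg_vadd_mem]
      simp only [mem_ofPred_eq, h.vadd]
    · have h3 : volume.restrict (unitCube N) {x | φ x ≠ 0} = 0 := by
        refine measure_mono_null (fun x hx => ?_) (ae_iff.1 h1)
        simpa using hx
      have hm : MeasurableSet {x | φ x ≠ 0} := hc.measurable (measurableSet_singleton 0).compl
      rwa [Measure.restrict_apply hm] at h3
  have h3 : φ =ᵐ[volume] fun _ => 0 := ae_iff.2 h2
  exact congrFun ((hc.ae_eq_iff_eq volume continuous_const).1 h3) x

end TorusIntegral

/-! ### Energy estimates -/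

section Energy

variable {N : ℕ} {T : ℝ} {w : EuclideanSpace ℝ (Fin N) → ℝ → ℝ}
  {G : EuclideanSpace ℝ (Fin N) → ℝ → EuclideanSpace ℝ (Fin N) →L[ℝ] ℝ}
  {A : EuclideanSpace ℝ (Fin N) → ℝ →
    EuclideanSpace ℝ (Fin N) →L[ℝ] EuclideanSpace ℝ (Fin N) →L[ℝ] ℝ}
  {wt : EuclideanSpace ℝ (Fin N) → ℝ → ℝ}

/-- `ContinuousOn.sub` for operator-valued functions, stated separately so that instance search stays
fast for nested spaces of linear maps. -/
theorem ContinuousOn.clmSub {X V W : Type*} [TopologicalSpace X] [NormedAddCommGroup V]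
    [NormedSpace ℝ V] [NormedAddCommGroup W] [NormedSpace ℝ W] {f g : X → V →L[ℝ] W} {s : Set X}
    (hf : ContinuousOn f s) (hg : ContinuousOn g s) : ContinuousOn (fun x => f x - g x) s :=
  hf.sub hg

theorem IsParabolic.sub {w' : EuclideanSpace ℝ (Fin N) → ℝ → ℝ}
    {G' : EuclideanSpace ℝ (Fin N) → ℝ → EuclideanSpace ℝ (Fin N) →L[ℝ] ℝ}
    {A' : EuclideanSpace ℝ (Fin N) → ℝ →
      EuclideanSpace ℝ (Fin N) →L[ℝ] EuclideanSpace ℝ (Fin N) →L[ℝ] ℝ}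
    {wt' : EuclideanSpace ℝ (Fin N) → ℝ → ℝ}
    (h : IsParabolic T w G A wt) (h' : IsParabolic T w' G' A' wt') :
    IsParabolic T (fun x t => w x t - w' x t) (fun x t => G x t - G' x t)
      (fun x t => A x t - A' x t) (fun x t => wt x t - wt' x t) :=
  ⟨h.continuousOn.sub h'.continuousOn,
    fun x t ht => (h.hasFDerivAt x t ht).sub (h'.hasFDerivAt x t ht),
    fun x t ht => (h.hasFDerivAt_two x t ht).sub (h'.hasFDerivAt_two x t ht),
    fun x t ht => (h.hasDerivAt x t ht).sub (h'.hasDerivAt x t ht),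
    h.continuousOn_fderiv.sub h'.continuousOn_fderiv,
    h.continuousOn_fderiv_two.clmSub h'.continuousOn_fderiv_two,
    h.continuousOn_deriv.sub h'.continuousOn_deriv⟩

theorem IsParabolic.isTorusFun_fderiv (h : IsParabolic T w G A wt)
    (hper : ∀ t ∈ Icc 0 T, IsTorusFun (fun x => w x t)) {t : ℝ} (ht : t ∈ Ioo 0 T) :
    IsTorusFun fun x => G x t := by
  rw [← h.fderiv_eq ht]
  exact (hper t (Ioo_subset_Icc_self ht)).fderiv

theorem IsParabolic.isTorusFun_fderiv_two (h : IsParabolic T w G A wt)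
    (hper : ∀ t ∈ Icc 0 T, IsTorusFun (fun x => w x t)) {t : ℝ} (ht : t ∈ Ioo 0 T) :
    IsTorusFun fun x => A x t := by
  rw [← funext fun x => h.fderiv_fderiv_eq ht x]
  exact (hper t (Ioo_subset_Icc_self ht)).fderiv.fderiv

theorem IsParabolic.isTorusFun_deriv (h : IsParabolic T w G A wt)
    (hper : ∀ t ∈ Icc 0 T, IsTorusFun (fun x => w x t)) {t : ℝ} (ht : t ∈ Ioo 0 T) :
    IsTorusFun fun x => wt x t := fun i x => by
  refine ((h.hasDerivAt _ t ht).congr_of_eventuallyEq ?_).unique (h.hasDerivAt x t ht)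
  filter_upwards [Icc_mem_nhds ht.1 ht.2] with s hs using (hper s hs i x).symm

/-- The squared `L²` norm over the torus. -/
def energy (w : EuclideanSpace ℝ (Fin N) → ℝ → ℝ) (t : ℝ) : ℝ := ∫ x in unitCube N, w x t ^ 2

theorem energy_nonneg (w : EuclideanSpace ℝ (Fin N) → ℝ → ℝ) (t : ℝ) : 0 ≤ energy w t :=
  integral_nonneg fun _ => sq_nonneg _

theorem continuousOn_energy (hw : ContinuousOn (Function.uncurry w) (univ ×ˢ Icc 0 T))
    (hper : ∀ t ∈ Icc 0 T, IsTorusFun (fun x => w x t)) : ContinuousOn (energy w) (Icc 0 T) := by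
  obtain ⟨C, hC0, hC⟩ := exists_bound_of_isTorusFun_prod hw hper
  refine continuousOn_of_dominated (bound := fun _ => C ^ 2)
    (fun t ht => ((continuous_slice hw ht).pow 2).aestronglyMeasurable)
    (fun t ht => Eventually.of_forall fun x => ?_) (integrable_const _)
    (Eventually.of_forall fun x => ?_)
  · rw [norm_pow]
    exact pow_le_pow_left₀ (norm_nonneg _) (hC x t ht) 2
  · exact (hw.comp (f := fun t => (x, t)) (by fun_prop) fun t ht => ⟨mem_univ _, ht⟩).pow 2

/-- Differentiation of the energy under the integral sign. -/
theorem IsParabolic.hasDerivAt_energy (h : IsParabolic T w G A wt)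
    (hper : ∀ t ∈ Icc 0 T, IsTorusFun (fun x => w x t)) {t : ℝ} (ht : t ∈ Ioo 0 T) :
    HasDerivAt (energy w) (∫ x in unitCube N, 2 * w x t * wt x t) t := by
  have hIcc : Icc (t / 2) ((t + T) / 2) ⊆ Ioo 0 T := fun s hs =>
    ⟨by linarith [hs.1, ht.1], by linarith [hs.2, ht.2]⟩
  have hnhds : Icc (t / 2) ((t + T) / 2) ∈ 𝓝 t :=
    Icc_mem_nhds (by linarith [ht.1]) (by linarith [ht.2])
  obtain ⟨C, hC0, hC⟩ := exists_bound_of_isTorusFun_prod h.continuousOn hper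
  obtain ⟨D, hD0, hD⟩ := exists_bound_of_isTorusFun_prod
    (h.continuousOn_deriv.mono (prod_mono_right hIcc))
    fun s hs => h.isTorusFun_deriv hper (hIcc hs)
  have hwc : ∀ s ∈ Ioo 0 T, Continuous fun x => w x s := fun s hs =>
    continuous_slice h.continuousOn (Ioo_subset_Icc_self hs)
  refine (hasDerivAt_integral_of_dominated_loc_of_deriv_le
    (μ := volume.restrict (unitCube N)) (F := fun (s : ℝ) x => w x s ^ 2)
    (F' := fun s x => 2 * w x s * wt x s) (bound := fun _ => 2 * C * D) hnhds
    ?_ ?_ ?_ ?_ (integrable_const _) ?_).2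
  · filter_upwards [hnhds] with s hs
    exact ((hwc s (hIcc hs)).pow 2).aestronglyMeasurable
  · refine IsTorusFun.integrable (fun i x => ?_) ((hwc t ht).pow 2)
    exact congrArg (· ^ 2) (hper t (Ioo_subset_Icc_self ht) i x)
  · exact ((continuous_const.mul (hwc t ht)).mul
      (continuous_slice h.continuousOn_deriv ht)).aestronglyMeasurable
  · refine Eventually.of_forall fun x s hs => ?_
    rw [norm_mul, norm_mul, Real.norm_ofNat]
    have h1 : ‖w x s‖ ≤ C := hC x s (Ioo_subset_Icc_self (hIcc hs))
    have h2 : ‖wt x s‖ ≤ D := hD x s hs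
    gcongr
  · refine Eventually.of_forall fun x s hs => ?_
    have h1 := (h.hasDerivAt x s (hIcc hs)).fun_pow 2
    simpa using h1

/-- The sum of the second derivatives is the divergence of the gradient. -/
theorem basisTrace_sharp_comp {E ι : Type*} [NormedAddCommGroup E] [InnerProductSpace ℝ E]
    [FiniteDimensional ℝ E] [Fintype ι] (b : OrthonormalBasis ι ℝ E) (A : E →L[ℝ] E →L[ℝ] ℝ) :
    basisTrace b (((sharp E).toContinuousLinearEquiv : (E →L[ℝ] ℝ) →L[ℝ] E).comp A) =
      ∑ i, A (b i) (b i) := by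
  refine Finset.sum_congr rfl fun i _ => ?_
  rw [real_inner_comm]
  exact InnerProductSpace.toDual_symm_apply

theorem apply_sharp_self {E : Type*} [NormedAddCommGroup E] [InnerProductSpace ℝ E]
    [CompleteSpace E] (P : E →L[ℝ] ℝ) : P (sharp E P) = ‖P‖ ^ 2 := by
  have h : inner ℝ (sharp E P) (sharp E P) = P (sharp E P) := InnerProductSpace.toDual_symm_apply
  rw [← h, real_inner_self_eq_norm_sq, LinearIsometryEquiv.norm_map]

theorem IsParabolic.contDiff (h : IsParabolic T w G A wt) {t : ℝ} (ht : t ∈ Ioo 0 T) :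
    ContDiff ℝ 1 fun x => w x t :=
  contDiff_one_iff_hasFDerivAt.2 ⟨fun x => G x t, continuous_slice h.continuousOn_fderiv ht,
    fun x => h.hasFDerivAt x t ht⟩

theorem IsParabolic.contDiff_fderiv (h : IsParabolic T w G A wt) {t : ℝ} (ht : t ∈ Ioo 0 T) :
    ContDiff ℝ 1 fun x => G x t :=
  contDiff_one_iff_hasFDerivAt.2 ⟨fun x => A x t, continuous_slice h.continuousOn_fderiv_two ht,
    fun x => h.hasFDerivAt_two x t ht⟩

/-- Integration by parts: `∫ w Δw = -∫ |∇w|²`. -/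
theorem IsParabolic.integral_mul_laplacian (h : IsParabolic T w G A wt)
    (hper : ∀ t ∈ Icc 0 T, IsTorusFun (fun x => w x t)) {t : ℝ} (ht : t ∈ Ioo 0 T) :
    ∫ x in unitCube N, (w x t * (∑ i, A x t (EuclideanSpace.basisFun (Fin N) ℝ i)
      (EuclideanSpace.basisFun (Fin N) ℝ i)) + ‖G x t‖ ^ 2) = 0 := by
  have hV : ContDiff ℝ 1 fun x => sharp (EuclideanSpace ℝ (Fin N)) (G x t) :=
    (sharp _).contDiff.comp (h.contDiff_fderiv ht)
  have h1 := integral_mul_basisTrace (hper t (Ioo_subset_Icc_self ht)) (h.contDiff ht)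
    (V := fun x => sharp (EuclideanSpace ℝ (Fin N)) (G x t))
    (fun i x => congrArg (sharp _) (h.isTorusFun_fderiv hper ht i x)) hV
  rw [← h1]
  congr 1
  funext x
  have h2 : HasFDerivAt (fun x => sharp (EuclideanSpace ℝ (Fin N)) (G x t))
      (((sharp (EuclideanSpace ℝ (Fin N))).toContinuousLinearEquiv :
        (EuclideanSpace ℝ (Fin N) →L[ℝ] ℝ) →L[ℝ] EuclideanSpace ℝ (Fin N)).comp (A x t)) x :=
    (sharp (EuclideanSpace ℝ (Fin N))).toContinuousLinearEquiv.hasFDerivAt.comp x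
      (h.hasFDerivAt_two x t ht)
  rw [h2.fderiv, basisTrace_sharp_comp, (h.hasFDerivAt x t ht).fderiv, apply_sharp_self]

theorem IsParabolic.integrable_laplacian (h : IsParabolic T w G A wt)
    (hper : ∀ t ∈ Icc 0 T, IsTorusFun (fun x => w x t)) {t : ℝ} (ht : t ∈ Ioo 0 T) :
    Integrable (fun x => w x t * (∑ i, A x t (EuclideanSpace.basisFun (Fin N) ℝ i)
      (EuclideanSpace.basisFun (Fin N) ℝ i)) + ‖G x t‖ ^ 2) (volume.restrict (unitCube N)) := by
  have hA := continuous_slice h.continuousOn_fderiv_two ht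
  have hG := continuous_slice h.continuousOn_fderiv ht
  refine IsTorusFun.integrable (fun i x => ?_)
    (((h.contDiff ht).continuous.mul (continuous_finsetSum _ fun i _ =>
      (hA.clm_apply continuous_const).clm_apply continuous_const)).add (hG.norm.pow 2))
  have h1 : w (x + EuclideanSpace.single i 1) t = w x t := hper t (Ioo_subset_Icc_self ht) i x
  have h2 : G (x + EuclideanSpace.single i 1) t = G x t := h.isTorusFun_fderiv hper ht i x
  have h3 : A (x + EuclideanSpace.single i 1) t = A x t := h.isTorusFun_fderiv_two hper ht i x
  simp only [h1, h2, h3]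

theorem IsParabolic.integrable_mul_deriv (h : IsParabolic T w G A wt)
    (hper : ∀ t ∈ Icc 0 T, IsTorusFun (fun x => w x t)) {t : ℝ} (ht : t ∈ Ioo 0 T) :
    Integrable (fun x => 2 * w x t * wt x t) (volume.restrict (unitCube N)) := by
  refine IsTorusFun.integrable (fun i x => ?_) ((continuous_const.mul
    (h.contDiff ht).continuous).mul (continuous_slice h.continuousOn_deriv ht))
  have h1 : w (x + EuclideanSpace.single i 1) t = w x t := hper t (Ioo_subset_Icc_self ht) i x
  have h2 : wt (x + EuclideanSpace.single i 1) t = wt x t := h.isTorusFun_deriv hper ht i x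
  simp only [h1, h2]

theorem IsParabolic.integrable_sq (h : IsParabolic T w G A wt)
    (hper : ∀ t ∈ Icc 0 T, IsTorusFun (fun x => w x t)) {t : ℝ} (ht : t ∈ Ioo 0 T) :
    Integrable (fun x => w x t ^ 2) (volume.restrict (unitCube N)) :=
  IsTorusFun.integrable
    (fun i x => congrArg (· ^ 2) (hper t (Ioo_subset_Icc_self ht) i x))
    ((h.contDiff ht).continuous.pow 2)

theorem IsParabolic.integrable_norm_fderiv_sq (h : IsParabolic T w G A wt)
    (hper : ∀ t ∈ Icc 0 T, IsTorusFun (fun x => w x t)) {t : ℝ} (ht : t ∈ Ioo 0 T) :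
    Integrable (fun x => ‖G x t‖ ^ 2) (volume.restrict (unitCube N)) :=
  IsTorusFun.integrable (fun i x => congrArg (‖·‖ ^ 2) (h.isTorusFun_fderiv hper ht i x))
    ((continuous_slice h.continuousOn_fderiv ht).norm.pow 2)

variable {μ : EuclideanSpace ℝ (Fin N) → ℝ → ℝ}
  {Gμ : EuclideanSpace ℝ (Fin N) → ℝ → EuclideanSpace ℝ (Fin N) →L[ℝ] ℝ}
  {Aμ : EuclideanSpace ℝ (Fin N) → ℝ →
    EuclideanSpace ℝ (Fin N) →L[ℝ] EuclideanSpace ℝ (Fin N) →L[ℝ] ℝ}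
  {μt : EuclideanSpace ℝ (Fin N) → ℝ → ℝ}

/-- Energy estimate for the backward equation. -/
theorem IsParabolic.le_integral_of_backward (h : IsParabolic T w G A wt)
    (hper : ∀ t ∈ Icc 0 T, IsTorusFun (fun x => w x t)) (hμ : IsParabolic T μ Gμ Aμ μt)
    (hμper : ∀ t ∈ Icc 0 T, IsTorusFun (fun x => μ x t)) {t : ℝ} (ht : t ∈ Ioo 0 T) {L : ℝ}
    (heq : ∀ x, |wt x t + ∑ i, A x t (EuclideanSpace.basisFun (Fin N) ℝ i)
      (EuclideanSpace.basisFun (Fin N) ℝ i)| ≤ L * (‖G x t‖ + |μ x t|)) :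
    (∫ x in unitCube N, ‖G x t‖ ^ 2) - 2 * L ^ 2 * energy w t - energy μ t ≤
      ∫ x in unitCube N, 2 * w x t * wt x t := by
  have i1 := h.integrable_norm_fderiv_sq hper ht
  have i2 := (h.integrable_sq hper ht).const_mul (2 * L ^ 2)
  have i3 := hμ.integrable_sq hμper ht
  have i4 := h.integrable_mul_deriv hper ht
  have i5 := (h.integrable_laplacian hper ht).const_mul 2
  have i6 : Integrable (fun x => ‖G x t‖ ^ 2 - 2 * L ^ 2 * w x t ^ 2)
      (volume.restrict (unitCube N)) := i1.sub i2
  have e1 : (∫ x in unitCube N, ‖G x t‖ ^ 2) - 2 * L ^ 2 * energy w t - energy μ t =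
      ∫ x in unitCube N, (‖G x t‖ ^ 2 - 2 * L ^ 2 * w x t ^ 2 - μ x t ^ 2) := by
    rw [integral_sub i6 i3, integral_sub i1 i2, integral_const_mul, energy, energy]
  have e2 : ∫ x in unitCube N, 2 * w x t * wt x t =
      ∫ x in unitCube N, (2 * w x t * wt x t + 2 * (w x t * (∑ i, A x t
        (EuclideanSpace.basisFun (Fin N) ℝ i) (EuclideanSpace.basisFun (Fin N) ℝ i)) +
          ‖G x t‖ ^ 2)) := by
    rw [integral_add i4 i5, integral_const_mul, h.integral_mul_laplacian hper ht]
    ring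
  -- with the vanishing integral of `w Δw + |∇w|²` added, the inequality holds pointwise
  rw [e1, e2]
  refine integral_mono (i6.sub i3) (i4.add i5) fun x => ?_
  have h1 := heq x
  simp only
  set s := ∑ i, A x t (EuclideanSpace.basisFun (Fin N) ℝ i)
    (EuclideanSpace.basisFun (Fin N) ℝ i)
  have h2 : -(|w x t| * (L * (‖G x t‖ + |μ x t|))) ≤ w x t * (wt x t + s) := by
    refine le_trans ?_ (neg_abs_le _)
    rw [abs_mul]
    exact neg_le_neg (mul_le_mul_of_nonneg_left h1 (abs_nonneg _))
  have h3 := sq_abs (w x t)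
  have h4 := sq_abs (μ x t)
  nlinarith [sq_nonneg (L * |w x t| - ‖G x t‖), sq_nonneg (L * |w x t| - |μ x t|)]

/-- Energy estimate for the forward equation. -/
theorem IsParabolic.integral_le_of_forward (hμ : IsParabolic T μ Gμ Aμ μt)
    (hμper : ∀ t ∈ Icc 0 T, IsTorusFun (fun x => μ x t)) (h : IsParabolic T w G A wt)
    (hper : ∀ t ∈ Icc 0 T, IsTorusFun (fun x => w x t)) {t : ℝ} (ht : t ∈ Ioo 0 T)
    {V : EuclideanSpace ℝ (Fin N) → EuclideanSpace ℝ (Fin N)} (hV : ContDiff ℝ 1 V)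
    (hVper : IsTorusFun V) {L : ℝ} (hL : ∀ x, ‖V x‖ ≤ L * (‖G x t‖ + |μ x t|))
    (heq : ∀ x, μt x t = ∑ i, Aμ x t (EuclideanSpace.basisFun (Fin N) ℝ i)
      (EuclideanSpace.basisFun (Fin N) ℝ i) + divergence V x) :
    ∫ x in unitCube N, 2 * μ x t * μt x t ≤
      L ^ 2 * ((∫ x in unitCube N, ‖G x t‖ ^ 2) + energy μ t) := by
  have hV' := integral_mul_basisTrace (hμper t (Ioo_subset_Icc_self ht)) (hμ.contDiff ht) hVper hV
  have i1 := h.integrable_norm_fderiv_sq hper ht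
  have i3 := hμ.integrable_sq hμper ht
  have i4 := hμ.integrable_mul_deriv hμper ht
  have i5 := (hμ.integrable_laplacian hμper ht).const_mul 2
  have i6 : Integrable (fun x => 2 * (μ x t * basisTrace (EuclideanSpace.basisFun (Fin N) ℝ)
      (fderiv ℝ V x) + fderiv ℝ (fun x => μ x t) x (V x))) (volume.restrict (unitCube N)) := by
    refine Integrable.const_mul (IsTorusFun.integrable (fun i x => ?_) ?_) 2
    · have h1 : μ (x + EuclideanSpace.single i 1) t = μ x t :=
        hμper t (Ioo_subset_Icc_self ht) i x
      simp only [h1, (hμper t (Ioo_subset_Icc_self ht)).fderiv i x, hVper i x, hVper.fderiv i x]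
    · refine ((hμ.contDiff ht).continuous.mul (continuous_finsetSum _ fun i _ =>
        continuous_const.inner ((hV.continuous_fderiv (by norm_num)).clm_apply
          continuous_const))).add
        (((hμ.contDiff ht).continuous_fderiv (by norm_num)).clm_apply hV.continuous)
  have i7 : Integrable (fun x => 2 * μ x t * μt x t - 2 * (μ x t * (∑ i, Aμ x t
      (EuclideanSpace.basisFun (Fin N) ℝ i) (EuclideanSpace.basisFun (Fin N) ℝ i)) +
        ‖Gμ x t‖ ^ 2)) (volume.restrict (unitCube N)) := i4.sub i5
  have e1 : L ^ 2 * ((∫ x in unitCube N, ‖G x t‖ ^ 2) + energy μ t) =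
      ∫ x in unitCube N, L ^ 2 * (‖G x t‖ ^ 2 + μ x t ^ 2) := by
    rw [integral_const_mul, integral_add i1 i3, energy]
  have e2 : ∫ x in unitCube N, 2 * μ x t * μt x t =
      ∫ x in unitCube N, (2 * μ x t * μt x t - 2 * (μ x t * (∑ i, Aμ x t
        (EuclideanSpace.basisFun (Fin N) ℝ i) (EuclideanSpace.basisFun (Fin N) ℝ i)) +
          ‖Gμ x t‖ ^ 2) - 2 * (μ x t * basisTrace (EuclideanSpace.basisFun (Fin N) ℝ)
      (fderiv ℝ V x) + fderiv ℝ (fun x => μ x t) x (V x))) := by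
    rw [integral_sub i7 i6, integral_sub i4 i5, integral_const_mul, integral_const_mul,
      hμ.integral_mul_laplacian hμper ht, hV']
    ring
  -- with the vanishing integrals of both integrations by parts subtracted, the inequality holds
  -- pointwise
  rw [e1, e2]
  refine integral_mono (i7.sub i6) ((i1.add i3).const_mul _) fun x => ?_
  simp only
  rw [heq, divergence_eq_basisTrace, (hμ.hasFDerivAt x t ht).fderiv]
  have h1 : -(‖Gμ x t‖ * ‖V x‖) ≤ Gμ x t (V x) :=
    (neg_le_neg ((Gμ x t).le_opNorm (V x))).trans (neg_abs_le _)
  have h2 : ‖V x‖ ^ 2 ≤ L ^ 2 * (‖G x t‖ + |μ x t|) ^ 2 := by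
    rw [← mul_pow]
    exact pow_le_pow_left₀ (norm_nonneg _) (hL x) 2
  have h3 := sq_abs (μ x t)
  nlinarith [sq_nonneg (2 * ‖Gμ x t‖ - ‖V x‖), mul_nonneg (sq_nonneg L)
    (sq_nonneg (‖G x t‖ - |μ x t|))]

/-- A forward-backward differential inequality with zero data at both ends has only the zero
solution if the time horizon is small. In the energy method `y` and `z` are the squared norms of the
differences of the value functions and of the densities, and `Z` is that of the gradients. -/
theorem eq_zero_of_forward_backward {y z y' z' Z : ℝ → ℝ} {C : ℝ} (hC : 0 ≤ C) (hT : 0 < T)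
    (hTC : (C + C ^ 2) * (2 + C) * T < 1)
    (hy : ContinuousOn y (Icc 0 T)) (hz : ContinuousOn z (Icc 0 T))
    (hyd : ∀ t ∈ Ioo 0 T, HasDerivAt y (y' t) t) (hzd : ∀ t ∈ Ioo 0 T, HasDerivAt z (z' t) t)
    (hy0 : ∀ t, 0 ≤ y t) (hz0 : ∀ t, 0 ≤ z t) (hZ : ∀ t, 0 ≤ Z t)
    (hy' : ∀ t ∈ Ioo 0 T, Z t - C * (y t + z t) ≤ y' t)
    (hz' : ∀ t ∈ Ioo 0 T, z' t ≤ C * (z t + Z t)) (hyT : y T = 0) (hz00 : z 0 = 0) :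
    ∀ t ∈ Icc 0 T, y t = 0 ∧ z t = 0 := by
  obtain ⟨t₀, ht₀, hmax⟩ := isCompact_Icc.exists_isMaxOn (nonempty_Icc.2 hT.le) (hy.add hz)
  set S := y t₀ + z t₀ with hS
  have hS' : ∀ t ∈ Icc 0 T, y t + z t ≤ S := fun t ht => hmax ht
  have hS0 : 0 ≤ S := add_nonneg (hy0 _) (hz0 _)
  set K := C + C ^ 2 with hK
  have hK0 : 0 ≤ K := by positivity
  have hCK : C ≤ K := by nlinarith
  have h1 : T - t₀ ≤ T := by linarith [ht₀.1]
  have h2 : t₀ - 0 ≤ T := by linarith [ht₀.2]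
  have by1 : y t₀ ≤ K * S * T := by
    have := (convex_Icc 0 T).mul_sub_le_image_sub_of_le_deriv (C := -(K * S)) hy
      (fun t ht => (hyd t (interior_Icc (a := (0 : ℝ)) ▸ ht)).differentiableAt.differentiableWithinAt)
      (fun t ht => ?_) t₀ ht₀ T (right_mem_Icc.2 hT.le) ht₀.2
    · rw [hyT] at this
      nlinarith [mul_nonneg hK0 hS0]
    · rw [interior_Icc] at ht
      rw [(hyd t ht).deriv]
      have e1 := hy' t ht
      have e2 := hS' t (Ioo_subset_Icc_self ht)
      have e3 : C * (y t + z t) ≤ K * S :=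
        mul_le_mul hCK e2 (add_nonneg (hy0 _) (hz0 _)) hK0
      linarith [hZ t]
  -- `Z` cancels in the derivative of `z - C * y`
  have by2 : z t₀ - C * y t₀ ≤ K * S * T := by
    have := (convex_Icc 0 T).image_sub_le_mul_sub_of_deriv_le (C := K * S)
      (f := fun t => z t - C * y t) (hz.sub (continuousOn_const.mul hy))
      (fun t ht => by
        rw [interior_Icc] at ht
        exact ((hzd t ht).sub ((hyd t ht).const_mul C)).differentiableAt.differentiableWithinAt)
      (fun t ht => ?_) 0 (left_mem_Icc.2 hT.le) t₀ ht₀ ht₀.1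
    · simp only [hz00] at this
      nlinarith [mul_nonneg hK0 hS0, mul_nonneg hC (hy0 0)]
    · rw [interior_Icc] at ht
      have hd := ((hzd t ht).sub ((hyd t ht).const_mul C)).deriv
      refine le_trans (le_of_eq hd) ?_
      have e1 := hy' t ht
      have e2 := hS' t (Ioo_subset_Icc_self ht)
      have e3 := hz' t ht
      have e4 : K * (y t + z t) ≤ K * S := mul_le_mul_of_nonneg_left e2 hK0
      nlinarith [mul_le_mul_of_nonneg_left e1 hC, mul_nonneg hC (hy0 t)]
  have h3 : S ≤ K * (2 + C) * T * S := by
    nlinarith [mul_le_mul_of_nonneg_left by1 hC]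
  have h4 : S = 0 := by nlinarith
  intro t ht
  have := hS' t ht
  constructor <;> linarith [hy0 t, hz0 t]

end Energy

/-! ### Uniqueness of classical solutions -/

section Uniqueness

variable {N : ℕ} {f : EuclideanSpace ℝ (Fin N) → ℝ → ℝ} {H m₀ uT : EuclideanSpace ℝ (Fin N) → ℝ}

/-- The coupling is Lipschitz in the density on bounded intervals, including near `0`, where it is
only one-sided differentiable. -/
theorem exists_lipschitz_coupling (hf_per : ∀ r ∈ Ici (0 : ℝ), IsTorusFun (fun x => f x r))
    (hf : ContDiffOn ℝ 3 (fun p : EuclideanSpace ℝ (Fin N) × ℝ => f p.1 p.2)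
      (univ ×ˢ Ici (0 : ℝ))) (D : ℝ) :
    ∃ L, 0 ≤ L ∧ ∀ x, ∀ r ∈ Icc 0 D, ∀ r' ∈ Icc 0 D, |f x r - f x r'| ≤ L * |r - r'| := by
  set s : Set (EuclideanSpace ℝ (Fin N) × ℝ) := univ ×ˢ Ici (0 : ℝ) with hs
  have hsu : UniqueDiffOn ℝ s := uniqueDiffOn_univ.prod (uniqueDiffOn_Ici 0)
  have hks : closedCube N ×ˢ Icc 0 D ⊆ s := prod_mono (subset_univ _) Icc_subset_Ici_self
  obtain ⟨C, hC⟩ := (isCompact_closedCube.prod isCompact_Icc).exists_bound_of_continuousOn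
    ((hf.continuousOn_fderivWithin hsu (by norm_num)).mono hks)
  refine ⟨max C 0, le_max_right _ _, fun x r hr r' hr' => ?_⟩
  have hx := sub_floorVec_mem_closedCube x
  have h1 := ((convex_closedCube (N := N)).prod
    (convex_Icc 0 D)).norm_image_sub_le_of_norm_hasFDerivWithin_le
    (fun q hq => ((hf.differentiableOn (by norm_num) q (hks hq)).hasFDerivWithinAt).mono hks)
    hC (mk_mem_prod hx hr') (mk_mem_prod hx hr)
  simp only [(hf_per r hr.1).sub_floorVec x, (hf_per r' hr'.1).sub_floorVec x] at h1
  rw [Prod.mk_sub_mk, sub_self, Prod.norm_mk, norm_zero, max_eq_right (norm_nonneg _)] at h1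
  exact h1.trans (mul_le_mul_of_nonneg_right (le_max_left _ _) (abs_nonneg _))

/-- On bounded sets the Hamiltonian and its gradient are Lipschitz, and the gradient is bounded. -/
theorem exists_lipschitz_hamiltonian (hH : ContDiff ℝ 3 H) (R : ℝ) :
    ∃ L, 0 ≤ L ∧ ∀ v v', ‖v‖ ≤ R → ‖v'‖ ≤ R → |H v - H v'| ≤ L * ‖v - v'‖ ∧
      ‖gradient H v - gradient H v'‖ ≤ L * ‖v - v'‖ ∧ ‖gradient H v‖ ≤ L := by
  obtain ⟨K, hK, hKs, hKH⟩ := exists_truncation hH R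
  obtain ⟨C, hC0, -, hC⟩ := exists_lipschitz_of_hasCompactSupport (hK.of_le (by norm_num)) hKs
  obtain ⟨D, hD0, hDb, hD⟩ := exists_lipschitz_of_hasCompactSupport
    (hK.fderiv_right (m := 1) (by norm_num)) (hKs.fderiv ℝ)
  refine ⟨C + D, by positivity, fun v v' hv hv' => ?_⟩
  rw [gradient_eq_sharp, gradient_eq_sharp, ← map_sub, LinearIsometryEquiv.norm_map,
    LinearIsometryEquiv.norm_map, ← (hKH v hv).eq_of_nhds, ← (hKH v' hv').eq_of_nhds,
    ← (hKH v hv).fderiv_eq, ← (hKH v' hv').fderiv_eq]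
  exact ⟨(hC v v').trans (by gcongr; linarith), (hD v v').trans (by gcongr; linarith),
    (hDb v).trans (by linarith)⟩

theorem IsClassicalFun.contDiff_gradient {T : ℝ} {u : EuclideanSpace ℝ (Fin N) → ℝ → ℝ}
    (hu : IsClassicalFun T u) {t : ℝ} (ht : t ∈ Ioo 0 T) :
    ContDiff ℝ 1 fun x => gradient (fun y => u y t) x :=
  (sharp _).contDiff.comp ((hu.contDiff_space t ht).fderiv_right (m := 1) (by norm_num))

theorem IsClassicalFun.isTorusFun_gradient {T : ℝ} {u : EuclideanSpace ℝ (Fin N) → ℝ → ℝ}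
    (hu : IsClassicalFun T u) {t : ℝ} (ht : t ∈ Ioo 0 T) :
    IsTorusFun fun x => gradient (fun y => u y t) x := fun i x =>
  congrArg (sharp _) ((hu.periodic t (Ioo_subset_Icc_self ht)).fderiv i x)

theorem IsClassicalMFGSolution.contDiff_flux {T : ℝ} {u m : EuclideanSpace ℝ (Fin N) → ℝ → ℝ}
    (hH : ContDiff ℝ 3 H) (h : IsClassicalMFGSolution f H m₀ uT T u m) {t : ℝ}
    (ht : t ∈ Ioo 0 T) :
    ContDiff ℝ 1 fun y => m y t • gradient H (gradient (fun z => u z t) y) :=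
  ((h.classical_m.contDiff_space t ht).of_le (by norm_num)).smul
    ((sharp _).contDiff.comp ((hH.fderiv_right (m := 1) (by norm_num)).comp
      (h.classical_u.contDiff_gradient ht)))

theorem IsClassicalMFGSolution.isTorusFun_flux {T : ℝ} {u m : EuclideanSpace ℝ (Fin N) → ℝ → ℝ}
    (h : IsClassicalMFGSolution f H m₀ uT T u m) {t : ℝ} (ht : t ∈ Ioo 0 T) :
    IsTorusFun fun y => m y t • gradient H (gradient (fun z => u z t) y) := fun i x => by
  have h1 : m (x + EuclideanSpace.single i 1) t = m x t :=
    h.classical_m.periodic t (Ioo_subset_Icc_self ht) i x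
  have h2 := h.classical_u.isTorusFun_gradient ht i x
  simp only at h2
  simp only [h1, h2]

theorem divergence_sub {V V' : EuclideanSpace ℝ (Fin N) → EuclideanSpace ℝ (Fin N)}
    (hV : ContDiff ℝ 1 V) (hV' : ContDiff ℝ 1 V') (x : EuclideanSpace ℝ (Fin N)) :
    divergence (fun y => V y - V' y) x = divergence V x - divergence V' x := by
  rw [divergence_eq_basisTrace, divergence_eq_basisTrace, divergence_eq_basisTrace,
    ← basisTrace_sub, fderiv_fun_sub (hV.differentiable (by norm_num) x)
      (hV'.differentiable (by norm_num) x)]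

theorem norm_smul_sub_smul_le {E : Type*} [NormedAddCommGroup E] [NormedSpace ℝ E] {r r' D L d : ℝ}
    {b b' : E} (hL : 0 ≤ L) (hD : 0 ≤ D) (hd : 0 ≤ d) (hb : ‖b‖ ≤ L) (hb' : ‖b - b'‖ ≤ L * d)
    (hr' : |r'| ≤ D) : ‖r • b - r' • b'‖ ≤ L * (1 + D) * (d + |r - r'|) := by
  have e : r • b - r' • b' = (r - r') • b + r' • (b - b') := by
    rw [sub_smul, smul_sub]; abel
  rw [e]
  refine (norm_add_le _ _).trans ?_
  rw [norm_smul, norm_smul, Real.norm_eq_abs, Real.norm_eq_abs]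
  have h1 := mul_le_mul_of_nonneg_left hb (abs_nonneg (r - r'))
  have h2 := mul_le_mul hr' hb' (norm_nonneg _) hD
  nlinarith [mul_nonneg hL hd, mul_nonneg (mul_nonneg hL hD) (abs_nonneg (r - r'))]

/-- Uniqueness of classical solutions in a bounded range, for small horizons, by the energy
method: the `L²` norms of the differences satisfy a forward-backward differential inequality. -/
theorem IsClassicalMFGSolution.eq_of_bounded {T D R L L' : ℝ}
    {u m u' m' : EuclideanSpace ℝ (Fin N) → ℝ → ℝ}
    (hH : ContDiff ℝ 3 H) (hL0 : 0 ≤ L) (hL0' : 0 ≤ L') (hD : 0 ≤ D)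
    (hfL : ∀ x, ∀ r ∈ Icc 0 D, ∀ r' ∈ Icc 0 D, |f x r - f x r'| ≤ L * |r - r'|)
    (hHL : ∀ v v', ‖v‖ ≤ R → ‖v'‖ ≤ R → |H v - H v'| ≤ L' * ‖v - v'‖ ∧
      ‖gradient H v - gradient H v'‖ ≤ L' * ‖v - v'‖ ∧ ‖gradient H v‖ ≤ L')
    (hT : 0 < T) {C : ℝ} (hC1 : 2 * (L + L') ^ 2 + 1 ≤ C) (hC2 : (L' * (1 + D)) ^ 2 ≤ C)
    (hTC : (C + C ^ 2) * (2 + C) * T < 1)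
    (h : IsClassicalMFGSolution f H m₀ uT T u m) (h' : IsClassicalMFGSolution f H m₀ uT T u' m')
    (hR : ∀ t ∈ Ioo 0 T, ∀ x, ‖gradient (fun y => u y t) x‖ ≤ R ∧ m x t ≤ D)
    (hR' : ∀ t ∈ Ioo 0 T, ∀ x, ‖gradient (fun y => u' y t) x‖ ≤ R ∧ m' x t ≤ D) :
    ∀ t ∈ Icc 0 T, ∀ x, u x t = u' x t ∧ m x t = m' x t := by
  have hw := h.classical_u.isParabolic.sub h'.classical_u.isParabolic
  have hμ := h.classical_m.isParabolic.sub h'.classical_m.isParabolic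
  have hwper : ∀ t ∈ Icc 0 T, IsTorusFun fun x => u x t - u' x t := fun t ht i x =>
    congrArg₂ (· - ·) (h.classical_u.periodic t ht i x) (h'.classical_u.periodic t ht i x)
  have hμper : ∀ t ∈ Icc 0 T, IsTorusFun fun x => m x t - m' x t := fun t ht i x =>
    congrArg₂ (· - ·) (h.classical_m.periodic t ht i x) (h'.classical_m.periodic t ht i x)
  have hC0 : 0 ≤ C := by nlinarith [sq_nonneg (L + L')]
  have hG : ∀ t x, ‖gradient (fun y => u y t) x - gradient (fun y => u' y t) x‖ =
      ‖fderiv ℝ (fun y => u y t) x - fderiv ℝ (fun y => u' y t) x‖ := fun t x => by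
    rw [gradient_eq_sharp, gradient_eq_sharp, ← map_sub, LinearIsometryEquiv.norm_map]
  have hmr : ∀ t ∈ Ioo 0 T, ∀ x, m x t ∈ Icc 0 D := fun t ht x =>
    ⟨h.nonneg_m x t (Ioo_subset_Icc_self ht), (hR t ht x).2⟩
  have hmr' : ∀ t ∈ Ioo 0 T, ∀ x, m' x t ∈ Icc 0 D := fun t ht x =>
    ⟨h'.nonneg_m x t (Ioo_subset_Icc_self ht), (hR' t ht x).2⟩
  have key := eq_zero_of_forward_backward hC0 hT hTC
    (continuousOn_energy hw.continuousOn hwper) (continuousOn_energy hμ.continuousOn hμper)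
    (fun t ht => hw.hasDerivAt_energy hwper ht) (fun t ht => hμ.hasDerivAt_energy hμper ht)
    (energy_nonneg _) (energy_nonneg _)
    (Z := fun t => ∫ x in unitCube N,
      ‖fderiv ℝ (fun y => u y t) x - fderiv ℝ (fun y => u' y t) x‖ ^ 2)
    (fun t => integral_nonneg fun x => sq_nonneg _) (fun t ht => ?_) (fun t ht => ?_) ?_ ?_
  · intro t ht x
    obtain ⟨k1, k2⟩ := key t ht
    exact ⟨sub_eq_zero.1 ((hwper t ht).eq_zero_of_integral_sq
      (continuous_slice hw.continuousOn ht) k1 x), sub_eq_zero.1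
      ((hμper t ht).eq_zero_of_integral_sq (continuous_slice hμ.continuousOn ht) k2 x)⟩
  · refine le_trans ?_ (hw.le_integral_of_backward hwper hμ hμper ht (L := L + L') fun x => ?_)
    · have e1 := energy_nonneg (fun x t => u x t - u' x t) t
      have e2 := energy_nonneg (fun x t => m x t - m' x t) t
      have e3 : 0 ≤ C - 2 * (L + L') ^ 2 - 1 := by linarith
      nlinarith [mul_nonneg e3 e1, mul_nonneg e3 e2, sq_nonneg (L + L'),
        mul_nonneg (sq_nonneg (L + L')) e2]
    · have a1 := h.hamiltonJacobi x t ht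
      have a2 := h'.hamiltonJacobi x t ht
      rw [laplacian_eq_sum (EuclideanSpace.basisFun (Fin N) ℝ)] at a1 a2
      simp only [sub_apply, Finset.sum_sub_distrib]
      have b1 := (hHL _ _ (hR t ht x).1 (hR' t ht x).1).1
      have b2 := hfL x _ (hmr t ht x) _ (hmr' t ht x)
      rw [hG] at b1
      have c1 := norm_nonneg (fderiv ℝ (fun y => u y t) x - fderiv ℝ (fun y => u' y t) x)
      have c2 := abs_nonneg (m x t - m' x t)
      have d1 := abs_le.1 b1
      have d2 := abs_le.1 b2
      rw [abs_le]
      constructor <;> nlinarith [mul_nonneg hL0 c1, mul_nonneg hL0' c2, d1.1, d1.2, d2.1, d2.2]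
  · refine (hμ.integral_le_of_forward hμper hw hwper ht
      ((h.contDiff_flux hH ht).sub (h'.contDiff_flux hH ht)) (fun i x => ?_)
      (L := L' * (1 + D)) (fun x => ?_) fun x => ?_).trans ?_
    · exact congrArg₂ (· - ·) (h.isTorusFun_flux ht i x) (h'.isTorusFun_flux ht i x)
    · obtain ⟨-, b2, b3⟩ := hHL _ _ (hR t ht x).1 (hR' t ht x).1
      rw [hG] at b2
      exact norm_smul_sub_smul_le hL0' hD (norm_nonneg _) b3 b2
        (by rw [abs_of_nonneg (hmr' t ht x).1]; exact (hmr' t ht x).2)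
    · have a1 := h.fokkerPlanck x t ht
      have a2 := h'.fokkerPlanck x t ht
      rw [laplacian_eq_sum (EuclideanSpace.basisFun (Fin N) ℝ)] at a1 a2
      simp only [sub_apply, Finset.sum_sub_distrib]
      rw [divergence_sub (h.contDiff_flux hH ht) (h'.contDiff_flux hH ht)]
      linarith
    · rw [add_comm (∫ x in unitCube N, _)]
      exact mul_le_mul_of_nonneg_right hC2
        (add_nonneg (energy_nonneg _ _) (integral_nonneg fun x => sq_nonneg _))
  · simp [energy, h.terminal, h'.terminal]
  · simp [energy, h.initial, h'.initial]

/-- For small horizons there is at most one classical solution close to the data. -/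
theorem exists_forall_eq_of_isCloseToData
    (hf_per : ∀ r ∈ Ici (0 : ℝ), IsTorusFun (fun x => f x r))
    (hf : ContDiffOn ℝ 3 (fun p : EuclideanSpace ℝ (Fin N) × ℝ => f p.1 p.2)
      (univ ×ˢ Ici (0 : ℝ)))
    (hH : ContDiff ℝ 3 H) (hm₀_per : IsTorusFun m₀) (hm₀ : ContDiff ℝ 2 m₀)
    (huT_per : IsTorusFun uT) (huT : ContDiff ℝ 2 uT) {a : ℝ} (ha : 0 < a) :
    ∃ T₀ : ℝ, 0 < T₀ ∧ ∀ T ∈ Ioc 0 T₀, ∀ u m u' m' : EuclideanSpace ℝ (Fin N) → ℝ → ℝ,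
      IsClassicalMFGSolution f H m₀ uT T u m → IsCloseToData m₀ uT T a u m →
      IsClassicalMFGSolution f H m₀ uT T u' m' → IsCloseToData m₀ uT T a u' m' →
        ∀ t ∈ Icc 0 T, ∀ x, u x t = u' x t ∧ m x t = m' x t := by
  obtain ⟨Mu, hMu⟩ := huT_per.exists_isC2Bounded huT
  obtain ⟨Mm, hMm⟩ := hm₀_per.exists_isC2Bounded hm₀
  have hMm0 : 0 ≤ Mm := (norm_nonneg _).trans (hMm.bound 0)
  obtain ⟨L, hL0, hL⟩ := exists_lipschitz_coupling hf_per hf (Mm + a)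
  obtain ⟨L', hL0', hL'⟩ := exists_lipschitz_hamiltonian hH (Mu + a)
  set C := 2 * (L + L') ^ 2 + 1 + (L' * (1 + (Mm + a))) ^ 2 with hC
  have hK : 0 < (C + C ^ 2) * (2 + C) + 1 := by positivity
  refine ⟨1 / ((C + C ^ 2) * (2 + C) + 1), by positivity, fun T hT u m u' m' h hc h' hc' => ?_⟩
  have hb : ∀ u m : EuclideanSpace ℝ (Fin N) → ℝ → ℝ, IsCloseToData m₀ uT T a u m →
      ∀ t ∈ Ioo 0 T, ∀ x, ‖gradient (fun y => u y t) x‖ ≤ Mu + a ∧ m x t ≤ Mm + a := by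
    intro u m hc t ht x
    obtain ⟨-, h2, h3⟩ := hc x t ht
    constructor
    · have e1 := norm_le_norm_add_norm_sub' (gradient (fun y => u y t) x) (gradient uT x)
      have e2 : ‖gradient uT x‖ ≤ Mu := by
        rw [gradient_eq_sharp, LinearIsometryEquiv.norm_map]
        exact hMu.bound_one x
      linarith
    · have e1 := (abs_le.1 h3).2
      have e2 := (le_abs_self _).trans (hMm.bound x)
      linarith
  refine h.eq_of_bounded hH hL0 hL0' (by positivity) hL hL' hT.1 (C := C)
    (by rw [hC]; linarith [sq_nonneg (L' * (1 + (Mm + a)))])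
    (by rw [hC]; linarith [sq_nonneg (L + L')]) ?_ h' (hb u m hc) (hb u' m' hc')
  have h1 := (le_div_iff₀ hK).1 hT.2
  linarith [hT.1]

end Uniqueness

end

theorem theorem1p4 (N : ℕ)
    (f : EuclideanSpace ℝ (Fin N) → ℝ → ℝ) (H : EuclideanSpace ℝ (Fin N) → ℝ)
    (m₀ uT : EuclideanSpace ℝ (Fin N) → ℝ)
    (hf_per : ∀ r ∈ Ici (0 : ℝ), IsTorusFun (fun x => f x r))
    (hf : ContDiffOn ℝ 3 (fun p : EuclideanSpace ℝ (Fin N) × ℝ => f p.1 p.2)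
      (univ ×ˢ Ici (0 : ℝ)))
    (hH : ContDiff ℝ 3 H)
    (hm₀_per : IsTorusFun m₀) (hm₀ : ContDiff ℝ 2 m₀) (hm₀_pos : ∀ x, 0 < m₀ x)
    (hm₀_mass : ∫ x in unitCube N, m₀ x = 1)
    (huT_per : IsTorusFun uT) (huT : ContDiff ℝ 2 uT) :
    ∀ a : ℝ, 0 < a → ∃ Tstar : ℝ, 0 < Tstar ∧ ∀ T ∈ Ioc 0 Tstar,
      ∃ u m : EuclideanSpace ℝ (Fin N) → ℝ → ℝ,
        IsClassicalMFGSolution f H m₀ uT T u m ∧ IsCloseToData m₀ uT T a u m ∧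
        ∀ u' m' : EuclideanSpace ℝ (Fin N) → ℝ → ℝ,
          IsClassicalMFGSolution f H m₀ uT T u' m' → IsCloseToData m₀ uT T a u' m' →
            ∀ x, ∀ t ∈ Icc 0 T, u' x t = u x t ∧ m' x t = m x t := by
  intro a ha
  obtain ⟨T₁, hT₁, hex⟩ := exists_isClassicalMFGSolution hf_per hf hH hm₀_per hm₀ hm₀_pos huT_per
    huT ha
  obtain ⟨T₂, hT₂, huniq⟩ := exists_forall_eq_of_isCloseToData hf_per hf hH hm₀_per hm₀ huT_per
    huT ha
  refine ⟨min T₁ T₂, lt_min hT₁ hT₂, fun T hT => ?_⟩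
  obtain ⟨u, m, hsol, hclose⟩ := hex T ⟨hT.1, hT.2.trans (min_le_left _ _)⟩
  exact ⟨u, m, hsol, hclose, fun u' m' hsol' hclose' x t ht =>
    huniq T ⟨hT.1, hT.2.trans (min_le_right _ _)⟩ u' m' u m hsol' hclose' hsol hclose t ht x⟩
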